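/- **Conventions.** An $n$-marked plane tropical curve $(\Gamma,h,x_1,\dots,x_n)$ is a finite metric graph $\Gamma$ with vertices of valence $\ge 3$, bounded edges of positive length and unbounded edges (ends), $n$ distinct ends $x_i$ of which are marked, together with a continuous map $h:\Gamma\to\mathbb R^2$ which on each edge is affine with integral direction vector, is balanced at each vertex (the outgoing direction vectors sum to $0$) and contracts the $x_i$. Its genus is $1-\#\{\text{vertices}\}+\#\{\text{bounded edges}\}$. It has degree $d$ if its unmarked ends have the directions $(-1,0),(0,-1),(1,1)$, each $d$ times; it passes through $(p_1,\dots,p_n)$ if $h(x_i)=p_i$ for all $i$. Curves are identified under isometries of $\Gamma$ compatible with $h$ and the $x_i$. A rational (elliptic) curve is a connected one of genus $0$ ($1$); the $j$-invariant $j(C)$ of an elliptic curve is the length of its cycle. The multiplicity $\operatorname{mult}(V)$ of a vertex with directions $u,v,-u-v$ and no marked end is $|\det(u,v)|$, and $\operatorname{mult}(C')$ of a $3$-valent curve is the product of the $\operatorname{mult}(V)$ over the vertices without marked end. *Multiplicity of $\operatorname{ev}\times j$.* Let $C$ be an elliptic curve of degree $d$, $n=3d-1$, whose combinatorial type $\alpha$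 has a cell $\mathcal M^\alpha$ of dimension $3d+n$. In the coordinates given by the position of a root vertex and the lengths of the $e$ bounded edges, $\mathcal M^\alpha\subset\mathbb R^{2+e}$ is cut out by positivity of lengths and the two linear equations $a_1,a_2$ saying that the cycle closes up. Then $\operatorname{mult}_{\operatorname{ev}\times j}(C)=\omega(\alpha)\cdot|\det(\operatorname{ev}\times j)|$, where the determinant of $C\mapsto(h(x_1),\dots,h(x_n),j(C))$ is taken with respect to a basis of the lattice of integral points of the linear span of $\mathcal M^\alpha$, and the weight $\omega(\alpha)$ is as follows. - If $h$ maps the cycle neither to a point nor into a line, $\omega(\alpha)$ is the index of the lattice map $(a_1,a_2):\mathbb Z^{2+e}\to\mathbb Z^2$. - If $h$ maps the cycle onto a segment, $\omega(\alpha)=0$ unless there is a $4$-valent vertex on the cycle; if there is one, with cycle edges of directions $ku,mu$, $\gcd(k,m)=1$, and another edge of direction $v$, then $\omega(\alpha)=|\det(u,v)|$, or $\tfrac12|\det(u,v)|$ if $k=m=1$ and no marked end is attached to the cycle. - If $h$ contracts the cycle, $\omega(\alpha)=\tfrac12(|\det(u,v)|-1)$ if there is a $5$-valent vertex without marked end on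 the cycle, $u,v$ being the directions of two of its three other edges, and $\omega(\alpha)=0$ otherwise. *Tropical general position.* A plane tropical curve (with its marked ends removed) is simple if it is $3$-valent, $h$ is an immersion, every point of $\mathbb R^2$ has at most two preimages, and if it has two, neither is a vertex. Points $p_1,\dots,p_n$ are in tropical general position if every (possibly disconnected) plane tropical curve through them, of any genus $g$, with $x$ unmarked non-contracted ends of any directions, no contracted connected component and $n\ge g+x-1$, is simple, has none of the $p_i$ as image of a vertex or of two different points, and satisfies $n=g+x-1$. **Lemma.** Let $d\ge 1$, $n=3d-1$, and let $p_1,\dots,p_n\in\mathbb R^2$ be in tropical general position. Then there is a constant $L$ such that for every $l>L$ and every rational curve $C'$ of degree $d$ through $(p_1,\dots,p_n)$ the following holds. Consider the curves with $j$-invariant $l$ which are built out of $C'$ in one of the following two ways: 1. by attaching a contracted loop at a $3$-valent vertex of $C'$ without marked end; 2. by splitting two edges of $C'$ whose images cross in one point into two edges each, at the crossing, and joining the two new vertices by a contracted bounded edge. At every vertex of $C'$ without marked end (these are $3$-valent) and at every crossing there is exactly one length of the new edge for which the resulting curve has $j$-invariant $l$. All resulting curves $C$ are elliptic plane tropical curves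 of degree $d$ through $(p_1,\dots,p_n)$ with $j(C)=l$, in cells of top dimension $3d+n$. Up to isomorphism there are finitely many of them, and $$\sum_{C}\operatorname{mult}_{\operatorname{ev}\times j}(C)=\binom{d-1}{2}\cdot\operatorname{mult}(C'),$$ where the sum is over the isomorphism classes of these curves. -/

import Mathlib

noncomputable section

open scoped Classical

namespace TropicalElliptic

/-- The determinant of two integral plane vectors. -/
def det2 (a b : Fin 2 → ℤ) : ℤ := a 0 * b 1 - a 1 * b 0

/-- A finite metric graph `Γ` with bounded edges and unbounded edges (ends), together with a map
`h : Γ → ℝ²` that is affine with integral slope on every edge and balanced at every vertex, and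
with `n` marked ends contracted by `h`.  Vertices of arbitrary valence are allowed here.

A flag is a vertex together with an edge starting at it.  `inv` exchanges the two flags of a bounded
edge and fixes the only flag of an end.  `dir f` is the direction of the flag `f`, and `h` is
determined by its values `pos` at the vertices: the point at distance `s` from the vertex `bdry f`
on the edge of `f` is mapped to `pos (bdry f) + s • dir f`.  Ends have no length, which is recorded
by the value `0` of `len`. -/
structure PlaneGraph (n : ℕ) where
  V : Type
  F : Type
  [fintypeV : Fintype V]
  [fintypeF : Fintype F]
  bdry : F → V
  inv : F → F
  inv_inv : ∀ f, inv (inv f) = f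
  len : F → ℝ
  len_inv : ∀ f, len (inv f) = len f
  len_pos : ∀ f, inv f ≠ f → 0 < len f
  len_end : ∀ f, inv f = f → len f = 0
  dir : F → Fin 2 → ℤ
  dir_inv : ∀ f, inv f ≠ f → dir (inv f) = - dir f
  pos : V → Fin 2 → ℝ
  pos_inv : ∀ f i, pos (bdry (inv f)) i = pos (bdry f) i + len f * (dir f i : ℝ)
  balanced : ∀ v, (∑ f, if bdry f = v then dir f else 0) = 0
  mark : Fin n → F
  mark_injective : Function.Injective mark
  mark_end : ∀ i, inv (mark i) = mark i
  mark_dir : ∀ i, dir (mark i) = 0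

attribute [instance] PlaneGraph.fintypeV PlaneGraph.fintypeF

namespace PlaneGraph

variable {n : ℕ}

/-! ### Basic notions -/

/-- The flag belongs to a bounded edge. -/
def IsBounded (C : PlaneGraph n) (f : C.F) : Prop := C.inv f ≠ f

/-- The flag belongs to one of the marked ends. -/
def IsMarked (C : PlaneGraph n) (f : C.F) : Prop := ∃ i, C.mark i = f

/-- The flag belongs to an end that is not marked. -/
def IsFreeEnd (C : PlaneGraph n) (f : C.F) : Prop := C.inv f = f ∧ ¬ C.IsMarked f

/-- The valence of a vertex (a loop counts twice, marked ends count). -/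
def val (C : PlaneGraph n) (v : C.V) : ℕ := (Finset.univ.filter fun f => C.bdry f = v).card

/-- No marked end is attached to the vertex. -/
def IsUnmarkedVertex (C : PlaneGraph n) (v : C.V) : Prop := ∀ i, C.bdry (C.mark i) ≠ v

/-- `C` is an `n`-marked plane tropical curve: all vertices have valence at least `3`. -/
def IsTropicalCurve (C : PlaneGraph n) : Prop := ∀ v, 3 ≤ C.val v

/-- Two vertices are joined by an edge (or equal and carrying an end). -/
def Adj (C : PlaneGraph n) (v w : C.V) : Prop := ∃ g, C.bdry g = v ∧ C.bdry (C.inv g) = w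

def Connected (C : PlaneGraph n) : Prop :=
  Nonempty C.V ∧ ∀ v w, Relation.ReflTransGen C.Adj v w

/-- The number of bounded edges: every bounded edge has exactly two flags. -/
def numBounded (C : PlaneGraph n) : ℕ := (Finset.univ.filter fun f => C.IsBounded f).card / 2

/-- The number of ends that are not marked. -/
def numFreeEnds (C : PlaneGraph n) : ℕ := (Finset.univ.filter fun f => C.IsFreeEnd f).card

/-- The genus `1 - #vertices + #bounded edges`, that is `1 - dim H₀ + dim H₁`. -/
def genus (C : PlaneGraph n) : ℤ := 1 - (Fintype.card C.V : ℤ) + (C.numBounded : ℤ)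

/-- `C` has degree `d`: the directions of its unmarked ends are `(-1,0)`, `(0,-1)`, `(1,1)`, each
occurring `d` times. -/
def HasDegree (C : PlaneGraph n) (d : ℕ) : Prop :=
  (Finset.univ.filter fun f => C.IsFreeEnd f).val.map C.dir =
    Multiset.replicate d ![-1, 0] + Multiset.replicate d ![0, -1] + Multiset.replicate d ![1, 1]

/-- The evaluation `h(xᵢ)` at the `i`-th marked end. -/
def ev (C : PlaneGraph n) (i : Fin n) : Fin 2 → ℝ := C.pos (C.bdry (C.mark i))

/-! ### Isomorphisms -/

/-- Isomorphisms of marked plane curves: they preserve the graph, the lengths of the bounded edges,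
the marked ends and the map to the plane. -/
structure Iso (C D : PlaneGraph n) where
  onV : C.V ≃ D.V
  onF : C.F ≃ D.F
  bdry_eq : ∀ f, D.bdry (onF f) = onV (C.bdry f)
  inv_eq : ∀ f, D.inv (onF f) = onF (C.inv f)
  len_eq : ∀ f, D.len (onF f) = C.len f
  dir_eq : ∀ f, D.dir (onF f) = C.dir f
  pos_eq : ∀ v, D.pos (onV v) = C.pos v
  mark_eq : ∀ i, D.mark i = onF (C.mark i)

def isoSetoid (n : ℕ) : Setoid (PlaneGraph n) where
  r C D := Nonempty (Iso C D)
  iseqv :=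
    { refl := fun C => ⟨⟨Equiv.refl _, Equiv.refl _, by simp, by simp, by simp, by simp, by simp,
        by simp⟩⟩
      symm := by
        rintro C D ⟨φ⟩
        refine ⟨⟨φ.onV.symm, φ.onF.symm, fun f => ?_, fun f => ?_, fun f => ?_, fun f => ?_,
          fun v => ?_, fun i => ?_⟩⟩
        · rw [Equiv.eq_symm_apply, ← φ.bdry_eq, Equiv.apply_symm_apply]
        · rw [Equiv.eq_symm_apply, ← φ.inv_eq, Equiv.apply_symm_apply]
        · rw [← φ.len_eq, Equiv.apply_symm_apply]
        · rw [← φ.dir_eq, Equiv.apply_symm_apply]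
        · rw [← φ.pos_eq, Equiv.apply_symm_apply]
        · rw [Equiv.eq_symm_apply, ← φ.mark_eq]
      trans := by
        rintro C D E ⟨φ⟩ ⟨ψ⟩
        exact ⟨⟨φ.onV.trans ψ.onV, φ.onF.trans ψ.onF, by simp [ψ.bdry_eq, φ.bdry_eq],
          by simp [ψ.inv_eq, φ.inv_eq], by simp [ψ.len_eq, φ.len_eq],
          by simp [ψ.dir_eq, φ.dir_eq], by simp [ψ.pos_eq, φ.pos_eq],
          by simp [ψ.mark_eq, φ.mark_eq]⟩⟩ }

/-- Isomorphism classes of marked plane graphs. -/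
def IsoClass (n : ℕ) : Type 1 := Quotient (isoSetoid n)

/-- The isomorphism class of `C`. -/
def isoClass (C : PlaneGraph n) : IsoClass n := Quotient.mk (isoSetoid n) C

/-! ### Points on edges, crossings and simple curves -/

/-- An interior point of an edge which is not a marked end: the point at distance `s` from the
vertex of the flag `flag`. -/
structure EdgePoint (C : PlaneGraph n) where
  flag : C.F
  s : ℝ
  s_pos : 0 < s
  s_lt : C.IsBounded flag → s < C.len flag
  unmarked : ¬ C.IsMarked flag

namespace EdgePoint

/-- The image in the plane. -/
def image {C : PlaneGraph n} (x : C.EdgePoint) : Fin 2 → ℝ :=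
  fun i => C.pos (C.bdry x.flag) i + x.s * (C.dir x.flag i : ℝ)

/-- The two descriptions give the same point of the graph (a point of a bounded edge is described
from either of the two flags of this edge). -/
def Same {C : PlaneGraph n} (x y : C.EdgePoint) : Prop :=
  (y.flag = x.flag ∧ y.s = x.s) ∨
    (C.IsBounded x.flag ∧ y.flag = C.inv x.flag ∧ y.s = C.len x.flag - x.s)

end EdgePoint

/-- Simple curves: the graph is `3`-valent, `h` is an immersion away from the (contracted) marked
ends, every point of the plane has at most two preimages, and if it has two, then none of them is
a vertex.  (The vertices include those at which the marked ends are attached.) -/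
structure IsSimple (C : PlaneGraph n) : Prop where
  trivalent : ∀ v, C.val v = 3
  dir_ne_zero : ∀ f, ¬ C.IsMarked f → C.dir f ≠ 0
  immersed : ∀ f g, ¬ C.IsMarked f → ¬ C.IsMarked g → f ≠ g → C.bdry f = C.bdry g →
    ∀ a b : ℕ, 0 < a → 0 < b → a • C.dir f ≠ b • C.dir g
  pos_injective : Function.Injective C.pos
  vertex_ne_point : ∀ (v : C.V) (x : C.EdgePoint), x.image ≠ C.pos v
  at_most_two : ∀ x y z : C.EdgePoint, x.image = y.image → y.image = z.image →
    x.Same y ∨ y.Same z ∨ x.Same z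

/-- Tropical general position of `n` points.  Every plane tropical curve through the points,
possibly disconnected, of any genus `g` (`= 1 - dim H₀ + dim H₁`) and with any number `x` of
unmarked ends (of any directions), with `n ≥ g + x - 1`, is simple, with none of the points at the
image of a vertex, and satisfies `n = g + x - 1`.  A curve through the points is presented as an
`n`-marked curve, the marked ends being attached at preimages of the points; the unmarked ends are
not contracted, and no connected component is contracted (each one has an unmarked end).  That the
points are not images of vertices is part of `IsSimple` for the marked curve: the marked ends are
attached at `3`-valent vertices, i.e. at interior points of edges of the curve without its marked
ends. -/
def InTropicalGeneralPosition (p : Fin n → Fin 2 → ℝ) : Prop :=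
  ∀ C : PlaneGraph n, C.IsTropicalCurve →
    (∀ f, C.IsFreeEnd f → C.dir f ≠ 0) →
    (∀ v, ∃ f, C.IsFreeEnd f ∧ Relation.ReflTransGen C.Adj v (C.bdry f)) →
    (∀ i, C.ev i = p i) →
    C.genus + (C.numFreeEnds : ℤ) - 1 ≤ (n : ℤ) →
    C.IsSimple ∧ (n : ℤ) = C.genus + (C.numFreeEnds : ℤ) - 1

/-! ### The multiplicity of a trivalent curve -/

/-- The area of the parallelogram spanned by the directions of two edges at `v`.  For three balanced
directions it does not depend on the choice of the two edges; the largest value is taken, so that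
contracted edges at `v` are ignored. -/
def vertexMult (C : PlaneGraph n) (v : C.V) : ℕ :=
  (Finset.univ.filter fun x : C.F × C.F => C.bdry x.1 = v ∧ C.bdry x.2 = v).sup
    fun x => (det2 (C.dir x.1) (C.dir x.2)).natAbs

/-- The multiplicity of a `3`-valent curve: the product of the multiplicities of its vertices.  A
vertex at which a marked end is attached is not a vertex of the curve without markings, and does
not contribute. -/
def mult (C : PlaneGraph n) : ℕ :=
  ∏ v ∈ Finset.univ.filter fun v => C.IsUnmarkedVertex v, C.vertexMult v

/-! ### The cycle and the j-invariant -/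

/-- Adjacency by an edge other than the one of `f`. -/
def AdjAvoid (C : PlaneGraph n) (f : C.F) (v w : C.V) : Prop :=
  ∃ g, g ≠ f ∧ g ≠ C.inv f ∧ C.bdry g = v ∧ C.bdry (C.inv g) = w

/-- The bounded edge of `f` belongs to a cycle: its endpoints can be joined without using it.  In a
connected graph of genus `1` these are the edges of the unique cycle. -/
def OnCycle (C : PlaneGraph n) (f : C.F) : Prop :=
  C.IsBounded f ∧ Relation.ReflTransGen (C.AdjAvoid f) (C.bdry f) (C.bdry (C.inv f))

def VertexOnCycle (C : PlaneGraph n) (v : C.V) : Prop := ∃ f, C.OnCycle f ∧ C.bdry f = v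

/-- For a function `ℓ` on the bounded edges, the sum of its values over the edges of the cycle
(every edge has two flags). -/
def cycleSum (C : PlaneGraph n) {K : Type*} [Field K] (ℓ : C.F → K) : K :=
  (∑ f ∈ Finset.univ.filter fun f => C.OnCycle f, ℓ f) / 2

/-- The tropical `j`-invariant of a connected curve of genus at most `1`: the length of its cycle
(`0` for rational curves). -/
def j (C : PlaneGraph n) : ℝ := C.cycleSum C.len

/-- The deficiency. -/
def deficiency (C : PlaneGraph n) : ℕ :=
  if C.genus = 1 ∧ ∀ f, C.OnCycle f → C.dir f = 0 then 2
  else if C.genus = 1 ∧ ∀ f g, C.OnCycle f → C.OnCycle g → det2 (C.dir f) (C.dir g) = 0 then 1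
  else 0

/-! ### The cells of the moduli space, their weights, and the multiplicity of `ev × j` -/

/-- The lattice of the linear span of the cell of curves of the combinatorial type of `C`.  The
coordinates are the position of a root vertex and the lengths of the bounded edges, subject to the
condition that the cycle closes up.  To avoid the choice of a root vertex, the positions of all
vertices are recorded, which (the graph being connected) are determined by that of any one of them;
they are all integral if the position of the root and the lengths are. -/
def cellLattice (C : PlaneGraph n) : Submodule ℤ ((C.V → Fin 2 → ℤ) × (C.F → ℤ)) where
  carrier := {x | (∀ f, x.2 (C.inv f) = x.2 f) ∧ (∀ f, C.inv f = f → x.2 f = 0) ∧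
    ∀ f i, x.1 (C.bdry (C.inv f)) i = x.1 (C.bdry f) i + x.2 f * C.dir f i}
  zero_mem' := by simp
  add_mem' := by
    rintro x y ⟨hx1, hx2, hx3⟩ ⟨hy1, hy2, hy3⟩
    refine ⟨fun f => ?_, fun f hf => ?_, fun f i => ?_⟩
    · simp [hx1, hy1]
    · simp [hx2 f hf, hy2 f hf]
    · simp only [Prod.fst_add, Prod.snd_add, Pi.add_apply, hx3, hy3]
      ring
  smul_mem' := by
    rintro c x ⟨hx1, hx2, hx3⟩
    refine ⟨fun f => ?_, fun f hf => ?_, fun f i => ?_⟩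
    · simp [hx1]
    · simp [hx2 f hf]
    · simp only [Prod.smul_fst, Prod.smul_snd, Pi.smul_apply, hx3, smul_eq_mul]
      ring

/-- The dimension of the cell of curves of the combinatorial type of `C`. -/
def cellDim (C : PlaneGraph n) : ℕ := Module.finrank ℤ C.cellLattice

/-- The linear map `ev × j` on the cell of `C`. -/
def evj (C : PlaneGraph n) (x : C.cellLattice) : (Fin n × Fin 2) ⊕ Unit → ℚ
  | Sum.inl (i, k) => ((x : (C.V → Fin 2 → ℤ) × (C.F → ℤ)).1 (C.bdry (C.mark i)) k : ℚ)
  | Sum.inr _ => C.cycleSum fun f => ((x : (C.V → Fin 2 → ℤ) × (C.F → ℤ)).2 f : ℚ)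

/-- The absolute value of the determinant of `ev × j` with respect to a lattice basis of the cell of
`C` (it does not depend on the basis).  It is only used for cells of dimension `2n + 1`. -/
def absDetEvj (C : PlaneGraph n) : ℚ :=
  if h : Nonempty (Module.Basis ((Fin n × Fin 2) ⊕ Unit) ℤ C.cellLattice) then
    |(Matrix.of fun i k => C.evj (h.some k) i).det|
  else 0

/-- Weight of a cell of deficiency `0`: the index of the lattice map `ℤ^{2 + #bounded edges} → ℤ²`
given by the two equations which say that the cycle closes up.  Its image is generated by the
directions of the edges of the cycle. -/
def weightZero (C : PlaneGraph n) : ℚ :=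
  (AddSubgroup.closure {u : Fin 2 → ℤ | ∃ f, C.OnCycle f ∧ C.dir f = u}).index

/-- Weight of a cell of deficiency `1` (and of top dimension).  If the `4`-valent vertex is on the
cycle, let the directions of the edges of the cycle there be `n•u` and `m•u` with `gcd n m = 1`, and
let `v` be the direction of another edge there.  Then `|det (u, v)|` is the greatest common divisor
of `|det (n•u, v)|` and `|det (m•u, v)|`.  The weight is `|det (u, v)|`, respectively one half of it
if `n = m = 1` and no marked end is attached to the cycle. -/
def weightOne (C : PlaneGraph n) : ℚ :=
  ∑ v ∈ Finset.univ.filter fun v => C.val v = 4 ∧ C.VertexOnCycle v,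
    (if (∀ f g, C.OnCycle f → C.OnCycle g → C.bdry f = v → C.bdry g = v → C.dir f = C.dir g) ∧
        ∀ w, C.VertexOnCycle w → C.IsUnmarkedVertex w then (1 / 2 : ℚ) else 1) *
      (((Finset.univ.filter fun x : C.F × C.F =>
          C.bdry x.1 = v ∧ C.bdry x.2 = v ∧ C.OnCycle x.1 ∧ ¬ C.OnCycle x.2).gcd
        fun x => (det2 (C.dir x.1) (C.dir x.2)).natAbs : ℕ) : ℚ)

/-- Weight of a cell of deficiency `2` (and of top dimension): `(|det (u, v)| - 1) / 2` if the
contracted cycle is adjacent to a `5`-valent vertex, where `u` and `v` are the directions of two of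
the three other edges there, none of which is a marked end, and `0` otherwise. -/
def weightTwo (C : PlaneGraph n) : ℚ :=
  ∑ v ∈ Finset.univ.filter fun v => C.val v = 5 ∧ C.VertexOnCycle v ∧ C.IsUnmarkedVertex v,
    ((C.vertexMult v : ℚ) - 1) / 2

/-- The weight of the cell (of top dimension) of the moduli space of elliptic curves which contains
the curve `C` of genus `1`. -/
def weight (C : PlaneGraph n) : ℚ :=
  if C.deficiency = 0 then C.weightZero
  else if C.deficiency = 1 then C.weightOne
  else C.weightTwo

/-- The `ev × j`-multiplicity of a curve of genus `1` in a cell of top dimension: the weight of the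
cell times the absolute value of the determinant of `ev × j`. -/
def evjMult (C : PlaneGraph n) : ℚ := C.weight * C.absDetEvj

/-! ### Attaching contracted edges and loops -/

/-- Attach a contracted bounded edge of length `m` to two (possibly equal) vertices with the same
image. -/
def attachEdge (C : PlaneGraph n) (v w : C.V) (hvw : C.pos v = C.pos w) (m : ℝ) (hm : 0 < m) :
    PlaneGraph n where
  V := C.V
  F := C.F ⊕ Bool
  bdry := Sum.elim C.bdry fun b => if b then w else v
  inv := Sum.map C.inv Bool.not
  inv_inv := by rintro (f | b) <;> simp [C.inv_inv]
  len := Sum.elim C.len fun _ => m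
  len_inv := by rintro (f | b) <;> simp [C.len_inv]
  len_pos := by
    rintro (f | b) h
    · exact C.len_pos f fun h' => h (by simp [h'])
    · exact hm
  len_end := by
    rintro (f | b) h
    · exact C.len_end f (by simpa using h)
    · simp at h
  dir := Sum.elim C.dir fun _ => 0
  dir_inv := by
    rintro (f | b) h
    · exact C.dir_inv f fun h' => h (by simp [h'])
    · simp
  pos := C.pos
  pos_inv := by
    rintro (f | b) i
    · simpa using C.pos_inv f i
    · cases b <;> simp [hvw]
  balanced := by
    intro u
    have h := C.balanced u
    rw [Fintype.sum_sum_type]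
    simp only [Sum.elim_inl, Sum.elim_inr]
    rw [Finset.sum_eq_zero (s := (Finset.univ : Finset Bool)) fun b _ => by split <;> split <;> rfl, add_zero]
    exact h
  mark := fun i => Sum.inl (C.mark i)
  mark_injective := Sum.inl_injective.comp C.mark_injective
  mark_end := by simp [C.mark_end]
  mark_dir := by simp [C.mark_dir]

/-- Attach a contracted loop of length `m` at the vertex `v`. -/
def attachLoop (C : PlaneGraph n) (v : C.V) (m : ℝ) (hm : 0 < m) : PlaneGraph n :=
  C.attachEdge v v rfl m hm

/-- Split an edge in two by making an interior point `x` of it a new (divalent) vertex `none`.  Of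
the two new flags, both starting at `none`, `false` points back to the vertex of `x.flag` and `true`
points forward; if the edge is an end, then the edge of `true` is an end again. -/
def subdivide (C : PlaneGraph n) (x : C.EdgePoint) : PlaneGraph n where
  V := Option C.V
  F := C.F ⊕ Bool
  bdry := Sum.elim (fun f => some (C.bdry f)) fun _ => none
  inv := Sum.elim
    (fun f => if f = x.flag then Sum.inr false
      else if f = C.inv x.flag then Sum.inr true else Sum.inl (C.inv f))
    (fun b => if b then (if C.inv x.flag = x.flag then Sum.inr true else Sum.inl (C.inv x.flag))
      else Sum.inl x.flag)
  inv_inv := by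
    have key := C.inv_inv
    rintro (f | b)
    · by_cases h1 : f = x.flag
      · simp [h1]
      · by_cases h2 : f = C.inv x.flag
        · have : C.inv x.flag ≠ x.flag := fun h => h1 (h2.trans h)
          simp [h2, this]
        · have h3 : C.inv f ≠ x.flag := fun h => h2 (by rw [← h, key])
          have h4 : C.inv f ≠ C.inv x.flag := fun h => h1 (by rw [← key f, h, key])
          simp [h1, h2, h3, h4, key]
    · cases b
      · simp
      · by_cases h : C.inv x.flag = x.flag <;> simp [h]
  len := Sum.elim
    (fun f => if f = x.flag then x.s else if f = C.inv x.flag then C.len x.flag - x.s else C.len f)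
    (fun b => if b then (if C.inv x.flag = x.flag then 0 else C.len x.flag - x.s) else x.s)
  len_inv := by
    have key := C.inv_inv
    rintro (f | b)
    · by_cases h1 : f = x.flag
      · simp [h1]
      · by_cases h2 : f = C.inv x.flag
        · have : C.inv x.flag ≠ x.flag := fun h => h1 (h2.trans h)
          simp [h2, this]
        · have h3 : C.inv f ≠ x.flag := fun h => h2 (by rw [← h, key])
          have h4 : C.inv f ≠ C.inv x.flag := fun h => h1 (by rw [← key f, h, key])
          simp [h1, h2, h3, h4, C.len_inv]
    · cases b
      · simp
      · by_cases h : C.inv x.flag = x.flag <;> simp [h]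
  len_pos := by
    rintro (f | b) h
    · by_cases h1 : f = x.flag
      · simp [h1, x.s_pos]
      · by_cases h2 : f = C.inv x.flag
        · have h3 : C.inv x.flag ≠ x.flag := fun h => h1 (h2.trans h)
          simpa [h2, h3] using x.s_lt h3
        · have h3 : C.inv f ≠ f := by simpa [h1, h2] using h
          simpa [h1, h2] using C.len_pos f h3
    · cases b
      · simp [x.s_pos]
      · by_cases h3 : C.inv x.flag = x.flag
        · simp [h3] at h
        · simpa [h3] using x.s_lt h3
  len_end := by
    rintro (f | b) h
    · by_cases h1 : f = x.flag
      · simp [h1] at h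
      · by_cases h2 : f = C.inv x.flag
        · have h3 : C.inv x.flag ≠ x.flag := fun h => h1 (h2.trans h)
          simp [h2, h3] at h
        · have h3 : C.inv f = f := by simpa [h1, h2] using h
          simpa [h1, h2] using C.len_end f h3
    · cases b
      · simp at h
      · by_cases h3 : C.inv x.flag = x.flag
        · simp [h3]
        · simp [h3] at h
  dir := Sum.elim C.dir fun b => if b then C.dir x.flag else - C.dir x.flag
  dir_inv := by
    have key := C.inv_inv
    rintro (f | b) h
    · by_cases h1 : f = x.flag
      · simp [h1]
      · by_cases h2 : f = C.inv x.flag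
        · have h3 : C.inv x.flag ≠ x.flag := fun h => h1 (h2.trans h)
          simp [h2, h3, C.dir_inv _ h3]
        · have h3 : C.inv f ≠ f := by simpa [h1, h2] using h
          simpa [h1, h2] using C.dir_inv f h3
    · cases b
      · simp
      · by_cases h3 : C.inv x.flag = x.flag
        · simp [h3] at h
        · simp [h3, C.dir_inv _ h3]
  pos := fun v => v.elim x.image C.pos
  pos_inv := by
    have key := C.inv_inv
    rintro (f | b) i
    · by_cases h1 : f = x.flag
      · simp [h1, EdgePoint.image]
      · by_cases h2 : f = C.inv x.flag
        · have h3 : C.inv x.flag ≠ x.flag := fun h => h1 (h2.trans h)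
          simp [h2, h3, EdgePoint.image, C.dir_inv _ h3, C.pos_inv]
          ring
        · simpa [h1, h2] using C.pos_inv f i
    · cases b
      · simp [EdgePoint.image]
      · by_cases h3 : C.inv x.flag = x.flag
        · simp [h3]
        · simp [h3, EdgePoint.image, C.pos_inv]
          ring
  balanced := by
    intro u
    cases u with
    | none => simp [Fintype.sum_sum_type]
    | some u => simpa [Fintype.sum_sum_type] using C.balanced u
  mark := fun i => Sum.inl (C.mark i)
  mark_injective := Sum.inl_injective.comp C.mark_injective
  mark_end := by
    intro i
    have h1 : C.mark i ≠ x.flag := fun h => x.unmarked ⟨i, h⟩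
    have h2 : C.mark i ≠ C.inv x.flag := fun h => h1 (by
      rw [← C.inv_inv x.flag, ← h, C.mark_end])
    simp [h1, h2, C.mark_end]
  mark_dir := by simp [C.mark_dir]

/-- A crossing of (the images of) two different edges `e₁`, `e₂`: they have a common point, in
the interiors of both edges, and are not parallel. -/
structure Crossing (C : PlaneGraph n) where
  fst : C.EdgePoint
  snd : C.EdgePoint
  flag_ne : snd.flag ≠ fst.flag
  flag_ne_inv : snd.flag ≠ C.inv fst.flag
  image_eq : fst.image = snd.image
  transverse : det2 (C.dir fst.flag) (C.dir snd.flag) ≠ 0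

namespace Crossing

variable {C : PlaneGraph n}

/-- The second point of the crossing in the graph subdivided at the first one. -/
def snd' (c : C.Crossing) : (C.subdivide c.fst).EdgePoint where
  flag := Sum.inl c.snd.flag
  s := c.snd.s
  s_pos := c.snd.s_pos
  s_lt := by
    intro h
    have h' : C.IsBounded c.snd.flag := fun h' => h (by
      simp [subdivide, c.flag_ne, c.flag_ne_inv, h'])
    simpa [subdivide, c.flag_ne, c.flag_ne_inv] using c.snd.s_lt h'
  unmarked := by
    rintro ⟨i, hi⟩
    exact c.snd.unmarked ⟨i, Sum.inl_injective hi⟩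

/-- Split the two crossing edges at the crossing, and join the two new vertices by a contracted
bounded edge of length `m`. -/
def attach (c : C.Crossing) (m : ℝ) (hm : 0 < m) : PlaneGraph n :=
  ((C.subdivide c.fst).subdivide c.snd').attachEdge (some none) none
    (by
      funext i
      have h := congrFun c.image_eq i
      simpa [subdivide, snd', EdgePoint.image] using h) m hm

end Crossing

/-- The isomorphism classes of curves with `j`-invariant `l` that are built out of the curve `C` by
attaching a contracted loop at a `3`-valent vertex of `C` (other than the vertices at which the
marked ends are attached), or a contracted bounded edge at a crossing of two edges. -/
def ellipticLifts (C : PlaneGraph n) (l : ℝ) : Set (IsoClass n) :=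
  {q | (∃ (v : C.V) (m : ℝ) (hm : 0 < m), C.val v = 3 ∧ C.IsUnmarkedVertex v ∧
          (C.attachLoop v m hm).j = l ∧ q = (C.attachLoop v m hm).isoClass) ∨
       (∃ (c : C.Crossing) (m : ℝ) (hm : 0 < m),
          (c.attach m hm).j = l ∧ q = (c.attach m hm).isoClass)}

end PlaneGraph

end TropicalElliptic

end

noncomputable section

open scoped Classical

namespace TropicalElliptic

namespace PlaneGraph

/-! ### Trees -/

section Trees

variable {n : ℕ} (C : PlaneGraph n)

/-! General position makes `C'` trivalent, and a connected curve of genus 0 is a tree. Every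
multiplicity in the lemma is then read as the index of a map of lattices (`absDetEvj_eq_index`), so
that the product rule `index_range_prod` for the index of a pair of maps does the work of
determinant expansions.

For `C'` itself, evaluation at the marked ends is injective on the lattice of the cell, and its
image has index mult(C') (`IsGeneric.index_evHom_range`). The reason is a ranking of the vertices:
applied to the curve cut out by a set of vertices, general position forces every proper set
containing the marked vertices to be joined to some further vertex by two edges
(`IsGeneric.exists_two_flags`). Ordered in this way, the linear system for positions and lengths is
block triangular, with one block of determinant ±mult(V) for each unmarked vertex V.

A contracted edge between two vertices of a tree imposes that their positions agree, and it adds one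
free length, which takes care of the j-invariant. Hence the determinant of ev × j is the index of ev
on the kernel of the difference map `diffHom` (`attachEdge_absDetEvj`). For a loop there is no
condition, so the multiplicity is (mult(V) - 1)/2 · mult(C'). For a crossing of edges with
directions u and v, the weight is the index of the image of `diffHom`, so weight times determinant
is the index of the pair (difference, ev). Taking the two maps in the other order gives |det(u,v)| ·
mult(C'), because curves with fixed marked points only move the two new vertices along u and v
(`Crossing.attach_evjMult`).

The sum therefore reduces to Σ_V (mult(V) - 1)/2 + Σ |det(u,v)| = (d-1)(d-2)/2. There are 3d - 2
unmarked vertices, so this is the identity Σ_V mult(V) + 2 Σ |det(u,v)| = d²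
(`IsSimple.sum_crossings`), which expresses d² as the normalized area of the dual subdivision of the
triangle of size d. It is proved here as a Bézout identity for the intersection of the curve with
itself, by a sum of signs over pairs of flags that balancing makes computable.

The constant L bounds the part of the cycle already present in `C'`, uniformly in `C'`
(`exists_pathLength_bound`), so that the new edge has positive length when l > L. Different vertices
and crossings give non-isomorphic curves because the image of the contracted edge is an invariant
(`lift_injective`). -/

lemma inv_injective : Function.Injective C.inv :=
  Function.LeftInverse.injective (g := C.inv) C.inv_inv

lemma isBounded_inv {f : C.F} : C.IsBounded (C.inv f) ↔ C.IsBounded f := by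
  unfold IsBounded
  rw [C.inv_inv, ne_comm]

/-- `inv` is an involution without fixed points on the bounded flags, so their number vanishes
modulo 2. This makes the division by 2 in `numBounded` exact. -/
lemma even_card_bounded : Even (Finset.univ.filter fun f => C.IsBounded f).card := by
  rw [← ZMod.natCast_eq_zero_iff_even, Finset.card_eq_sum_ones, Nat.cast_sum]
  refine Finset.sum_involution (fun f _ => C.inv f) (fun f _ => by decide) (fun f hf _ => ?_)
    (fun f hf => ?_) (fun f _ => C.inv_inv f)
  · exact (Finset.mem_filter.1 hf).2
  · simpa [C.isBounded_inv] using hf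

lemma two_mul_numBounded :
    2 * C.numBounded = (Finset.univ.filter fun f => C.IsBounded f).card :=
  Nat.two_mul_div_two_of_even C.even_card_bounded

variable {C}

lemma Adj.symm {v w : C.V} (h : C.Adj v w) : C.Adj w v := by
  obtain ⟨g, rfl, rfl⟩ := h
  exact ⟨C.inv g, rfl, by rw [C.inv_inv]⟩

/-- A function which does not change along the edges is constant. -/
lemma Connected.eq_of_forall_flag (hC : C.Connected) {A : Type*} {h : C.V → A}
    (hh : ∀ f, h (C.bdry (C.inv f)) = h (C.bdry f)) (v w : C.V) : h v = h w := by
  induction hC.2 v w with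
  | refl => rfl
  | tail _ hab ih =>
    obtain ⟨g, rfl, rfl⟩ := hab
    rw [ih, hh]

lemma Connected.exists_leaving (hC : C.Connected) {S : Set C.V} {v w : C.V} (hv : v ∈ S)
    (hw : w ∉ S) : ∃ f, C.bdry f ∈ S ∧ C.bdry (C.inv f) ∉ S := by
  by_contra! hcon
  have h := hC.eq_of_forall_flag (h := fun v => v ∈ S) (fun f => by
    refine propext ⟨fun h => ?_, fun h => hcon f h⟩
    have := hcon _ h
    rwa [C.inv_inv] at this) v w
  exact hw (h ▸ hv)

/-- Connected graphs of genus `0`. -/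
def IsTree (C : PlaneGraph n) : Prop := C.Connected ∧ C.genus = 0

lemma IsTree.card_bounded (hC : C.IsTree) :
    (Finset.univ.filter fun f => C.IsBounded f).card + 2 = 2 * Fintype.card C.V := by
  have h1 := C.two_mul_numBounded
  have h2 := hC.2
  unfold genus at h2
  omega

/-- Every vertex has a distance to a given root. -/
lemma Connected.exists_dist (hC : C.Connected) (root : C.V) :
    ∃ dist : C.V → ℕ, ∀ v, v ≠ root →
      ∃ f, C.bdry f = v ∧ dist (C.bdry (C.inv f)) < dist v := by
  -- `R k v` says that a walk of `k` edges leads from `v` to the root. The distance is the least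
  -- such `k`.
  let R : ℕ → C.V → Prop := fun k => Nat.rec (fun v => v = root)
    (fun _ P v => ∃ f, C.bdry f = v ∧ P (C.bdry (C.inv f))) k
  have hR : ∀ v, ∃ k, R k v := by
    intro v
    induction hC.2 root v with
    | refl => exact ⟨0, rfl⟩
    | tail _ hab ih =>
      obtain ⟨k, hk⟩ := ih
      obtain ⟨g, hg, rfl⟩ := hab
      exact ⟨k + 1, C.inv g, rfl, by rw [C.inv_inv, hg]; exact hk⟩
  refine ⟨fun v => sInf {k | R k v}, fun v hv => ?_⟩
  have hs : R (sInf {k | R k v}) v := Nat.sInf_mem (hR v)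
  obtain ⟨k, hk⟩ : ∃ k, sInf {k | R k v} = k + 1 := by
    refine Nat.exists_eq_succ_of_ne_zero fun h0 => hv ?_
    rw [h0] at hs
    exact hs
  rw [hk] at hs
  obtain ⟨f, hf, hP⟩ := hs
  refine ⟨f, hf, ?_⟩
  beta_reduce
  rw [hk]
  exact Nat.lt_succ_of_le (Nat.sInf_le hP)

/-- In a tree with a root, the bounded edges correspond to the other vertices: every one of these
has an edge towards the root. -/
lemma IsTree.exists_parent (hC : C.IsTree) (root : C.V) :
    ∃ (par : {v // v ≠ root} → C.F) (dist : C.V → ℕ),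
      (∀ v, C.bdry (par v) = v ∧ C.IsBounded (par v) ∧
        dist (C.bdry (C.inv (par v))) < dist v) ∧
      (∀ f, C.IsBounded f → ∃ v, f = par v ∨ f = C.inv (par v)) := by
  obtain ⟨dist, hdist⟩ := hC.1.exists_dist root
  choose par hpar hlt using fun v : {v // v ≠ root} => hdist v v.2
  have hbd : ∀ v, C.IsBounded (par v) := fun v h => by
    have := hlt v
    rw [h, hpar] at this
    exact lt_irrefl _ this
  refine ⟨par, dist, fun v => ⟨hpar v, hbd v, hlt v⟩, ?_⟩
  -- The flags `par v` and their inverses are distinct, as the distance drops strictly along `par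
  -- v`. There are 2(#V - 1) of them, which is the number of all bounded flags in genus 0, so none
  -- is missed.
  let φ : {v // v ≠ root} × Bool → C.F := fun x => if x.2 then C.inv (par x.1) else par x.1
  have hpinj : Function.Injective par := fun v w h => Subtype.ext (by rw [← hpar v, h, hpar w])
  have hne : ∀ v w, par v ≠ C.inv (par w) := fun v w h => by
    have h1 := hlt w
    rw [← h, hpar] at h1
    have h2 := hlt v
    rw [h, C.inv_inv, hpar] at h2
    exact lt_asymm h1 h2
  have hφ : Function.Injective φ := by
    rintro ⟨v, b⟩ ⟨w, c⟩ h
    cases b <;> cases c <;> simp only [φ, if_true, if_false, Bool.false_eq_true] at h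
    · rw [hpinj h]
    · exact absurd h (hne v w)
    · exact absurd h.symm (hne w v)
    · rw [hpinj (C.inv_injective h)]
  have hsub : Finset.univ.image φ = Finset.univ.filter fun f => C.IsBounded f := by
    refine Finset.eq_of_subset_of_card_le ?_ ?_
    · intro f hf
      obtain ⟨⟨v, b⟩, -, rfl⟩ := Finset.mem_image.1 hf
      refine Finset.mem_filter.2 ⟨Finset.mem_univ _, ?_⟩
      cases b
      · exact hbd v
      · exact C.isBounded_inv.2 (hbd v)
    · rw [Finset.card_image_of_injective _ hφ]
      have h1 := hC.card_bounded
      have h2 : Fintype.card {v // v ≠ root} + 1 = Fintype.card C.V := by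
        rw [Fintype.card_subtype_compl, Fintype.card_subtype_eq]
        have : 0 < Fintype.card C.V := Fintype.card_pos_iff.2 ⟨root⟩
        omega
      simp only [Finset.card_univ, Fintype.card_prod, Fintype.card_bool]
      omega
  intro f hf
  have hmem : f ∈ Finset.univ.image φ := by rw [hsub]; simpa using hf
  obtain ⟨⟨v, b⟩, -, h⟩ := Finset.mem_image.1 hmem
  cases b
  · exact ⟨v, Or.inl h.symm⟩
  · exact ⟨v, Or.inr h.symm⟩

/-- Functions on the edges of a tree are differences of functions on the vertices. -/
lemma IsTree.exists_potential (hC : C.IsTree) {A : Type*} [AddCommGroup A] (c : C.F → A)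
    (hc : ∀ f, C.IsBounded f → c (C.inv f) = - c f) :
    ∃ h : C.V → A, ∀ f, C.IsBounded f → h (C.bdry (C.inv f)) = h (C.bdry f) + c f := by
  obtain ⟨root⟩ := hC.1.1
  obtain ⟨par, dist, hpar, hall⟩ := hC.exists_parent root
  have hwf : WellFounded fun v w : C.V => dist v < dist w := (measure dist).wf
  -- `H` integrates `c` along the path of parents up to the root, by recursion on the distance.
  let H : C.V → A := hwf.fix fun v ih =>
    if hv : v ≠ root then ih (C.bdry (C.inv (par ⟨v, hv⟩))) (hpar ⟨v, hv⟩).2.2 - c (par ⟨v, hv⟩)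
    else 0
  have hH : ∀ v : {v // v ≠ root}, H v = H (C.bdry (C.inv (par v))) - c (par v) := by
    rintro ⟨v, hv⟩
    have := hwf.fix_eq (fun (v : C.V) (ih : ∀ w, dist w < dist v → A) =>
      if hv : v ≠ root then
        ih (C.bdry (C.inv (par ⟨v, hv⟩))) (hpar ⟨v, hv⟩).2.2 - c (par ⟨v, hv⟩) else 0) v
    rw [dif_pos hv] at this
    exact this
  refine ⟨H, fun f hf => ?_⟩
  obtain ⟨v, rfl | rfl⟩ := hall f hf
  · have h := hH v
    rw [(hpar v).1, h, sub_add_cancel]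
  · have h := hH v
    rw [C.inv_inv, (hpar v).1, h, hc _ (hpar v).2.1, sub_eq_add_neg]

/-- The number of flags in a proper part of a tree. -/
lemma IsTree.card_bounded_inside (hC : C.IsTree) {S : Finset C.V} (hS : S.Nonempty) :
    (Finset.univ.filter fun f => C.IsBounded f ∧ C.bdry f ∈ S ∧ C.bdry (C.inv f) ∈ S).card + 2 ≤
      2 * S.card := by
  obtain ⟨root, hroot⟩ := hS
  obtain ⟨par, dist, hpar, hall⟩ := hC.exists_parent root
  let φ : {v // v ≠ root} × Bool → C.F := fun x => if x.2 then C.inv (par x.1) else par x.1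
  -- With the root chosen inside `S`, an edge with both vertices in `S` is the parent edge of a
  -- vertex of `S` other than the root.
  have hsub : (Finset.univ.filter fun f => C.IsBounded f ∧ C.bdry f ∈ S ∧ C.bdry (C.inv f) ∈ S) ⊆
      (((S.erase root).subtype fun v => v ≠ root) ×ˢ (Finset.univ : Finset Bool)).image φ := by
    intro f hf
    obtain ⟨-, hb, h1, h2⟩ := Finset.mem_filter.1 hf
    obtain ⟨v, hv⟩ := hall f hb
    have hvS : (v : C.V) ∈ S := by
      rw [← (hpar v).1]
      rcases hv with rfl | rfl
      · exact h1
      · rwa [C.inv_inv] at h2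
    refine Finset.mem_image.2 ?_
    rcases hv with rfl | rfl
    · exact ⟨(v, false), by simp [hvS, v.2], rfl⟩
    · exact ⟨(v, true), by simp [hvS, v.2], rfl⟩
  have h1 := (Finset.card_le_card hsub).trans Finset.card_image_le
  have h2 : ((S.erase root).subtype fun v => v ≠ root).card ≤ (S.erase root).card := by
    rw [Finset.card_subtype]
    exact Finset.card_filter_le _ _
  rw [Finset.card_product, Finset.card_univ, Fintype.card_bool] at h1
  have h3 := Finset.card_erase_add_one hroot
  omega

/-- The function that is 1 on `f`, -1 on `inv f` and 0 elsewhere is odd, so it integrates over the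
tree. For a bounded `f` the result tells apart the two pieces left when this edge is removed; it
replaces explicit paths throughout. -/
lemma IsTree.exists_separator (hC : C.IsTree) (f : C.F) :
    ∃ h : C.V → ℤ, ∀ g, C.IsBounded g → h (C.bdry (C.inv g)) = h (C.bdry g) +
      ((if g = f then 1 else 0) - if g = C.inv f then 1 else 0) := by
  refine hC.exists_potential _ fun g _ => ?_
  have h1 : C.inv g = f ↔ g = C.inv f :=
    ⟨fun h => by rw [← h, C.inv_inv], fun h => by rw [h, C.inv_inv]⟩
  have h2 : C.inv g = C.inv f ↔ g = f := C.inv_injective.eq_iff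
  simp only [h1, h2]
  ring

/-- A function on the vertices of a tree which only changes along the edge of `f`. -/
def IsTree.sep (hC : C.IsTree) (f : C.F) : C.V → ℤ := (hC.exists_separator f).choose

lemma IsTree.sep_inv (hC : C.IsTree) (f : C.F) {g : C.F} (hg : C.IsBounded g) :
    hC.sep f (C.bdry (C.inv g)) = hC.sep f (C.bdry g) +
      ((if g = f then 1 else 0) - if g = C.inv f then 1 else 0) :=
  (hC.exists_separator f).choose_spec g hg

lemma IsTree.sep_inv_of_ne (hC : C.IsTree) {f g : C.F} (h1 : g ≠ f) (h2 : g ≠ C.inv f) :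
    hC.sep f (C.bdry (C.inv g)) = hC.sep f (C.bdry g) := by
  by_cases hg : C.IsBounded g
  · simp [hC.sep_inv f hg, h1, h2]
  · rw [IsBounded, not_not] at hg
    rw [hg]

lemma IsTree.sep_inv_self (hC : C.IsTree) {f : C.F} (hf : C.IsBounded f) :
    hC.sep f (C.bdry (C.inv f)) = hC.sep f (C.bdry f) + 1 := by
  have : f ≠ C.inv f := fun h => hf h.symm
  simp [hC.sep_inv f hf, this]

/-- The function `sep` takes only two values. -/
lemma IsTree.sep_eq_or (hC : C.IsTree) {f : C.F} (hf : C.IsBounded f) (v : C.V) :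
    hC.sep f v = hC.sep f (C.bdry f) ∧ Relation.ReflTransGen (C.AdjAvoid f) (C.bdry f) v ∨
    hC.sep f v = hC.sep f (C.bdry f) + 1 ∧
      Relation.ReflTransGen (C.AdjAvoid f) (C.bdry (C.inv f)) v := by
  induction hC.1.2 (C.bdry f) v with
  | refl => exact Or.inl ⟨rfl, .refl⟩
  | tail _ hab ih =>
    obtain ⟨g, rfl, rfl⟩ := hab
    by_cases h1 : g = f
    · subst h1
      exact Or.inr ⟨hC.sep_inv_self hf, .refl⟩
    by_cases h2 : g = C.inv f
    · subst h2
      rw [C.inv_inv]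
      exact Or.inl ⟨rfl, .refl⟩
    rw [hC.sep_inv_of_ne h1 h2]
    rcases ih with ⟨h, hp⟩ | ⟨h, hp⟩
    · exact Or.inl ⟨h, hp.tail ⟨g, h1, h2, rfl, rfl⟩⟩
    · exact Or.inr ⟨h, hp.tail ⟨g, h1, h2, rfl, rfl⟩⟩

end Trees

/-! ### Sums over edges -/

section EdgeSums

variable {n : ℕ} (C : PlaneGraph n)

/-- An injective numbering of the flags. -/
def flagKey : C.F ≃ Fin (Fintype.card C.F) := Fintype.equivFin C.F

/-- A set of flags that contains exactly one flag of every edge. -/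
def edgeReps : Finset C.F := Finset.univ.filter fun f => C.flagKey f ≤ C.flagKey (C.inv f)

variable {C}

lemma mem_edgeReps {f : C.F} : f ∈ C.edgeReps ↔ C.flagKey f ≤ C.flagKey (C.inv f) := by
  simp [edgeReps]

lemma mem_edgeReps_or (f : C.F) : f ∈ C.edgeReps ∨ C.inv f ∈ C.edgeReps := by
  rw [mem_edgeReps, mem_edgeReps, C.inv_inv]
  exact le_total _ _

lemma eq_of_mem_edgeReps {f : C.F} (h1 : f ∈ C.edgeReps) (h2 : C.inv f ∈ C.edgeReps) :
    C.inv f = f := by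
  rw [mem_edgeReps] at h1 h2
  rw [C.inv_inv] at h2
  exact C.flagKey.injective (le_antisymm h2 h1)

/-- A sum over flags is a sum over edges. -/
lemma sum_flags_eq {A : Type*} [AddCommMonoid A] (φ : C.F → A) :
    ∑ f, φ f = ∑ f ∈ C.edgeReps, (φ f + if C.IsBounded f then φ (C.inv f) else 0) := by
  rw [Finset.sum_add_distrib, ← Finset.sum_filter,
    ← Finset.sum_add_sum_compl C.edgeReps φ]
  congr 1
  refine Finset.sum_nbij' C.inv C.inv (fun f hf => ?_) (fun f hf => ?_) (fun f _ => C.inv_inv f)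
    (fun f _ => C.inv_inv f) (fun f _ => by rw [C.inv_inv])
  · rw [Finset.mem_compl] at hf
    rw [Finset.mem_filter, C.isBounded_inv]
    exact ⟨(mem_edgeReps_or f).resolve_left hf, fun h => hf (by
      have := (mem_edgeReps_or f).resolve_left hf
      rwa [h] at this)⟩
  · rw [Finset.mem_filter] at hf
    rw [Finset.mem_compl]
    exact fun h => hf.2 (eq_of_mem_edgeReps hf.1 h)

lemma sum_bounded_eq_zero {A : Type*} [AddCommGroup A] (φ : C.F → A)
    (hφ : ∀ f, C.IsBounded f → φ (C.inv f) = - φ f) :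
    ∑ f ∈ Finset.univ.filter (fun f => C.IsBounded f), φ f = 0 := by
  rw [Finset.sum_filter, sum_flags_eq]
  refine Finset.sum_eq_zero fun f _ => ?_
  by_cases hf : C.IsBounded f
  · simp [hf, C.isBounded_inv, hφ]
  · simp [hf]

/-- A sum over flags, arranged by vertices. -/
lemma sum_flags_fiberwise {A : Type*} [AddCommMonoid A] (φ : C.F → A) :
    ∑ v, ∑ f ∈ Finset.univ.filter (fun f => C.bdry f = v), φ f = ∑ f, φ f :=
  Finset.sum_fiberwise Finset.univ C.bdry φ

lemma balanced_apply (v : C.V) (i : Fin 2) :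
    ∑ f ∈ Finset.univ.filter (fun f => C.bdry f = v), C.dir f i = 0 := by
  have := congrFun (C.balanced v) i
  rw [← Finset.sum_filter] at this
  simpa using this

end EdgeSums

end PlaneGraph

/-! ### Indices of subgroups of free abelian groups -/

section Index

/-- The index of a subgroup of a product. -/
lemma index_prod_eq {A B : Type*} [AddCommGroup A] [AddCommGroup B] (H : AddSubgroup (A × B)) :
    H.index = (H.map (AddMonoidHom.fst A B)).index * (H.comap (AddMonoidHom.inr A B)).index := by
  have h1 : (H.comap (AddMonoidHom.inr A B)).index = H.relIndex (AddMonoidHom.inr A B).range :=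
    AddSubgroup.index_comap H _
  have hk : (AddMonoidHom.inr A B).range = (AddMonoidHom.fst A B).ker := by
    ext ⟨a, b⟩
    simp only [AddMonoidHom.mem_range, AddMonoidHom.inr_apply, Prod.ext_iff, AddMonoidHom.mem_ker,
      AddMonoidHom.coe_fst]
    exact ⟨fun ⟨x, h, _⟩ => h.symm, fun h => ⟨b, h.symm, rfl⟩⟩
  have hs : Function.Surjective (AddMonoidHom.fst A B) := Prod.fst_surjective
  -- The image of `H` in `A` has index [A × B : H + B], and the trace of `H` on `B` has index [B : H
  -- ∩ B] = [H + B : H].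
  rw [AddSubgroup.index_map, AddMonoidHom.range_eq_top_of_surjective _ hs, AddSubgroup.index_top,
    mul_one, h1, hk, ← AddSubgroup.relIndex_sup_right, sup_comm, mul_comm]
  exact (AddSubgroup.relIndex_mul_index le_sup_right).symm

/-- For a pair of homomorphisms, the index of the image is the index of the image of the first one
times the index of the image of the kernel of the first one. -/
lemma index_range_prod {G A B : Type*} [AddCommGroup G] [AddCommGroup A] [AddCommGroup B]
    (f : G →+ A) (g : G →+ B) :
    (f.prod g).range.index = f.range.index * (f.ker.map g).index := by
  rw [index_prod_eq]
  congr 2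
  · ext a
    simp [AddMonoidHom.mem_range]
  · ext b
    simp [AddMonoidHom.mem_range, AddMonoidHom.mem_ker]

lemma index_map_equiv' {A B : Type*} [AddCommGroup A] [AddCommGroup B] (H : AddSubgroup A)
    (e : A ≃+ B) : (H.map e.toAddMonoidHom).index = H.index := by
  rw [AddSubgroup.index_map, (AddMonoidHom.ker_eq_bot_iff _).2 e.injective, sup_bot_eq,
    AddMonoidHom.range_eq_top_of_surjective _ e.surjective, AddSubgroup.index_top, mul_one]

lemma finrank_of_index_ne_zero {ι : Type*} [Fintype ι] (H : AddSubgroup (ι → ℤ))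
    (hH : H.index ≠ 0) : Module.finrank ℤ H.toIntSubmodule = Fintype.card ι := by
  have h1 : Finite ((ι → ℤ) ⧸ H.toIntSubmodule) := by
    have : H.FiniteIndex := ⟨hH⟩
    exact (inferInstance : Finite ((ι → ℤ) ⧸ H))
  rw [(Submodule.finiteQuotient_iff _).1 h1, Module.finrank_fintype_fun_eq_card]

/-- The index of the image of a square integral matrix. -/
lemma index_range_toLin {m : Type*} [Fintype m] [DecidableEq m] (M : Matrix m m ℤ)
    (hM : M.det ≠ 0) : (Matrix.toLin' M).toAddMonoidHom.range.index = M.det.natAbs := by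
  have hinj : Function.Injective (Matrix.toLin' M) := by
    rw [← LinearMap.ker_eq_bot, LinearMap.ker_eq_bot']
    intro x hx
    exact Matrix.eq_zero_of_mulVec_eq_zero hM (by simpa using hx)
  -- Transporting the standard basis by `e` gives a basis of the image consisting of the columns of
  -- `M`.
  let e : (m → ℤ) ≃ₗ[ℤ] (Matrix.toLin' M).toAddMonoidHom.range.toIntSubmodule :=
    LinearEquiv.ofBijective
      (f := LinearMap.codRestrict _ (Matrix.toLin' M) fun x => AddMonoidHom.mem_range.2 ⟨x, rfl⟩)
      ⟨fun x y h => hinj (congrArg Subtype.val h), fun ⟨y, x, hx⟩ => ⟨x, Subtype.ext hx⟩⟩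
  have he : ∀ x, ((e x : (Matrix.toLin' M).toAddMonoidHom.range.toIntSubmodule) : m → ℤ) =
    Matrix.toLin' M x := fun x => rfl
  rw [AddSubgroup.index_eq_natAbs_det (Pi.basisFun ℤ m) _ ((Pi.basisFun ℤ m).map e),
    Module.Basis.det_apply]
  congr 2
  ext i j
  change (e (Pi.basisFun ℤ m j) : m → ℤ) i = M i j
  rw [he]
  simp

lemma index_range_det2 (a b : Fin 2 → ℤ) (hab : det2 a b ≠ 0) (f : ℤ × ℤ →+ (Fin 2 → ℤ))
    (hf : ∀ s t, f (s, t) = s • a + t • b) : f.range.index = (det2 a b).natAbs := by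
  have hM : (!![a 0, b 0; a 1, b 1] : Matrix (Fin 2) (Fin 2) ℤ).det = det2 a b := by
    rw [Matrix.det_fin_two_of, det2]
    ring
  rw [← hM, ← index_range_toLin _ (by rwa [hM])]
  congr 1
  ext y
  constructor
  · rintro ⟨⟨s, t⟩, rfl⟩
    refine ⟨![s, t], ?_⟩
    rw [hf]
    ext i
    fin_cases i <;> simp [Matrix.mulVec, dotProduct] <;> ring
  · rintro ⟨x, rfl⟩
    refine ⟨(x 0, x 1), ?_⟩
    rw [hf]
    ext i
    fin_cases i <;> simp [Matrix.mulVec, dotProduct] <;> ring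

end Index

namespace PlaneGraph

variable {n : ℕ}

/-- The determinant of `ev × j` is the index of the image of the lattice. -/
lemma absDetEvj_eq_index {C : PlaneGraph n} {Λ : Type*} [AddCommGroup Λ] (e : Λ ≃+ C.cellLattice)
    (φ : Λ →+ ((Fin n × Fin 2) ⊕ Unit → ℤ)) (hφ : ∀ x i, C.evj (e x) i = (φ x i : ℚ))
    (hinj : Function.Injective φ) (hidx : φ.range.index ≠ 0) :
    C.cellDim = 2 * n + 1 ∧ C.absDetEvj = φ.range.index := by
  let e' : C.cellLattice ≃ₗ[ℤ] φ.range.toIntSubmodule :=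
    (e.symm.trans (AddMonoidHom.ofInjective hinj)).toIntLinearEquiv
  have he' : ∀ x i, C.evj x i = (((e' x : φ.range.toIntSubmodule) : (Fin n × Fin 2) ⊕ Unit → ℤ) i
      : ℚ) := by
    intro x i
    have := hφ (e.symm x) i
    rw [e.apply_symm_apply] at this
    exact this
  have hrank := finrank_of_index_ne_zero φ.range hidx
  have hrank' : C.cellDim = Fintype.card ((Fin n × Fin 2) ⊕ Unit) := by
    rw [cellDim, e'.finrank_eq, hrank]
  have hne : Nonempty (Module.Basis ((Fin n × Fin 2) ⊕ Unit) ℤ C.cellLattice) := by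
    have b := Module.finBasisOfFinrankEq ℤ φ.range.toIntSubmodule hrank
    exact ⟨(b.reindex (Fintype.equivFin _).symm).map e'.symm⟩
  refine ⟨by rw [hrank']; simp; ring, ?_⟩
  -- The arbitrary basis chosen in `absDetEvj` is carried by `e'` to a basis of the image lattice,
  -- and the determinant of any such basis is the index up to sign.
  rw [absDetEvj, dif_pos hne, AddSubgroup.index_eq_natAbs_det (Pi.basisFun ℤ _) φ.range
    (hne.some.map e'), Module.Basis.det_apply]
  have : (Matrix.of fun i k => C.evj (hne.some k) i) =
      ((Pi.basisFun ℤ _).toMatrix fun k => ((hne.some.map e' k : φ.range.toIntSubmodule) :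
        (Fin n × Fin 2) ⊕ Unit → ℤ)).map (Int.castRingHom ℚ) := by
    ext i k
    simp [Module.Basis.toMatrix_apply, he']
  rw [this, ← RingHom.mapMatrix_apply, ← RingHom.map_det, Nat.cast_natAbs, Int.cast_abs]
  rfl

/-! ### Invariance under isomorphisms -/

namespace Iso

variable {C D : PlaneGraph n}

def symm (φ : Iso C D) : Iso D C where
  onV := φ.onV.symm
  onF := φ.onF.symm
  bdry_eq f := by rw [Equiv.eq_symm_apply, ← φ.bdry_eq, Equiv.apply_symm_apply]
  inv_eq f := by rw [Equiv.eq_symm_apply, ← φ.inv_eq, Equiv.apply_symm_apply]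
  len_eq f := by rw [← φ.len_eq, Equiv.apply_symm_apply]
  dir_eq f := by rw [← φ.dir_eq, Equiv.apply_symm_apply]
  pos_eq v := by rw [← φ.pos_eq, Equiv.apply_symm_apply]
  mark_eq i := by rw [Equiv.eq_symm_apply, ← φ.mark_eq]

lemma isBounded_iff (φ : Iso C D) (f : C.F) : D.IsBounded (φ.onF f) ↔ C.IsBounded f := by
  simp only [IsBounded, φ.inv_eq, ne_eq, EmbeddingLike.apply_eq_iff_eq]

lemma isMarked_iff (φ : Iso C D) (f : C.F) : D.IsMarked (φ.onF f) ↔ C.IsMarked f := by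
  simp only [IsMarked, φ.mark_eq, EmbeddingLike.apply_eq_iff_eq]

lemma isFreeEnd_iff (φ : Iso C D) (f : C.F) : D.IsFreeEnd (φ.onF f) ↔ C.IsFreeEnd f := by
  simp only [IsFreeEnd, φ.inv_eq, φ.isMarked_iff, EmbeddingLike.apply_eq_iff_eq]

lemma card_filter_eq (φ : Iso C D) {p : C.F → Prop} {q : D.F → Prop} (h : ∀ f, q (φ.onF f) ↔ p f) :
    (Finset.univ.filter q).card = (Finset.univ.filter p).card := by
  symm
  refine Finset.card_equiv φ.onF fun f => ?_
  simp [h]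

lemma val_eq (φ : Iso C D) (v : C.V) : D.val (φ.onV v) = C.val v :=
  φ.card_filter_eq fun f => by rw [φ.bdry_eq, EmbeddingLike.apply_eq_iff_eq]

lemma isUnmarkedVertex_iff (φ : Iso C D) (v : C.V) : D.IsUnmarkedVertex (φ.onV v) ↔ C.IsUnmarkedVertex v := by
  simp only [IsUnmarkedVertex, φ.mark_eq, φ.bdry_eq, ne_eq, EmbeddingLike.apply_eq_iff_eq]

lemma isTropicalCurve (φ : Iso C D) (h : C.IsTropicalCurve) : D.IsTropicalCurve := by
  intro v
  obtain ⟨v, rfl⟩ := φ.onV.surjective v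
  rw [φ.val_eq]
  exact h v

lemma connected (φ : Iso C D) (h : C.Connected) : D.Connected := by
  refine ⟨h.1.map φ.onV, fun v w => ?_⟩
  obtain ⟨v, rfl⟩ := φ.onV.surjective v
  obtain ⟨w, rfl⟩ := φ.onV.surjective w
  refine (h.2 v w).lift φ.onV fun a b ⟨g, hg, hg'⟩ => ⟨φ.onF g, ?_, ?_⟩
  · rw [φ.bdry_eq, hg]
  · rw [φ.inv_eq, φ.bdry_eq, hg']

lemma genus_eq (φ : Iso C D) : D.genus = C.genus := by
  rw [genus, genus, numBounded, numBounded, φ.card_filter_eq φ.isBounded_iff,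
    Fintype.card_congr φ.onV]

lemma hasDegree (φ : Iso C D) {d : ℕ} (h : C.HasDegree d) : D.HasDegree d := by
  rw [HasDegree] at h ⊢
  rw [← h]
  have : (Finset.univ.filter fun f => D.IsFreeEnd f) =
      (Finset.univ.filter fun f => C.IsFreeEnd f).map φ.onF.toEmbedding := by
    ext f
    obtain ⟨f, rfl⟩ := φ.onF.surjective f
    simp [φ.isFreeEnd_iff]
  rw [this, Finset.map_val, Multiset.map_map]
  exact Multiset.map_congr rfl fun f _ => φ.dir_eq f

lemma ev_eq (φ : Iso C D) (i : Fin n) : D.ev i = C.ev i := by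
  rw [ev, ev, φ.mark_eq, φ.bdry_eq, φ.pos_eq]

lemma onCycle_of (φ : Iso C D) {f : C.F} (h : C.OnCycle f) : D.OnCycle (φ.onF f) := by
  refine ⟨(φ.isBounded_iff f).2 h.1, ?_⟩
  rw [φ.inv_eq, φ.bdry_eq, φ.bdry_eq]
  refine h.2.lift φ.onV fun a b ⟨g, h1, h2, hg, hg'⟩ => ⟨φ.onF g, ?_, ?_, ?_, ?_⟩
  · rwa [ne_eq, EmbeddingLike.apply_eq_iff_eq]
  · rwa [φ.inv_eq, ne_eq, EmbeddingLike.apply_eq_iff_eq]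
  · rw [φ.bdry_eq, hg]
  · rw [φ.inv_eq, φ.bdry_eq, hg']

lemma onCycle_iff (φ : Iso C D) (f : C.F) : D.OnCycle (φ.onF f) ↔ C.OnCycle f := by
  refine ⟨fun h => ?_, φ.onCycle_of⟩
  have := φ.symm.onCycle_of h
  rwa [show φ.symm.onF (φ.onF f) = f from φ.onF.symm_apply_apply f] at this

lemma vertexOnCycle_iff (φ : Iso C D) (v : C.V) : D.VertexOnCycle (φ.onV v) ↔ C.VertexOnCycle v := by
  simp only [VertexOnCycle]
  rw [φ.onF.surjective.exists]
  simp only [φ.onCycle_iff, φ.bdry_eq, EmbeddingLike.apply_eq_iff_eq]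

lemma cycleSum_eq (φ : Iso C D) {K : Type*} [Field K] (ℓ : D.F → K) :
    D.cycleSum ℓ = C.cycleSum fun f => ℓ (φ.onF f) := by
  rw [cycleSum, cycleSum]
  congr 1
  symm
  refine Finset.sum_equiv φ.onF (fun f => ?_) fun _ _ => rfl
  simp [φ.onCycle_iff]

lemma j_eq (φ : Iso C D) : D.j = C.j := by
  rw [j, φ.cycleSum_eq, j]
  simp only [φ.len_eq]

lemma deficiency_eq (φ : Iso C D) : D.deficiency = C.deficiency := by
  have h1 : (∀ f, D.OnCycle f → D.dir f = 0) ↔ ∀ f, C.OnCycle f → C.dir f = 0 := by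
    rw [φ.onF.surjective.forall]
    simp only [φ.onCycle_iff, φ.dir_eq]
  have h2 : (∀ f g, D.OnCycle f → D.OnCycle g → det2 (D.dir f) (D.dir g) = 0) ↔
      ∀ f g, C.OnCycle f → C.OnCycle g → det2 (C.dir f) (C.dir g) = 0 := by
    rw [φ.onF.surjective.forall₂]
    simp only [φ.onCycle_iff, φ.dir_eq]
  simp only [deficiency, φ.genus_eq, h1, h2]

lemma weightZero_eq (φ : Iso C D) : D.weightZero = C.weightZero := by
  have : {u | ∃ f, D.OnCycle f ∧ D.dir f = u} = {u | ∃ f, C.OnCycle f ∧ C.dir f = u} := by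
    ext u
    simp only [Set.mem_ofPred_eq]
    rw [φ.onF.surjective.exists]
    simp only [φ.onCycle_iff, φ.dir_eq]
  rw [weightZero, weightZero, this]

lemma vertexMult_le (φ : Iso C D) (v : C.V) : C.vertexMult v ≤ D.vertexMult (φ.onV v) := by
  refine Finset.sup_le fun x hx => ?_
  rw [← φ.dir_eq, ← φ.dir_eq]
  refine Finset.le_sup (f := fun x : D.F × D.F => (det2 (D.dir x.1) (D.dir x.2)).natAbs)
    (b := (φ.onF x.1, φ.onF x.2)) ?_
  simpa [φ.bdry_eq] using hx

lemma vertexMult_eq (φ : Iso C D) (v : C.V) : D.vertexMult (φ.onV v) = C.vertexMult v := by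
  refine le_antisymm ?_ (φ.vertexMult_le v)
  have := φ.symm.vertexMult_le (φ.onV v)
  rwa [show φ.symm.onV (φ.onV v) = v from φ.onV.symm_apply_apply v] at this

lemma weightTwo_eq (φ : Iso C D) : D.weightTwo = C.weightTwo := by
  rw [weightTwo, weightTwo]
  symm
  refine Finset.sum_equiv φ.onV (fun v => ?_) fun v _ => by rw [φ.vertexMult_eq]
  simp [φ.val_eq, φ.vertexOnCycle_iff, φ.isUnmarkedVertex_iff]

/-- Deficiency 1 may be left out, since it does not occur: contracted loops give deficiency 2 and
crossings give deficiency 0. -/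
lemma weight_eq (φ : Iso C D) (h : C.deficiency ≠ 1) : D.weight = C.weight := by
  simp only [weight, φ.deficiency_eq, if_neg h, φ.weightZero_eq, φ.weightTwo_eq]

/-- Isomorphic curves have isomorphic lattices. -/
def cellLatticeEquiv (φ : Iso C D) : C.cellLattice ≃+ D.cellLattice where
  toFun x := ⟨(fun v => x.1.1 (φ.onV.symm v), fun f => x.1.2 (φ.onF.symm f)), by
    obtain ⟨h1, h2, h3⟩ := x.2
    refine ⟨fun f => ?_, fun f hf => ?_, fun f i => ?_⟩
    · obtain ⟨f, rfl⟩ := φ.onF.surjective f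
      simp [φ.inv_eq, h1]
    · obtain ⟨f, rfl⟩ := φ.onF.surjective f
      rw [φ.inv_eq, EmbeddingLike.apply_eq_iff_eq] at hf
      simp [h2 f hf]
    · obtain ⟨f, rfl⟩ := φ.onF.surjective f
      simp [φ.inv_eq, φ.bdry_eq, φ.dir_eq, h3]⟩
  invFun x := ⟨(fun v => x.1.1 (φ.onV v), fun f => x.1.2 (φ.onF f)), by
    obtain ⟨h1, h2, h3⟩ := x.2
    refine ⟨fun f => ?_, fun f hf => ?_, fun f i => ?_⟩
    · simp only
      rw [← φ.inv_eq, h1]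
    · exact h2 _ (by rw [φ.inv_eq, hf])
    · simp only
      rw [← φ.bdry_eq, ← φ.bdry_eq, ← φ.inv_eq, h3, φ.dir_eq]⟩
  left_inv x := by
    apply Subtype.ext
    simp
  right_inv x := by
    apply Subtype.ext
    simp
  map_add' x y := rfl

lemma evj_cellLatticeEquiv (φ : Iso C D) (x : C.cellLattice) (i : (Fin n × Fin 2) ⊕ Unit) :
    D.evj (φ.cellLatticeEquiv x) i = C.evj x i := by
  rcases i with ⟨i, k⟩ | u
  · simp only [evj, cellLatticeEquiv]
    simp [φ.mark_eq, φ.bdry_eq]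
  · simp only [evj]
    rw [φ.cycleSum_eq]
    simp [cellLatticeEquiv]

end Iso

/-! ### Attaching a contracted edge to a tree -/

section Attach

variable {n : ℕ} {T : PlaneGraph n} {v w : T.V} {hvw : T.pos v = T.pos w} {m : ℝ} {hm : 0 < m}

lemma attachEdge_isBounded_inl (f : T.F) :
    (T.attachEdge v w hvw m hm).IsBounded (Sum.inl f) ↔ T.IsBounded f := by
  simp [IsBounded, attachEdge]

lemma attachEdge_isBounded_inr (b : Bool) :
    (T.attachEdge v w hvw m hm).IsBounded (Sum.inr b) := by
  simp [IsBounded, attachEdge]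

lemma attachEdge_isMarked_inl (f : T.F) :
    (T.attachEdge v w hvw m hm).IsMarked (Sum.inl f) ↔ T.IsMarked f := by
  simp [IsMarked, attachEdge]

lemma attachEdge_isFreeEnd_inl (f : T.F) :
    (T.attachEdge v w hvw m hm).IsFreeEnd (Sum.inl f) ↔ T.IsFreeEnd f := by
  refine and_congr ?_ (not_congr (attachEdge_isMarked_inl f))
  exact Sum.inl_injective.eq_iff

lemma attachEdge_not_isFreeEnd_inr (b : Bool) :
    ¬ (T.attachEdge v w hvw m hm).IsFreeEnd (Sum.inr b) :=
  fun h => attachEdge_isBounded_inr b h.1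

/-- Counting flags of a graph whose set of flags is a disjoint union. -/
lemma card_filter_sum {A B : Type*} [Fintype A] [Fintype B] (p : A ⊕ B → Prop) :
    (Finset.univ.filter p).card =
      (Finset.univ.filter fun a => p (Sum.inl a)).card +
        (Finset.univ.filter fun b => p (Sum.inr b)).card := by
  rw [Finset.card_filter, Finset.card_filter, Finset.card_filter, Fintype.sum_sum_type]

lemma attachEdge_val (u : T.V) :
    (T.attachEdge v w hvw m hm).val u =
      T.val u + ((if v = u then 1 else 0) + if w = u then 1 else 0) := by
  have h := card_filter_sum (A := T.F) (B := Bool)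
    fun f => (T.attachEdge v w hvw m hm).bdry f = u
  refine h.trans ?_
  congr 1
  rw [Finset.card_filter, Fintype.sum_bool, add_comm]
  simp [attachEdge]

lemma attachEdge_genus : (T.attachEdge v w hvw m hm).genus = T.genus + 1 := by
  have h : (Finset.univ.filter fun f => (T.attachEdge v w hvw m hm).IsBounded f).card =
      (Finset.univ.filter fun f => T.IsBounded f).card + 2 := by
    refine (card_filter_sum (A := T.F) (B := Bool) _).trans ?_
    simp only [attachEdge_isBounded_inl, attachEdge_isBounded_inr]
    rfl
  have h1 := T.two_mul_numBounded
  have h2 := (T.attachEdge v w hvw m hm).two_mul_numBounded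
  have h3 : Fintype.card (T.attachEdge v w hvw m hm).V = Fintype.card T.V := rfl
  rw [genus, genus, h3]
  omega

lemma Connected.attachEdge (hT : T.Connected) : (T.attachEdge v w hvw m hm).Connected := by
  refine ⟨hT.1, fun a b => ?_⟩
  refine Relation.ReflTransGen.mono (fun x y hxy => ?_) _ _ (hT.2 a b)
  obtain ⟨g, hg, hg'⟩ := hxy
  exact ⟨Sum.inl g, hg, hg'⟩

/-- The map `ι` only matters on the free ends, which it must match bijectively with equal
directions. For subdivisions it replaces an end by its outer half. -/
lemma HasDegree.of_map {d : ℕ} {C D : PlaneGraph n} (hC : C.HasDegree d) (ι : C.F → D.F)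
    (hι : Set.InjOn ι {f | C.IsFreeEnd f}) (h1 : ∀ f, C.IsFreeEnd f → D.IsFreeEnd (ι f))
    (h2 : ∀ g, D.IsFreeEnd g → ∃ f, C.IsFreeEnd f ∧ ι f = g)
    (h3 : ∀ f, C.IsFreeEnd f → D.dir (ι f) = C.dir f) : D.HasDegree d := by
  rw [HasDegree] at hC ⊢
  rw [← hC]
  have : (Finset.univ.filter fun f => D.IsFreeEnd f) =
      (Finset.univ.filter fun f => C.IsFreeEnd f).image ι := by
    ext g
    simp only [Finset.mem_filter, Finset.mem_univ, true_and, Finset.mem_image]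
    exact ⟨h2 g, by rintro ⟨f, hf, rfl⟩; exact h1 f hf⟩
  rw [this, Finset.image_val_of_injOn (by simpa using hι), Multiset.map_map]
  exact Multiset.map_congr rfl fun f hf => h3 f (Finset.mem_filter.1 hf).2

lemma HasDegree.attachEdge {d : ℕ} (hT : T.HasDegree d) :
    (T.attachEdge v w hvw m hm).HasDegree d := by
  refine hT.of_map (fun f => Sum.inl f) (fun f _ g _ h => Sum.inl_injective h)
    (fun f hf => (attachEdge_isFreeEnd_inl f).2 hf) ?_ (fun f _ => rfl)
  rintro (f | b) hf
  · exact ⟨f, (attachEdge_isFreeEnd_inl f).1 hf, rfl⟩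
  · exact absurd hf (attachEdge_not_isFreeEnd_inr b)

lemma attachEdge_onCycle_inr (hT : T.Connected) (b : Bool) :
    (T.attachEdge v w hvw m hm).OnCycle (Sum.inr b) := by
  refine ⟨attachEdge_isBounded_inr b, ?_⟩
  refine Relation.ReflTransGen.mono (r := T.Adj) (fun x y hxy => ?_) _ _ (hT.2 _ _)
  obtain ⟨g, hg, hg'⟩ := hxy
  refine ⟨Sum.inl g, ?_, ?_, hg, hg'⟩ <;> simp [PlaneGraph.attachEdge]

/-- The cycle consists of the new edge and the path from `v` to `w` in the tree, and `f` lies on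
this path exactly when removing it separates `v` from `w`. If it does not, `sep f` is constant along
all edges other than that of `f`, including the new one, so the far end of `f` is out of reach. If
it does, the new edge bridges the two pieces. -/
lemma attachEdge_onCycle_inl (hT : T.IsTree) (f : T.F) :
    (T.attachEdge v w hvw m hm).OnCycle (Sum.inl f) ↔
      T.IsBounded f ∧ hT.sep f v ≠ hT.sep f w := by
  refine (and_congr_left fun _ => attachEdge_isBounded_inl f).trans
    (and_congr_right fun hf => ⟨fun h heq => ?_, fun h => ?_⟩)
  · have key : ∀ x, Relation.ReflTransGen
        ((T.attachEdge v w hvw m hm).AdjAvoid (Sum.inl f)) (T.bdry f) x →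
        hT.sep f x = hT.sep f (T.bdry f) := by
      intro x hx
      induction hx with
      | refl => rfl
      | tail _ hab ih =>
        obtain ⟨g, h1, h2, rfl, rfl⟩ := hab
        rw [← ih]
        rcases g with g | b
        · exact hT.sep_inv_of_ne (fun h => h1 (by rw [h])) (fun h => h2 (by rw [h]; rfl))
        · cases b
          · exact heq.symm
          · exact heq
    have := key (T.bdry (T.inv f)) h
    rw [hT.sep_inv_self hf] at this
    omega
  · have lift : ∀ {x y}, Relation.ReflTransGen (T.AdjAvoid f) x y → Relation.ReflTransGen
        ((T.attachEdge v w hvw m hm).AdjAvoid (Sum.inl f)) x y := by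
      intro x y hxy
      refine Relation.ReflTransGen.mono (fun a b hab => ?_) _ _ hxy
      obtain ⟨g, h1, h2, hg, hg'⟩ := hab
      refine ⟨Sum.inl g, fun h => h1 (Sum.inl_injective h), fun h => h2 (Sum.inl_injective h),
        hg, hg'⟩
    have hsymm : ∀ {x y}, Relation.ReflTransGen
        ((T.attachEdge v w hvw m hm).AdjAvoid (Sum.inl f)) x y → Relation.ReflTransGen
        ((T.attachEdge v w hvw m hm).AdjAvoid (Sum.inl f)) y x := by
      intro x y hxy
      refine (@Relation.ReflTransGen.stdSymm _ _ ⟨fun a b hab => ?_⟩).symm _ _ hxy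
      obtain ⟨g, h1, h2, rfl, rfl⟩ := hab
      refine ⟨(T.attachEdge v w hvw m hm).inv g, fun h => h2 ?_, fun h => h1 ?_, rfl, ?_⟩
      · rw [← h, inv_inv]
      · exact (T.attachEdge v w hvw m hm).inv_injective h
      · rw [inv_inv]
    have hnew : ∀ b : Bool, (T.attachEdge v w hvw m hm).AdjAvoid (Sum.inl f)
        (if b then w else v) (if !b then w else v) := fun b =>
      ⟨Sum.inr b, fun h => Sum.inr_ne_inl h, fun h => Sum.inr_ne_inl h, rfl, rfl⟩
    rcases hT.sep_eq_or hf v with ⟨h1, p1⟩ | ⟨h1, p1⟩ <;>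
      rcases hT.sep_eq_or hf w with ⟨h2, p2⟩ | ⟨h2, p2⟩
    · exact absurd (h1.trans h2.symm) h
    · exact ((lift p1).tail (hnew false)).trans (hsymm (lift p2))
    · exact ((lift p2).tail (hnew true)).trans (hsymm (lift p1))
    · exact absurd (h1.trans h2.symm) h

/-- The bounded edges of a tree on the path between two vertices. -/
def IsTree.pathFlags (hT : T.IsTree) (v w : T.V) : Finset T.F :=
  Finset.univ.filter fun f => T.IsBounded f ∧ hT.sep f v ≠ hT.sep f w

lemma IsTree.mem_pathFlags (hT : T.IsTree) {f : T.F} :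
    f ∈ hT.pathFlags v w ↔ T.IsBounded f ∧ hT.sep f v ≠ hT.sep f w := by
  simp [IsTree.pathFlags]

lemma IsTree.inv_mem_pathFlags (hT : T.IsTree) {f : T.F} (hf : f ∈ hT.pathFlags v w) :
    T.inv f ∈ hT.pathFlags v w := by
  rw [hT.mem_pathFlags] at hf ⊢
  refine ⟨T.isBounded_inv.2 hf.1, fun h => hf.2 ?_⟩
  -- The jumps of `sep f` and `sep (inv f)` along the edge cancel, so their sum is constant.
  have := hT.1.eq_of_forall_flag (h := fun x => hT.sep f x + hT.sep (T.inv f) x) (fun g => by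
    by_cases hg : T.IsBounded g
    · simp only [hT.sep_inv _ hg, T.inv_inv]
      ring
    · rw [IsBounded, not_not] at hg
      rw [hg]) v w
  omega

lemma IsTree.pathFlags_self (hT : T.IsTree) : hT.pathFlags v v = ∅ := by
  simp [IsTree.pathFlags]

lemma attachEdge_cycleSum (hT : T.IsTree) {K : Type*} [Field K] (ℓ : T.F ⊕ Bool → K) :
    (T.attachEdge v w hvw m hm).cycleSum ℓ =
      (∑ f ∈ hT.pathFlags v w, ℓ (Sum.inl f)) / 2 + (ℓ (Sum.inr true) + ℓ (Sum.inr false)) / 2 := by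
  have h : (Finset.univ.filter fun f => (T.attachEdge v w hvw m hm).OnCycle f) =
      (hT.pathFlags v w).disjSum Finset.univ := by
    ext (f | b)
    · refine Finset.mem_filter.trans ((and_iff_right (Finset.mem_univ _)).trans
        ((attachEdge_onCycle_inl hT f).trans (hT.mem_pathFlags.symm.trans
          Finset.inl_mem_disjSum.symm)))
    · refine Finset.mem_filter.trans (iff_of_true ⟨Finset.mem_univ _,
        attachEdge_onCycle_inr hT.1 b⟩ (Finset.inr_mem_disjSum.2 (Finset.mem_univ _)))
  have h' : (T.attachEdge v w hvw m hm).cycleSum ℓ =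
      (∑ f ∈ (hT.pathFlags v w).disjSum Finset.univ, ℓ f) / 2 := by
    rw [← h]
    rfl
  rw [h', Finset.sum_disjSum, Fintype.sum_bool, ← add_div]

lemma attachEdge_j (hT : T.IsTree) :
    (T.attachEdge v w hvw m hm).j = m + (∑ f ∈ hT.pathFlags v w, T.len f) / 2 := by
  refine (attachEdge_cycleSum hT (T.attachEdge v w hvw m hm).len).trans ?_
  simp only [attachEdge, Sum.elim_inl, Sum.elim_inr]
  ring

/-! ### The lattice -/

/-- Evaluation at the marked ends. -/
def evHom (T : PlaneGraph n) : T.cellLattice →+ (Fin n × Fin 2 → ℤ) where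
  toFun x i := x.1.1 (T.bdry (T.mark i.1)) i.2
  map_zero' := rfl
  map_add' _ _ := rfl

/-- The difference of the positions of two vertices. -/
def diffHom (T : PlaneGraph n) (v w : T.V) : T.cellLattice →+ (Fin 2 → ℤ) where
  toFun x := x.1.1 v - x.1.1 w
  map_zero' := by simp
  map_add' x y := by simp [sub_add_sub_comm]

lemma diffHom_apply (x : T.cellLattice) : T.diffHom v w x = x.1.1 v - x.1.1 w := rfl

/-- The lattice of a tree with a contracted edge attached. -/
def attachEdgeLattice : (T.diffHom v w).ker × ℤ ≃+ (T.attachEdge v w hvw m hm).cellLattice where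
  toFun x := ⟨(x.1.1.1.1, Sum.elim x.1.1.1.2 fun _ => x.2), by
    obtain ⟨⟨⟨x, h1, h2, h3⟩, h4⟩, k⟩ := x
    have h4' : x.1 v = x.1 w := sub_eq_zero.1 h4
    refine ⟨?_, ?_, ?_⟩
    · rintro (f | b)
      · exact h1 f
      · rfl
    · rintro (f | b) hf
      · exact h2 f (Sum.inl_injective hf)
      · exact absurd hf (attachEdge_isBounded_inr b)
    · rintro (f | b) i
      · exact h3 f i
      · cases b <;> simp [attachEdge, h4']⟩
  invFun y := (⟨⟨(y.1.1, fun f => y.1.2 (Sum.inl f)), by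
    obtain ⟨y, h1, h2, h3⟩ := y
    exact ⟨fun f => h1 (Sum.inl f), fun f hf => h2 (Sum.inl f) (congrArg Sum.inl hf),
      fun f i => h3 (Sum.inl f) i⟩⟩, by
    obtain ⟨y, h1, h2, h3⟩ := y
    refine sub_eq_zero.2 (funext fun i => ?_)
    have := h3 (Sum.inr true) i
    simpa [attachEdge] using this⟩, y.1.2 (Sum.inr true))
  left_inv x := rfl
  right_inv y := by
    apply Subtype.ext
    refine Prod.ext rfl (funext ?_)
    rintro (f | b)
    · rfl
    · cases b
      · exact y.2.1 (Sum.inr false)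
      · rfl
  map_add' x y := by
    apply Subtype.ext
    refine Prod.ext rfl (funext ?_)
    rintro (f | b) <;> rfl

/-- Adding a last coordinate. -/
def sumUnitEquiv (ι : Type*) : (ι → ℤ) × ℤ ≃+ (ι ⊕ Unit → ℤ) where
  toFun p := Sum.elim p.1 fun _ => p.2
  invFun q := (fun i => q (Sum.inl i), q (Sum.inr ()))
  left_inv p := rfl
  right_inv q := by
    ext (i | i) <;> rfl
  map_add' p q := by
    ext (i | i) <;> rfl

/-- The length of the path between two vertices, as a function on the lattice. -/
def IsTree.pathHom (hT : T.IsTree) (v w : T.V) : T.cellLattice →+ ℤ where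
  toFun x := ∑ f ∈ T.edgeReps ∩ hT.pathFlags v w, x.1.2 f
  map_zero' := by simp
  map_add' x y := by simp [Finset.sum_add_distrib]

/-- `cycleSum` halves a sum over flags. Since every edge of the path contributes two flags of equal
length, the half is integral on the lattice and is given by `pathHom`. -/
lemma IsTree.two_mul_pathHom (hT : T.IsTree) (x : T.cellLattice) :
    ∑ f ∈ hT.pathFlags v w, x.1.2 f = 2 * hT.pathHom v w x := by
  have h1 : ∑ f ∈ hT.pathFlags v w, x.1.2 f =
      ∑ f, if f ∈ hT.pathFlags v w then x.1.2 f else 0 := by simp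
  rw [h1, sum_flags_eq]
  simp only [IsTree.pathHom, AddMonoidHom.coe_mk, ZeroHom.coe_mk, Finset.mul_sum]
  rw [← Finset.filter_mem_eq_inter, Finset.sum_filter]
  refine Finset.sum_congr rfl fun f _ => ?_
  by_cases hf : f ∈ hT.pathFlags v w
  · have hb := (hT.mem_pathFlags.1 hf).1
    simp [hf, hT.inv_mem_pathFlags hf, hb, x.2.1 f]
    ring
  · have : T.inv f ∉ hT.pathFlags v w := fun h => hf (by
      have := hT.inv_mem_pathFlags h
      rwa [T.inv_inv] at this)
    simp [hf, this]

/-- The dimension of the cell and the determinant of `ev × j` of a tree with a contracted edge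
attached. -/
lemma attachEdge_absDetEvj (hT : T.IsTree)
    (hinj : ∀ x, T.diffHom v w x = 0 → T.evHom x = 0 → x = 0)
    (hidx : ((T.diffHom v w).ker.map T.evHom).index ≠ 0) {D : PlaneGraph n}
    (ψ : Iso (T.attachEdge v w hvw m hm) D) :
    D.cellDim = 2 * n + 1 ∧ D.absDetEvj = ((T.diffHom v w).ker.map T.evHom).index := by
  let f : (T.diffHom v w).ker × ℤ →+ (Fin n × Fin 2 → ℤ) :=
    (T.evHom.comp (T.diffHom v w).ker.subtype).comp (AddMonoidHom.fst _ _)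
  -- This is the j-invariant: the length of the path in the tree plus the length of the new edge.
  let g : (T.diffHom v w).ker × ℤ →+ ℤ :=
    AddMonoidHom.coprod ((hT.pathHom v w).comp (T.diffHom v w).ker.subtype) (AddMonoidHom.id ℤ)
  -- The length of the new edge is free and does not influence the evaluation, so j is already
  -- surjective on the kernel of ev and contributes the factor 1 to the index.
  have hgk : f.ker.map g = ⊤ := by
    refine eq_top_iff.2 fun k _ => ⟨(0, k), ?_, ?_⟩
    · exact AddMonoidHom.mem_ker.2 rfl
    · simp [g]
  have hf : f.range = (T.diffHom v w).ker.map T.evHom := by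
    ext y
    constructor
    · rintro ⟨⟨x, k⟩, rfl⟩
      exact ⟨x.1, x.2, rfl⟩
    · rintro ⟨x, hx, rfl⟩
      exact ⟨(⟨x, hx⟩, 0), rfl⟩
  let φ : (T.diffHom v w).ker × ℤ →+ ((Fin n × Fin 2) ⊕ Unit → ℤ) :=
    (sumUnitEquiv _).toAddMonoidHom.comp (f.prod g)
  have hφ : φ.range.index = ((T.diffHom v w).ker.map T.evHom).index := by
    rw [AddMonoidHom.range_comp, index_map_equiv', index_range_prod, hgk, hf,
      AddSubgroup.index_top, mul_one]
  rw [← hφ]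
  refine absDetEvj_eq_index (attachEdgeLattice.trans ψ.cellLatticeEquiv) φ ?_ ?_ (hφ ▸ hidx)
  · rintro x (i | i)
    · exact ψ.evj_cellLatticeEquiv _ _
    · refine (ψ.evj_cellLatticeEquiv _ _).trans ?_
      refine (attachEdge_cycleSum hT _).trans ?_
      have h2 : (∑ f ∈ hT.pathFlags v w, (x.1.1.1.2 f : ℚ)) = 2 * (hT.pathHom v w x.1.1 : ℤ) := by
        have := hT.two_mul_pathHom (v := v) (w := w) x.1.1
        exact_mod_cast this
      have h3 : φ x (Sum.inr i) = hT.pathHom v w x.1.1 + x.2 := rfl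
      rw [h3]
      change (∑ f ∈ hT.pathFlags v w, (x.1.1.1.2 f : ℚ)) / 2 + ((x.2 : ℚ) + x.2) / 2 = _
      rw [h2]
      push_cast
      ring
  · rw [injective_iff_map_eq_zero]
    rintro ⟨⟨x, hx⟩, k⟩ h
    have h' : (f.prod g) (⟨x, hx⟩, k) = 0 := by
      have : (sumUnitEquiv _) ((f.prod g) (⟨x, hx⟩, k)) = 0 := h
      exact (map_eq_zero_iff _ (sumUnitEquiv _).injective).1 this
    have hx0 : x = 0 := hinj x hx (congrArg Prod.fst h')
    subst hx0
    have hk : g (⟨0, hx⟩, k) = 0 := congrArg Prod.snd h'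
    have hk' : k = 0 := by
      have h0 : g (⟨0, hx⟩, k) = hT.pathHom v w 0 + k := rfl
      rw [h0, map_zero, zero_add] at hk
      exact hk
    subst hk'
    rfl

/-- An element of the lattice of a tree, in terms of the lengths of the edges. -/
lemma IsTree.diffHom_eq_sum (hT : T.IsTree) (x : T.cellLattice) :
    T.diffHom v w x = ∑ f ∈ T.edgeReps.filter fun f => T.IsBounded f,
      (x.1.2 f * (hT.sep f v - hT.sep f w)) • T.dir f := by
  ext i
  set S := T.edgeReps.filter fun f => T.IsBounded f with hS
  have hmem : ∀ g, T.IsBounded g → (g ∈ S ↔ T.inv g ∉ S) := by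
    intro g hg
    have hg' := T.isBounded_inv.2 hg
    simp only [hS, Finset.mem_filter, hg, hg', and_true]
    refine ⟨fun h h' => hg (eq_of_mem_edgeReps h h'), fun h => (mem_edgeReps_or g).resolve_right h⟩
  -- The position minus the sum does not change along any edge: along `g` only the term of the edge
  -- of `g` jumps, and by just the vector by which the position changes.
  have key := hT.1.eq_of_forall_flag
    (h := fun u => x.1.1 u i - ∑ f ∈ S, x.1.2 f * hT.sep f u * T.dir f i) (fun g => by
      by_cases hg : T.IsBounded g
      · simp only [hT.sep_inv _ hg, x.2.2.2 g i]
        have : ∑ f ∈ S, x.1.2 f * (hT.sep f (T.bdry g) + ((if g = f then 1 else 0) -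
            if g = T.inv f then 1 else 0)) * T.dir f i =
            ∑ f ∈ S, x.1.2 f * hT.sep f (T.bdry g) * T.dir f i + x.1.2 g * T.dir g i := by
          have h1 : ∀ f, (g = T.inv f) = (T.inv g = f) := fun f =>
            propext ⟨fun h => by rw [h, T.inv_inv], fun h => by rw [← h, T.inv_inv]⟩
          simp only [mul_add, add_mul, mul_sub, sub_mul, Finset.sum_add_distrib,
            Finset.sum_sub_distrib, mul_ite, ite_mul, mul_one, mul_zero, zero_mul, h1,
            Finset.sum_ite_eq]
          congr 1
          by_cases hgS : g ∈ S
          · simp [hgS, (hmem g hg).1 hgS]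
          · have : T.inv g ∈ S := by
              by_contra h
              exact hgS ((hmem g hg).2 h)
            simp [hgS, this, x.2.1 g, T.dir_inv g hg]
        rw [this]
        ring
      · rw [IsBounded, not_not] at hg
        rw [hg]) v w
  simp only [diffHom_apply, Pi.sub_apply, Finset.sum_apply, Pi.smul_apply, smul_eq_mul, mul_sub,
    sub_mul, Finset.sum_sub_distrib]
  linarith

/-- The differences of positions form the lattice generated by the directions of the cycle. -/
lemma attachEdge_closure_cycle (hT : T.IsTree) :
    AddSubgroup.closure {u | ∃ f, (T.attachEdge v w hvw m hm).OnCycle f ∧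
      (T.attachEdge v w hvw m hm).dir f = u} = (T.diffHom v w).range := by
  apply le_antisymm
  · rw [AddSubgroup.closure_le]
    rintro u ⟨f | b, hf, rfl⟩
    · rw [attachEdge_onCycle_inl hT] at hf
      obtain ⟨hb, hne⟩ := hf
      have hinv : ∀ g, (T.inv g = f) = (g = T.inv f) := fun g =>
        propext ⟨fun h => by rw [← h, T.inv_inv], fun h => by rw [h, T.inv_inv]⟩
      have hinv' : ∀ g, (T.inv g = T.inv f) = (g = f) := fun g =>
        propext T.inv_injective.eq_iff
      -- The lattice point at which the edge of `f` has length 1 and all other edges have length 0.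
      -- Its positions differ by `dir f` on the two sides of the edge.
      let x : T.cellLattice := ⟨(fun u i => hT.sep f u * T.dir f i,
        fun g => if g = f ∨ g = T.inv f then 1 else 0), by
          refine ⟨fun g => ?_, fun g hg => ?_, fun g i => ?_⟩
          · simp only [hinv, hinv', or_comm]
          · refine if_neg ?_
            rintro (rfl | rfl)
            · exact hb hg
            · rw [T.inv_inv] at hg
              exact hb hg.symm
          · by_cases h1 : g = f
            · subst h1
              simp only [hT.sep_inv_self hb, true_or, if_true]
              ring
            by_cases h2 : g = T.inv f
            · subst h2
              simp only [T.inv_inv, or_true, if_true, hT.sep_inv_self hb, T.dir_inv f hb,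
                Pi.neg_apply]
              ring
            · simp [hT.sep_inv_of_ne h1 h2, h1, h2]⟩
      have hx : T.diffHom v w x = (hT.sep f v - hT.sep f w) • T.dir f := by
        ext i
        simp [diffHom_apply, x, sub_mul]
      have hpm : hT.sep f v - hT.sep f w = 1 ∨ hT.sep f v - hT.sep f w = -1 := by
        rcases hT.sep_eq_or hb v with ⟨h1, -⟩ | ⟨h1, -⟩ <;>
          rcases hT.sep_eq_or hb w with ⟨h2, -⟩ | ⟨h2, -⟩ <;> omega
      have hmem : T.diffHom v w x ∈ (T.diffHom v w).range := ⟨x, rfl⟩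
      rw [hx] at hmem
      rcases hpm with h | h
      · rw [h, one_smul] at hmem
        exact hmem
      · rw [h, neg_smul, one_smul, neg_mem_iff] at hmem
        exact hmem
    · exact zero_mem _
  · rintro _ ⟨x, rfl⟩
    rw [hT.diffHom_eq_sum]
    refine sum_mem fun f hf => ?_
    by_cases h : hT.sep f v = hT.sep f w
    · simp [h]
    · have hc := (attachEdge_onCycle_inl (hvw := hvw) (hm := hm) hT f).2
        ⟨(Finset.mem_filter.1 hf).2, h⟩
      exact zsmul_mem (AddSubgroup.subset_closure (Set.mem_ofPred_eq ▸ ⟨Sum.inl f, hc, rfl⟩)) _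

/-! ### Contracted loops -/

lemma attachLoop_onCycle (hT : T.IsTree) (f : T.F ⊕ Bool) :
    (T.attachLoop v m hm).OnCycle f ↔ ∃ b, f = Sum.inr b := by
  rcases f with f | b
  · refine (attachEdge_onCycle_inl hT f).trans ?_
    simp
  · exact iff_of_true (attachEdge_onCycle_inr hT.1 b) ⟨b, rfl⟩

lemma attachLoop_deficiency (hT : T.IsTree) : (T.attachLoop v m hm).deficiency = 2 := by
  rw [deficiency, if_pos]
  refine ⟨by rw [attachLoop, attachEdge_genus, hT.2, zero_add], fun f hf => ?_⟩
  obtain ⟨b, rfl⟩ := (attachLoop_onCycle hT f).1 hf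
  rfl

lemma attachEdge_vertexMult (u : T.V) :
    (T.attachEdge v w hvw m hm).vertexMult u = T.vertexMult u := by
  apply le_antisymm
  · refine Finset.sup_le fun x hx => ?_
    obtain ⟨-, h1, h2⟩ := Finset.mem_filter.1 hx
    obtain ⟨f | b, g | c⟩ := x
    · exact Finset.le_sup (f := fun x : T.F × T.F => (det2 (T.dir x.1) (T.dir x.2)).natAbs)
        (b := (f, g)) (Finset.mem_filter.2 ⟨Finset.mem_univ _, h1, h2⟩)
    all_goals simp [attachEdge, det2]
  · refine Finset.sup_le fun x hx => ?_
    obtain ⟨-, h1, h2⟩ := Finset.mem_filter.1 hx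
    exact Finset.le_sup (f := fun x : (T.F ⊕ Bool) × (T.F ⊕ Bool) =>
        (det2 ((T.attachEdge v w hvw m hm).dir x.1)
          ((T.attachEdge v w hvw m hm).dir x.2)).natAbs)
        (b := (Sum.inl x.1, Sum.inl x.2)) (Finset.mem_filter.2 ⟨Finset.mem_univ _, h1, h2⟩)

/-- The loop adds two flags at `v`, which thereby has valence 5 and is the only vertex on the cycle.
The contracted flags do not affect the vertex multiplicity. -/
lemma attachLoop_weight (hT : T.IsTree) (hv : T.val v = 3) (hu : T.IsUnmarkedVertex v) :
    (T.attachLoop v m hm).weight = ((T.vertexMult v : ℚ) - 1) / 2 := by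
  have hd := attachLoop_deficiency (v := v) (hm := hm) hT
  rw [weight, if_neg (by omega), if_neg (by omega), weightTwo]
  have : (Finset.univ.filter fun u => (T.attachLoop v m hm).val u = 5 ∧
      (T.attachLoop v m hm).VertexOnCycle u ∧ (T.attachLoop v m hm).IsUnmarkedVertex u) =
      {v} := by
    ext u
    change T.V at u
    refine Finset.mem_filter.trans (Iff.trans ?_ Finset.mem_singleton.symm)
    constructor
    · rintro ⟨-, -, ⟨f, hf, rfl⟩, -⟩
      obtain ⟨b, rfl⟩ := (attachLoop_onCycle hT f).1 hf
      cases b <;> rfl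
    · intro huv
      subst huv
      refine ⟨Finset.mem_univ _, ?_, ⟨Sum.inr true, ?_, rfl⟩, hu⟩
      · refine (attachEdge_val (T := T) (v := u) (w := u) (hvw := rfl) (hm := hm) u).trans ?_
        rw [hv]
        simp
      · exact (attachLoop_onCycle hT _).2 ⟨true, rfl⟩
  rw [this]
  refine (Finset.sum_singleton _ _).trans ?_
  exact congrArg (fun k : ℕ => ((k : ℚ) - 1) / 2)
    (attachEdge_vertexMult (T := T) (v := v) (w := v) (hvw := rfl) (hm := hm) v)

end Attach

/-! ### Subdividing edges -/

section Subdivide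

variable {n : ℕ} {C : PlaneGraph n} (x : C.EdgePoint)

lemma subdivide_inv_flag : (C.subdivide x).inv (Sum.inl x.flag) = Sum.inr false := by
  simp [subdivide]

lemma subdivide_inv_false : (C.subdivide x).inv (Sum.inr false) = Sum.inl x.flag := by
  simp [subdivide]

lemma subdivide_inv_inv_flag (hx : C.IsBounded x.flag) :
    (C.subdivide x).inv (Sum.inl (C.inv x.flag)) = Sum.inr true := by
  have : C.inv x.flag ≠ x.flag := hx
  simp [subdivide, this]

lemma subdivide_inv_true (hx : C.IsBounded x.flag) :
    (C.subdivide x).inv (Sum.inr true) = Sum.inl (C.inv x.flag) := by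
  have : C.inv x.flag ≠ x.flag := hx
  simp [subdivide, this]

lemma subdivide_inv_true_of_end (hx : ¬ C.IsBounded x.flag) :
    (C.subdivide x).inv (Sum.inr true) = Sum.inr true := by
  have : C.inv x.flag = x.flag := not_not.1 hx
  simp [subdivide, this]

lemma subdivide_inv_of_ne {f : C.F} (h1 : f ≠ x.flag) (h2 : f ≠ C.inv x.flag) :
    (C.subdivide x).inv (Sum.inl f) = Sum.inl (C.inv f) := by
  simp [subdivide, h1, h2]

lemma subdivide_isBounded_inl (f : C.F) :
    (C.subdivide x).IsBounded (Sum.inl f) ↔ C.IsBounded f ∨ f = x.flag := by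
  by_cases h1 : f = x.flag
  · subst h1
    refine iff_of_true (fun h => ?_) (Or.inr rfl)
    rw [subdivide_inv_flag] at h
    exact Sum.inr_ne_inl h
  by_cases h2 : f = C.inv x.flag
  · subst h2
    have hx : C.IsBounded x.flag := h1
    refine iff_of_true (fun h => ?_) (Or.inl (C.isBounded_inv.2 hx))
    rw [subdivide_inv_inv_flag x hx] at h
    exact Sum.inr_ne_inl h
  · rw [or_iff_left h1]
    refine not_congr ?_
    rw [subdivide_inv_of_ne x h1 h2]
    exact Sum.inl_injective.eq_iff

lemma subdivide_isBounded_false : (C.subdivide x).IsBounded (Sum.inr false) := fun h => by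
  rw [subdivide_inv_false] at h
  exact Sum.inl_ne_inr h

lemma subdivide_isBounded_true :
    (C.subdivide x).IsBounded (Sum.inr true) ↔ C.IsBounded x.flag := by
  by_cases hx : C.IsBounded x.flag
  · refine iff_of_true (fun h => ?_) hx
    rw [subdivide_inv_true x hx] at h
    exact Sum.inl_ne_inr h
  · exact iff_of_false (fun h => h (subdivide_inv_true_of_end x hx)) hx

lemma subdivide_isMarked_inl (f : C.F) :
    (C.subdivide x).IsMarked (Sum.inl f) ↔ C.IsMarked f :=
  exists_congr fun _ => Sum.inl_injective.eq_iff

lemma subdivide_not_isMarked_inr (b : Bool) : ¬ (C.subdivide x).IsMarked (Sum.inr b) :=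
  fun ⟨_, h⟩ => Sum.inl_ne_inr h

lemma subdivide_val_some (u : C.V) : (C.subdivide x).val (some u) = C.val u := by
  refine (card_filter_sum (A := C.F) (B := Bool) _).trans ?_
  simp [subdivide, val]

lemma subdivide_val_none : (C.subdivide x).val none = 2 := by
  refine (card_filter_sum (A := C.F) (B := Bool) _).trans ?_
  simp [subdivide]

/-- There is one more bounded edge in either case: a bounded edge is cut into two, and an end into a
bounded edge and an end. -/
lemma subdivide_card_bounded :
    (Finset.univ.filter fun f => (C.subdivide x).IsBounded f).card =
      (Finset.univ.filter fun f => C.IsBounded f).card + 2 := by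
  have h1 : (Finset.univ.filter fun b : Bool => (C.subdivide x).IsBounded (Sum.inr b)).card =
      1 + if C.IsBounded x.flag then 1 else 0 := by
    rw [Finset.card_filter, Fintype.sum_bool, add_comm]
    simp only [subdivide_isBounded_false, subdivide_isBounded_true, if_true]
  have h2 : (Finset.univ.filter fun f : C.F => (C.subdivide x).IsBounded (Sum.inl f)) =
      insert x.flag (Finset.univ.filter fun f => C.IsBounded f) := by
    ext f
    simp only [Finset.mem_filter, Finset.mem_univ, true_and, Finset.mem_insert,
      subdivide_isBounded_inl, or_comm]
  refine (card_filter_sum (A := C.F) (B := Bool) _).trans ?_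
  rw [h1, h2]
  by_cases hx : C.IsBounded x.flag
  · rw [Finset.insert_eq_of_mem (by simpa using hx), if_pos hx]
  · rw [Finset.card_insert_of_notMem (by simpa using hx), if_neg hx]

variable {x}

lemma IsTree.subdivide (hC : C.IsTree) : (C.subdivide x).IsTree := by
  constructor
  · have h1 : ∀ v w : C.V, Relation.ReflTransGen (C.subdivide x).Adj (some v) (some w) := by
      intro v w
      induction hC.1.2 v w with
      | refl => exact .refl
      | tail _ hab ih =>
        refine ih.trans ?_
        obtain ⟨g, rfl, rfl⟩ := hab
        by_cases hg1 : g = x.flag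
        · subst hg1
          by_cases hx : C.IsBounded x.flag
          · exact (Relation.ReflTransGen.single (b := none) ⟨Sum.inl x.flag, rfl,
              congrArg (C.subdivide x).bdry (subdivide_inv_flag x)⟩).tail
              ⟨Sum.inr true, rfl, congrArg (C.subdivide x).bdry (subdivide_inv_true x hx)⟩
          · rw [show C.inv x.flag = x.flag from not_not.1 hx]
            exact .refl
        by_cases hg2 : g = C.inv x.flag
        · subst hg2
          have hx : C.IsBounded x.flag := hg1
          rw [C.inv_inv]
          exact (Relation.ReflTransGen.single (b := none) ⟨Sum.inl (C.inv x.flag), rfl,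
            congrArg (C.subdivide x).bdry (subdivide_inv_inv_flag x hx)⟩).tail
            ⟨Sum.inr false, rfl, congrArg (C.subdivide x).bdry (subdivide_inv_false x)⟩
        · refine .single ⟨Sum.inl g, rfl, ?_⟩
          rw [subdivide_inv_of_ne x hg1 hg2]; rfl
    have h2 : (C.subdivide x).Adj none (some (C.bdry x.flag)) :=
      ⟨Sum.inr false, rfl, by rw [subdivide_inv_false]; rfl⟩
    refine ⟨⟨none⟩, ?_⟩
    rintro (_ | v) (_ | w)
    · exact .refl
    · exact (Relation.ReflTransGen.single h2).trans (h1 _ _)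
    · exact (h1 _ _).tail h2.symm
    · exact h1 _ _
  · have h1 := C.two_mul_numBounded
    have h2 := (C.subdivide x).two_mul_numBounded
    rw [subdivide_card_bounded] at h2
    have h3 : Fintype.card (C.subdivide x).V = Fintype.card C.V + 1 := Fintype.card_option
    have h4 := hC.2
    rw [genus] at h4 ⊢
    rw [h3]
    push_cast
    omega

lemma HasDegree.subdivide {d : ℕ} (hC : C.HasDegree d) : (C.subdivide x).HasDegree d := by
  -- If the subdivided edge is an end, its role is taken over by the new flag `inr true`; all other
  -- ends stay.
  obtain ⟨ι, hι1, hι2⟩ : ∃ ι : C.F → (C.subdivide x).F, ι x.flag = Sum.inr true ∧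
      ∀ f, f ≠ x.flag → ι f = Sum.inl f :=
    ⟨fun f => if f = x.flag then Sum.inr true else Sum.inl f, if_pos rfl, fun f hf => if_neg hf⟩
  refine hC.of_map ι ?_ ?_ ?_ ?_
  · intro f _ g _ h
    by_cases hf : f = x.flag <;> by_cases hg : g = x.flag
    · rw [hf, hg]
    · rw [hf, hι1, hι2 g hg] at h
      exact absurd h.symm Sum.inl_ne_inr
    · rw [hg, hι1, hι2 f hf] at h
      exact absurd h Sum.inl_ne_inr
    · rw [hι2 f hf, hι2 g hg] at h
      exact Sum.inl_injective h
  · intro f hf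
    by_cases h1 : f = x.flag
    · subst h1
      rw [hι1]
      exact ⟨subdivide_inv_true_of_end x (not_not.2 hf.1), subdivide_not_isMarked_inr x true⟩
    · rw [hι2 f h1]
      refine ⟨not_not.1 fun h => ?_, fun h => hf.2 ((subdivide_isMarked_inl x f).1 h)⟩
      exact ((subdivide_isBounded_inl x f).1 h).elim (fun h => h hf.1) h1
  · rintro (f | b) hf
    · have h1 : ¬ (C.subdivide x).IsBounded (Sum.inl f) := not_not.2 hf.1
      have h1 := not_or.1 (mt (subdivide_isBounded_inl x f).2 h1)
      exact ⟨f, ⟨not_not.1 h1.1, fun h => hf.2 ((subdivide_isMarked_inl x f).2 h)⟩, hι2 f h1.2⟩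
    · cases b
      · exact absurd hf.1 (subdivide_isBounded_false x)
      · refine ⟨x.flag, ⟨not_not.1 fun h => ?_, x.unmarked⟩, hι1⟩
        exact (subdivide_isBounded_true x).2 h hf.1
  · intro f hf
    by_cases h1 : f = x.flag
    · subst h1
      rw [hι1]
      simp [PlaneGraph.subdivide]
    · rw [hι2 f h1]
      rfl

variable (x)

/-- The positions of the vertices of the subdivided curve. -/
def subdividePos (p : C.cellLattice × ℤ) (v : Option C.V) : Fin 2 → ℤ :=
  v.elim (p.1.1.1 (C.bdry x.flag) + p.2 • C.dir x.flag) p.1.1.1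

/-- The lengths of the edges of the subdivided curve. -/
def subdivideLen (p : C.cellLattice × ℤ) : C.F ⊕ Bool → ℤ :=
  Sum.elim (fun f => if f = x.flag then p.2 else if f = C.inv x.flag then
      p.1.1.2 x.flag - p.2 else p.1.1.2 f)
    fun b => if b then (if C.inv x.flag = x.flag then 0 else p.1.1.2 x.flag - p.2) else p.2

lemma subdividePos_add (p q : C.cellLattice × ℤ) (v : Option C.V) :
    subdividePos x (p + q) v = subdividePos x p v + subdividePos x q v := by
  rcases v with _ | v
  · simp [subdividePos, add_mul, add_add_add_comm]
  · simp [subdividePos]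

lemma subdivideLen_add (p q : C.cellLattice × ℤ) (f : C.F ⊕ Bool) :
    subdivideLen x (p + q) f = subdivideLen x p f + subdivideLen x q f := by
  rcases f with f | b
  · by_cases h1 : f = x.flag
    · simp [subdivideLen, h1]
    · by_cases h2 : f = C.inv x.flag
      · simp only [subdivideLen, Sum.elim_inl, if_neg h1, if_pos h2]
        simp
        ring
      · simp [subdivideLen, h1, h2]
  · cases b
    · simp [subdivideLen]
    · by_cases h : C.inv x.flag = x.flag
      · simp [subdivideLen, h]
      · simp only [subdivideLen, Sum.elim_inr, if_true, if_neg h]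
        simp
        ring

lemma subdivide_mem_cellLattice (p : C.cellLattice × ℤ) :
    (subdividePos x p, subdivideLen x p) ∈ (C.subdivide x).cellLattice := by
  obtain ⟨⟨z, h1, h2, h3⟩, s⟩ := p
  have key := C.inv_inv
  refine ⟨?_, ?_, ?_⟩
  · rintro (f | b)
    · by_cases hf1 : f = x.flag
      · simp [subdivide, subdivideLen, hf1]
      · by_cases hf2 : f = C.inv x.flag
        · have : C.inv x.flag ≠ x.flag := fun h => hf1 (hf2.trans h)
          simp [subdivide, subdivideLen, hf2, this]
        · have h3 : C.inv f ≠ x.flag := fun h => hf2 (by rw [← h, key])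
          have h4 : C.inv f ≠ C.inv x.flag := fun h => hf1 (by rw [← key f, h, key])
          simp [subdivide, subdivideLen, hf1, hf2, h3, h4, h1]
    · cases b
      · simp [subdivide, subdivideLen]
      · by_cases h : C.inv x.flag = x.flag <;> simp [subdivide, subdivideLen, h]
  · rintro (f | b) hf
    · have hf : ¬ (C.subdivide x).IsBounded (Sum.inl f) := not_not.2 hf
      have hf := not_or.1 (mt (subdivide_isBounded_inl x f).2 hf)
      have hb : C.inv f = f := not_not.1 hf.1
      have hf2 : f ≠ C.inv x.flag := fun h => hf.2 (by rw [← hb, h, key])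
      simp [subdivideLen, hf.2, hf2, h2 f hb]
    · cases b
      · exact absurd hf (subdivide_isBounded_false x)
      · have : C.inv x.flag = x.flag :=
          not_not.1 fun h => (subdivide_isBounded_true x).2 h hf
        simp [subdivideLen, this]
  · rintro (f | b) i
    · by_cases hf1 : f = x.flag
      · simp [subdivide, subdividePos, subdivideLen, hf1]
      · by_cases hf2 : f = C.inv x.flag
        · have h3' : C.inv x.flag ≠ x.flag := fun h => hf1 (hf2.trans h)
          simp [subdivide, subdividePos, subdivideLen, hf2, h3', C.dir_inv _ h3', h3]
          ring
        · simpa [subdivide, subdividePos, subdivideLen, hf1, hf2] using h3 f i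
    · cases b
      · simp [subdivide, subdividePos, subdivideLen]
      · by_cases h3' : C.inv x.flag = x.flag
        · simp [subdivide, subdividePos, subdivideLen, h3']
        · simp [subdivide, subdividePos, subdivideLen, h3', h3]
          ring

/-- A point of the lattice and the distance to the new vertex give a point of the lattice of the
subdivided curve. -/
def subdivideLattice : C.cellLattice × ℤ →+ (C.subdivide x).cellLattice :=
  AddMonoidHom.mk' (fun p => ⟨(subdividePos x p, subdivideLen x p), subdivide_mem_cellLattice x p⟩)
    fun p q => Subtype.ext (Prod.ext (funext fun v => subdividePos_add x p q v)
      (funext fun f => subdivideLen_add x p q f))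

lemma subdivideLattice_snd (p : C.cellLattice × ℤ) :
    (subdivideLattice x p).1.2 = subdivideLen x p := rfl

lemma subdivideLattice_none (p : C.cellLattice × ℤ) :
    (subdivideLattice x p).1.1 none = p.1.1.1 (C.bdry x.flag) + p.2 • C.dir x.flag := rfl

/-- This reduces statements about lattice points of the subdivided curve to the original curve
together with the distance of the new vertex along its edge, an arbitrary integer here. -/
lemma subdivideLattice_surjective : Function.Surjective (subdivideLattice x) := by
  rintro ⟨y, h1, h2, h3⟩
  have hpos : ∀ i, y.1 none i = y.1 (some (C.bdry x.flag)) i +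
      y.2 (Sum.inl x.flag) * C.dir x.flag i := by
    intro i
    have := h3 (Sum.inl x.flag) i
    rwa [subdivide_inv_flag] at this
  have hfalse : y.2 (Sum.inr false) = y.2 (Sum.inl x.flag) := by
    have := h1 (Sum.inl x.flag)
    rwa [subdivide_inv_flag] at this
  have hend : ¬ C.IsBounded x.flag → y.2 (Sum.inr true) = 0 := fun hx =>
    h2 (Sum.inr true) (subdivide_inv_true_of_end x hx)
  have htrue : C.IsBounded x.flag → y.2 (Sum.inl (C.inv x.flag)) = y.2 (Sum.inr true) := by
    intro hx
    have := h1 (Sum.inr true)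
    rwa [subdivide_inv_true x hx] at this
  have hpos' : C.IsBounded x.flag → ∀ i, y.1 (some (C.bdry (C.inv x.flag))) i =
      y.1 none i + y.2 (Sum.inr true) * C.dir x.flag i := by
    intro hx i
    have := h3 (Sum.inr true) i
    rw [subdivide_inv_true x hx] at this
    simpa [subdivide] using this
  have hinv : ∀ f, (C.inv f = x.flag) = (f = C.inv x.flag) := fun f =>
    propext ⟨fun h => by rw [← h, C.inv_inv], fun h => by rw [h, C.inv_inv]⟩
  have hinv' : ∀ f, (C.inv f = C.inv x.flag) = (f = x.flag) := fun f =>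
    propext C.inv_injective.eq_iff
  -- The original bounded edge gets the sum of the lengths of its two halves. If the edge is an end,
  -- its length is 0 by convention, whatever the length of the new bounded piece.
  let z : C.cellLattice := ⟨(fun u => y.1 (some u), fun f => if f = x.flag ∨ f = C.inv x.flag then
      (if C.IsBounded x.flag then y.2 (Sum.inl x.flag) + y.2 (Sum.inr true) else 0)
      else y.2 (Sum.inl f)), by
    refine ⟨fun f => ?_, fun f hf => ?_, fun f i => ?_⟩
    · by_cases hf1 : f = x.flag
      · simp [hf1]
      by_cases hf2 : f = C.inv x.flag
      · simp [hf2, C.inv_inv]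
      have := h1 (Sum.inl f)
      rw [subdivide_inv_of_ne x hf1 hf2] at this
      simp [hinv, hinv', hf1, hf2, this]
    · by_cases hf1 : f = x.flag
      · subst hf1
        simp [IsBounded, hf]
      by_cases hf2 : f = C.inv x.flag
      · subst hf2
        rw [C.inv_inv] at hf
        exact absurd hf.symm hf1
      have := h2 (Sum.inl f)
      rw [subdivide_inv_of_ne x hf1 hf2, hf] at this
      simp [hf1, hf2, this rfl]
    · by_cases hf1 : f = x.flag
      · subst hf1
        by_cases hx : C.IsBounded x.flag
        · simp only [true_or, if_true, if_pos hx, hpos' hx, hpos]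
          ring
        · simp [hx, show C.inv x.flag = x.flag from not_not.1 hx]
      by_cases hf2 : f = C.inv x.flag
      · subst hf2
        have hx : C.IsBounded x.flag := hf1
        simp only [or_true, if_true, if_pos hx, hpos' hx, hpos, C.inv_inv, C.dir_inv _ hx,
          Pi.neg_apply]
        ring
      have := h3 (Sum.inl f) i
      rw [subdivide_inv_of_ne x hf1 hf2] at this
      simp only [hf1, hf2, or_self, if_false]
      exact this⟩
  refine ⟨(z, y.2 (Sum.inl x.flag)), ?_⟩
  apply Subtype.ext
  refine Prod.ext (funext ?_) (funext ?_)
  · rintro (_ | u)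
    · ext i
      rw [subdivideLattice_none]
      simp [z, hpos]
    · rfl
  · rw [subdivideLattice_snd]
    rintro (f | b)
    · by_cases hf1 : f = x.flag
      · simp [subdivideLen, hf1]
      by_cases hf2 : f = C.inv x.flag
      · subst hf2
        have hx : C.IsBounded x.flag := hf1
        simp [subdivideLen, hf1, z, hx, htrue hx]
      · simp [subdivideLen, hf1, hf2, z]
    · cases b
      · simp [subdivideLen, hfalse]
      · by_cases hx : C.IsBounded x.flag
        · have : C.inv x.flag ≠ x.flag := hx
          simp [subdivideLen, this, z, hx]
        · have : C.inv x.flag = x.flag := not_not.1 hx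
          simp [subdivideLen, this, hend hx]

end Subdivide

end PlaneGraph

lemma eq_zero_of_det2_ne_zero {u v : Fin 2 → ℤ} (h : det2 u v ≠ 0) {s t : ℤ}
    (hst : s • u + t • v = 0) : s = 0 ∧ t = 0 := by
  have h0 := congrFun hst 0
  have h1 := congrFun hst 1
  simp only [Pi.add_apply, Pi.smul_apply, smul_eq_mul, Pi.zero_apply] at h0 h1
  rw [det2] at h
  constructor
  · refine (mul_eq_zero.1 (?_ : s * (u 0 * v 1 - u 1 * v 0) = 0)).resolve_right h
    linear_combination v 1 * h0 - v 0 * h1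
  · refine (mul_eq_zero.1 (?_ : t * (u 0 * v 1 - u 1 * v 0) = 0)).resolve_right h
    linear_combination u 0 * h1 - u 1 * h0

lemma index_range_det2_neg (a b : Fin 2 → ℤ) (hab : det2 a b ≠ 0) (f : ℤ × ℤ →+ (Fin 2 → ℤ))
    (hf : ∀ s t, f (s, t) = s • a - t • b) : f.range.index = (det2 a b).natAbs := by
  have hneg : det2 a (-b) = - det2 a b := by simp [det2]; ring
  rw [index_range_det2 a (-b) (by rwa [hneg, neg_ne_zero]) f fun s t => by
    rw [hf, smul_neg, sub_eq_add_neg], hneg, Int.natAbs_neg]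

/-- Vectors in a subgroup generated by parallel vectors are parallel. -/
lemma det2_eq_zero_of_mem_closure {S : Set (Fin 2 → ℤ)}
    (hS : ∀ a ∈ S, ∀ b ∈ S, det2 a b = 0) {u v : Fin 2 → ℤ} (hu : u ∈ AddSubgroup.closure S)
    (hv : v ∈ AddSubgroup.closure S) : det2 u v = 0 := by
  have hadd : ∀ a b c, det2 (a + b) c = det2 a c + det2 b c := fun a b c => by
    simp only [det2, Pi.add_apply]; ring
  have hadd' : ∀ a b c, det2 a (b + c) = det2 a b + det2 a c := fun a b c => by
    simp only [det2, Pi.add_apply]; ring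
  have hneg : ∀ a b, det2 (-a) b = - det2 a b := fun a b => by
    simp only [det2, Pi.neg_apply]; ring
  have hneg' : ∀ a b, det2 a (-b) = - det2 a b := fun a b => by
    simp only [det2, Pi.neg_apply]; ring
  induction hu using AddSubgroup.closure_induction with
  | mem a ha =>
    induction hv using AddSubgroup.closure_induction with
    | mem b hb => exact hS a ha b hb
    | zero => simp [det2]
    | add b c _ _ hb hc => rw [hadd', hb, hc, add_zero]
    | neg b _ hb => rw [hneg', hb, neg_zero]
  | zero => simp [det2]
  | add b c _ _ hb hc => rw [hadd, hb, hc, add_zero]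
  | neg b _ hb => rw [hneg, hb, neg_zero]

namespace PlaneGraph

/-! ### Multiplicities of the two kinds of elliptic curves -/

section Multiplicities

variable {n : ℕ} {C : PlaneGraph n}

/-- The multiplicity of a rational curve with a contracted loop attached. -/
lemma attachLoop_evjMult (hC : C.IsTree) (hinj : Function.Injective C.evHom)
    (hidx : C.evHom.range.index ≠ 0) {v : C.V} (hv : C.val v = 3) (hu : C.IsUnmarkedVertex v)
    {m : ℝ} {hm : 0 < m} {D : PlaneGraph n} (ψ : Iso (C.attachLoop v m hm) D) :
    D.cellDim = 2 * n + 1 ∧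
      D.evjMult = ((C.vertexMult v : ℚ) - 1) / 2 * C.evHom.range.index := by
  -- A loop closes up automatically, so it imposes no condition on the lattice.
  have hker : (C.diffHom v v).ker = ⊤ := by
    refine eq_top_iff.2 fun x _ => ?_
    rw [AddMonoidHom.mem_ker, diffHom_apply, sub_self]
  have himg : (C.diffHom v v).ker.map C.evHom = C.evHom.range := by
    rw [hker, ← AddMonoidHom.range_eq_map]
  obtain ⟨h1, h2⟩ := attachEdge_absDetEvj hC (v := v) (w := v)
    (fun x _ hx => hinj (hx.trans (map_zero _).symm)) (by rwa [himg]) ψ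
  refine ⟨h1, ?_⟩
  have hd := attachLoop_deficiency (v := v) (hm := hm) hC
  rw [evjMult, h2, himg, ψ.weight_eq (by rw [hd]; decide), attachLoop_weight hC hv hu]

namespace Crossing

variable (c : C.Crossing)

/-- The curve subdivided at the two points of the crossing. -/
abbrev subdivided : PlaneGraph n := (C.subdivide c.fst).subdivide c.snd'

/-- The parametrization of the lattice of the subdivided curve. -/
def latticeHom : (C.cellLattice × ℤ) × ℤ →+ c.subdivided.cellLattice :=
  (subdivideLattice c.snd').comp
    (((subdivideLattice c.fst).comp (AddMonoidHom.fst _ _)).prod (AddMonoidHom.snd _ _))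

lemma latticeHom_surjective : Function.Surjective c.latticeHom := by
  intro y
  obtain ⟨⟨y, t⟩, rfl⟩ := subdivideLattice_surjective c.snd' y
  obtain ⟨p, rfl⟩ := subdivideLattice_surjective c.fst y
  exact ⟨(p, t), rfl⟩

/-- The difference of the positions of the two new vertices. -/
abbrev diff : c.subdivided.cellLattice →+ (Fin 2 → ℤ) :=
  c.subdivided.diffHom (some none) none

lemma diff_latticeHom (z : C.cellLattice) (s t : ℤ) :
    c.diff (c.latticeHom ((z, s), t)) = z.1.1 (C.bdry c.fst.flag) + s • C.dir c.fst.flag -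
      (z.1.1 (C.bdry c.snd.flag) + t • C.dir c.snd.flag) := rfl

lemma evHom_latticeHom (p : (C.cellLattice × ℤ) × ℤ) :
    c.subdivided.evHom (c.latticeHom p) = C.evHom p.1.1 := rfl

lemma range_evHom : c.subdivided.evHom.range = C.evHom.range := by
  ext y
  constructor
  · rintro ⟨x, rfl⟩
    obtain ⟨p, rfl⟩ := c.latticeHom_surjective x
    exact ⟨p.1.1, rfl⟩
  · rintro ⟨z, rfl⟩
    exact ⟨c.latticeHom ((z, 0), 0), rfl⟩

/-- Once the marked points are fixed, injectivity of ev freezes the whole rational curve. Only the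
two new vertices can move, each along its edge, so the differences of their positions form the
lattice spanned by the two directions. -/
lemma index_map_diff (hinj : Function.Injective C.evHom) :
    (c.subdivided.evHom.ker.map c.diff).index =
      (det2 (C.dir c.fst.flag) (C.dir c.snd.flag)).natAbs := by
  let f : ℤ × ℤ →+ (Fin 2 → ℤ) :=
    (c.diff.comp c.latticeHom).comp (((0 : ℤ × ℤ →+ C.cellLattice).prod
      (AddMonoidHom.fst _ _)).prod (AddMonoidHom.snd _ _))
  have hf : ∀ s t, f (s, t) = s • C.dir c.fst.flag - t • C.dir c.snd.flag := fun s t => by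
    refine (c.diff_latticeHom 0 s t).trans ?_
    simp
  rw [← index_range_det2_neg _ _ c.transverse f hf]
  congr 1
  ext y
  constructor
  · rintro ⟨x, hx, rfl⟩
    obtain ⟨⟨⟨z, s⟩, t⟩, rfl⟩ := c.latticeHom_surjective x
    have hz : z = 0 := hinj (((c.evHom_latticeHom _).symm.trans hx).trans (map_zero _).symm)
    subst hz
    exact ⟨(s, t), rfl⟩
  · rintro ⟨⟨s, t⟩, rfl⟩
    exact ⟨c.latticeHom ((0, s), t), map_zero C.evHom, rfl⟩

/-- The rational curve is again frozen, and two transverse lines meet in one point only, so neither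
new vertex can move. -/
lemma eq_zero_of_diff (hinj : Function.Injective C.evHom) (x : c.subdivided.cellLattice)
    (h1 : c.diff x = 0) (h2 : c.subdivided.evHom x = 0) : x = 0 := by
  obtain ⟨⟨⟨z, s⟩, t⟩, rfl⟩ := c.latticeHom_surjective x
  have hz : z = 0 := hinj (((c.evHom_latticeHom _).symm.trans h2).trans (map_zero _).symm)
  subst hz
  rw [c.diff_latticeHom] at h1
  have hst := eq_zero_of_det2_ne_zero (s := s) (t := -t) c.transverse (by
    rw [neg_smul, ← sub_eq_add_neg]
    simpa using h1)
  rw [hst.1, neg_eq_zero.1 hst.2]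
  exact map_zero c.latticeHom

variable {c} {m : ℝ} {hm : 0 < m}

lemma attach_closure (hC : C.IsTree) :
    AddSubgroup.closure {u | ∃ f, (c.attach m hm).OnCycle f ∧ (c.attach m hm).dir f = u} =
      c.diff.range :=
  attachEdge_closure_cycle hC.subdivide.subdivide

/-- Moving one new vertex along its edge shows that both crossing directions lie in the lattice
generated by the directions of the cycle. As they are not parallel, neither are all the edges of the
cycle. -/
lemma attach_deficiency (hC : C.IsTree) : (c.attach m hm).deficiency = 0 := by
  have hu : C.dir c.fst.flag ∈ c.diff.range := ⟨c.latticeHom ((0, 1), 0), by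
    rw [c.diff_latticeHom]; simp⟩
  have hv : C.dir c.snd.flag ∈ c.diff.range := ⟨c.latticeHom ((0, 0), -1), by
    rw [c.diff_latticeHom]; simp⟩
  rw [← c.attach_closure (hm := hm) hC] at hu hv
  have hnot : ¬ ∀ f g, (c.attach m hm).OnCycle f → (c.attach m hm).OnCycle g →
      det2 ((c.attach m hm).dir f) ((c.attach m hm).dir g) = 0 := fun h =>
    c.transverse (det2_eq_zero_of_mem_closure (by
      rintro a ⟨f, hf, rfl⟩ b ⟨g, hg, rfl⟩
      exact h f g hf hg) hu hv)
  rw [deficiency, if_neg, if_neg]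
  · exact fun h => hnot h.2
  · rintro ⟨-, h⟩
    refine hnot fun f g hf _ => ?_
    rw [h f hf]
    simp [det2]

/-- The multiplicity of a rational curve with a contracted edge attached at a crossing. -/
lemma attach_evjMult (hC : C.IsTree) (hinj : Function.Injective C.evHom)
    (hidx : C.evHom.range.index ≠ 0) {D : PlaneGraph n} (ψ : Iso (c.attach m hm) D) :
    D.cellDim = 2 * n + 1 ∧
      D.evjMult = (det2 (C.dir c.fst.flag) (C.dir c.snd.flag)).natAbs * C.evHom.range.index := by
  -- Both sides are the index of the image of the pair (difference, ev). Projecting first to the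
  -- difference gives weight times determinant; projecting first to ev gives the index for `C` times
  -- the lattice of differences at fixed marked points.
  have hprod : c.diff.range.index * (c.diff.ker.map c.subdivided.evHom).index =
      (det2 (C.dir c.fst.flag) (C.dir c.snd.flag)).natAbs * C.evHom.range.index := by
    rw [← index_range_prod, ← c.index_map_diff hinj, ← c.range_evHom, mul_comm,
      ← index_range_prod, ← index_map_equiv' _ (AddEquiv.prodComm), ← AddMonoidHom.range_comp]
    rfl
  have hne : c.diff.range.index * (c.diff.ker.map c.subdivided.evHom).index ≠ 0 := by
    rw [hprod]
    exact mul_ne_zero (Int.natAbs_ne_zero.2 c.transverse) hidx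
  obtain ⟨h1, h2⟩ := attachEdge_absDetEvj hC.subdivide.subdivide (c.eq_zero_of_diff hinj)
    (right_ne_zero_of_mul hne) ψ
  refine ⟨h1, ?_⟩
  have hd := c.attach_deficiency (hm := hm) hC
  rw [evjMult, h2, ψ.weight_eq (by rw [hd]; decide), weight, if_pos hd, weightZero,
    c.attach_closure hC, ← Nat.cast_mul, hprod, Nat.cast_mul]

end Crossing

end Multiplicities

/-! ### Isomorphisms between the curves attached at a crossing -/

section CrossingIso

variable {n : ℕ} {C D : PlaneGraph n}

def Iso.trans {E : PlaneGraph n} (φ : Iso C D) (ψ : Iso D E) : Iso C E :=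
  ⟨φ.onV.trans ψ.onV, φ.onF.trans ψ.onF, by simp [ψ.bdry_eq, φ.bdry_eq],
    by simp [ψ.inv_eq, φ.inv_eq], by simp [ψ.len_eq, φ.len_eq], by simp [ψ.dir_eq, φ.dir_eq],
    by simp [ψ.pos_eq, φ.pos_eq], by simp [ψ.mark_eq, φ.mark_eq]⟩

/-- Attaching edges is compatible with isomorphisms. -/
def Iso.attachEdge (φ : Iso C D) {v w : C.V} {v' w' : D.V} (hv : φ.onV v = v')
    (hw : φ.onV w = w') (hvw : C.pos v = C.pos w) (hvw' : D.pos v' = D.pos w') {m : ℝ}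
    (hm : 0 < m) : Iso (C.attachEdge v w hvw m hm) (D.attachEdge v' w' hvw' m hm) where
  onV := φ.onV
  onF := φ.onF.sumCongr (Equiv.refl Bool)
  bdry_eq := by
    rintro (f | b)
    · exact φ.bdry_eq f
    · cases b
      · exact hv.symm
      · exact hw.symm
  inv_eq := by
    rintro (f | b)
    · exact congrArg Sum.inl (φ.inv_eq f)
    · rfl
  len_eq := by
    rintro (f | b)
    · exact φ.len_eq f
    · rfl
  dir_eq := by
    rintro (f | b)
    · exact φ.dir_eq f
    · rfl
  pos_eq := φ.pos_eq
  mark_eq i := congrArg Sum.inl (φ.mark_eq i)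

def attachEdgeSwap {v w : C.V} (hvw : C.pos v = C.pos w) {m : ℝ} (hm : 0 < m) :
    Iso (C.attachEdge v w hvw m hm) (C.attachEdge w v hvw.symm m hm) where
  onV := Equiv.refl _
  onF := (Equiv.refl C.F).sumCongr Equiv.boolNot
  bdry_eq := by
    rintro (f | b)
    · rfl
    · cases b <;> rfl
  inv_eq := by
    rintro (f | b)
    · rfl
    · cases b <;> rfl
  len_eq := by rintro (f | b) <;> rfl
  dir_eq := by rintro (f | b) <;> rfl
  pos_eq _ := rfl
  mark_eq _ := rfl

/-- Subdividing is compatible with isomorphisms. -/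
def Iso.subdivide (φ : Iso C D) (x : C.EdgePoint) (y : D.EdgePoint) (hf : y.flag = φ.onF x.flag)
    (hs : y.s = x.s) : Iso (C.subdivide x) (D.subdivide y) where
  onV := φ.onV.optionCongr
  onF := φ.onF.sumCongr (Equiv.refl Bool)
  bdry_eq := by
    rintro (f | b)
    · exact congrArg some (φ.bdry_eq f)
    · rfl
  inv_eq := by
    intro f
    change (D.subdivide y).inv (Sum.map φ.onF id f) = Sum.map φ.onF id ((C.subdivide x).inv f)
    rcases f with f | b
    · by_cases h1 : f = x.flag
      · simp [PlaneGraph.subdivide, h1, hf]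
      · by_cases h2 : f = C.inv x.flag
        · have : C.inv x.flag ≠ x.flag := fun h => h1 (h2.trans h)
          simp [PlaneGraph.subdivide, h2, hf, φ.inv_eq, this]
        · simp [PlaneGraph.subdivide, h1, h2, hf, φ.inv_eq]
    · cases b
      · simp [PlaneGraph.subdivide, hf]
      · by_cases h : C.inv x.flag = x.flag <;> simp [PlaneGraph.subdivide, hf, φ.inv_eq, h]
  len_eq := by
    intro f
    change (D.subdivide y).len (Sum.map φ.onF id f) = (C.subdivide x).len f
    rcases f with f | b
    · simp [PlaneGraph.subdivide, hf, φ.inv_eq, hs, φ.len_eq]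
    · simp [PlaneGraph.subdivide, hf, φ.inv_eq, hs, φ.len_eq]
  dir_eq := by
    intro f
    change (D.subdivide y).dir (Sum.map φ.onF id f) = (C.subdivide x).dir f
    rcases f with f | b
    · exact φ.dir_eq f
    · simp [PlaneGraph.subdivide, hf, φ.dir_eq]
  pos_eq := by
    intro v
    change (D.subdivide y).pos (Option.map φ.onV v) = (C.subdivide x).pos v
    rcases v with _ | v
    · funext i
      simp [PlaneGraph.subdivide, EdgePoint.image, hf, hs, φ.bdry_eq, φ.dir_eq, φ.pos_eq]
    · exact φ.pos_eq v
  mark_eq i := congrArg Sum.inl (φ.mark_eq i)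

/-- Describing the point from the other end of the edge. -/
def subdivideFlip (x y : C.EdgePoint) (hx : C.IsBounded x.flag) (hf : y.flag = C.inv x.flag)
    (hs : y.s = C.len x.flag - x.s) : Iso (C.subdivide x) (C.subdivide y) where
  onV := Equiv.refl _
  onF := (Equiv.refl C.F).sumCongr Equiv.boolNot
  bdry_eq := by
    rintro (f | b)
    · rfl
    · cases b <;> rfl
  inv_eq := by
    have hx' : C.inv x.flag ≠ x.flag := hx
    intro f
    change (C.subdivide y).inv (Sum.map id Bool.not f) = Sum.map id Bool.not ((C.subdivide x).inv f)
    rcases f with f | b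
    · by_cases h1 : f = x.flag
      · simp [PlaneGraph.subdivide, h1, hf, C.inv_inv, hx'.symm]
      · by_cases h2 : f = C.inv x.flag
        · simp [PlaneGraph.subdivide, h2, hf, C.inv_inv, hx']
        · simp [PlaneGraph.subdivide, h1, h2, hf, C.inv_inv]
    · cases b
      · simp [PlaneGraph.subdivide, hf, C.inv_inv, hx'.symm]
      · simp [PlaneGraph.subdivide, hf, hx']
  len_eq := by
    have hx' : C.inv x.flag ≠ x.flag := hx
    intro f
    change (C.subdivide y).len (Sum.map id Bool.not f) = (C.subdivide x).len f
    rcases f with f | b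
    · by_cases h1 : f = x.flag
      · simp [PlaneGraph.subdivide, h1, hf, C.inv_inv, hx'.symm, hs, C.len_inv]
      · by_cases h2 : f = C.inv x.flag
        · simp [PlaneGraph.subdivide, h2, hf, C.inv_inv, hx', hs]
        · simp [PlaneGraph.subdivide, h1, h2, hf, C.inv_inv]
    · cases b
      · simp [PlaneGraph.subdivide, hf, C.inv_inv, hx'.symm, hs, C.len_inv]
      · simp [PlaneGraph.subdivide, hf, hx', hs]
  dir_eq := by
    intro f
    change (C.subdivide y).dir (Sum.map id Bool.not f) = (C.subdivide x).dir f
    rcases f with f | b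
    · rfl
    · cases b <;> simp [PlaneGraph.subdivide, hf, C.dir_inv _ hx]
  pos_eq := by
    intro v
    change (C.subdivide y).pos v = (C.subdivide x).pos v
    rcases v with _ | v
    · funext i
      simp [PlaneGraph.subdivide, EdgePoint.image, hf, hs, C.dir_inv _ hx, C.pos_inv]
      ring
    · rfl
  mark_eq _ := rfl

lemma EdgePoint.Same.exists_iso {x y : C.EdgePoint} (h : x.Same y) :
    ∃ φ : Iso (C.subdivide x) (C.subdivide y), (∀ v : Option C.V, φ.onV v = v) ∧
      ∀ f : C.F, φ.onF (Sum.inl f) = Sum.inl f := by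
  rcases h with ⟨h1, h2⟩ | ⟨h0, h1, h2⟩
  · refine ⟨(Iso.mk (Equiv.refl _) (Equiv.refl _) (fun _ => rfl) (fun _ => rfl) (fun _ => rfl)
      (fun _ => rfl) (fun _ => rfl) (fun _ => rfl) : Iso C C).subdivide x y h1 h2, ?_,
      fun _ => rfl⟩
    rintro (_ | v) <;> rfl
  · exact ⟨subdivideFlip x y h0 h1 h2, fun _ => rfl, fun _ => rfl⟩

namespace Crossing

/-- The same crossing with its two points exchanged. -/
def swap (c : C.Crossing) : C.Crossing where
  fst := c.snd
  snd := c.fst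
  flag_ne := c.flag_ne.symm
  flag_ne_inv h := c.flag_ne_inv (by rw [h, C.inv_inv])
  image_eq := c.image_eq.symm
  transverse h := c.transverse (by rw [det2] at h ⊢; linarith)

/-- The correspondence of the flags of the two subdivided curves. -/
def swapFlag {A : Type*} : (A ⊕ Bool) ⊕ Bool → (A ⊕ Bool) ⊕ Bool :=
  Sum.elim (Sum.elim (fun f => Sum.inl (Sum.inl f)) Sum.inr) fun b => Sum.inl (Sum.inr b)

def swapVertex {A : Type*} : Option (Option A) → Option (Option A) :=
  fun v => v.elim (some none) fun v => v.elim none fun v => some (some v)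

lemma swapFlag_swapFlag {A : Type*} (f : (A ⊕ Bool) ⊕ Bool) : swapFlag (swapFlag f) = f := by
  rcases f with (f | b) | b <;> rfl

lemma swapVertex_swapVertex {A : Type*} (v : Option (Option A)) :
    swapVertex (swapVertex v) = v := by
  rcases v with _ | _ | v <;> rfl

set_option linter.unusedSimpArgs false in
lemma swap_inv (c : C.Crossing) (f : (C.F ⊕ Bool) ⊕ Bool) :
    c.swap.subdivided.inv (swapFlag f) = swapFlag (c.subdivided.inv f) := by
  have h1 := c.flag_ne
  have h2 := c.flag_ne_inv
  have h3 : c.fst.flag ≠ C.inv c.snd.flag := c.swap.flag_ne_inv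
  have h4 : C.inv c.snd.flag ≠ C.inv c.fst.flag := fun h => h1 (C.inv_injective h)
  rcases f with (f | b) | b
  · by_cases hf1 : f = c.fst.flag
    · simp [subdivided, subdivide, snd', swap, swapFlag, hf1, h1, h1.symm, h2, h3]
    by_cases hf2 : f = c.snd.flag
    · simp [subdivided, subdivide, snd', swap, swapFlag, hf2, h1, h1.symm, h2, h3]
    by_cases hf3 : f = C.inv c.fst.flag
    · have hf5 : c.snd.flag ≠ f := Ne.symm hf2
      have hf6 : f ≠ C.inv c.snd.flag := fun h => h4 (by rw [← h, hf3])
      simp [subdivided, subdivide, snd', swap, swapFlag, ← hf3, hf1, hf2, hf5, hf6, h1, h1.symm, h3]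
    by_cases hf4 : f = C.inv c.snd.flag
    · simp [subdivided, subdivide, snd', swap, swapFlag, hf4, h1, h1.symm, h2, h3,
        h2.symm, h3.symm, h4, h4.symm, hf4 ▸ hf1, hf4 ▸ hf2]
    · simp [subdivided, subdivide, snd', swap, swapFlag, hf1, hf2, hf3, hf4, h1, h1.symm, h2, h3]
  · cases b
    · simp [subdivided, subdivide, snd', swap, swapFlag, h1, h1.symm, h2, h3]
    · by_cases h : C.inv c.fst.flag = c.fst.flag
      · simp [subdivided, subdivide, snd', swap, swapFlag, h, h1, h1.symm, h2, h3]
      · simp [subdivided, subdivide, snd', swap, swapFlag, h, h1, h1.symm, h2, h3, h2.symm, h4,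
          h4.symm]
  · cases b
    · simp [subdivided, subdivide, snd', swap, swapFlag, h1, h1.symm, h2, h3]
    · by_cases h : C.inv c.snd.flag = c.snd.flag
      · simp [subdivided, subdivide, snd', swap, swapFlag, h, h1, h1.symm, h2, h3]
      · simp [subdivided, subdivide, snd', swap, swapFlag, h, h1, h1.symm, h2, h3, h3.symm, h4]

set_option linter.unusedSimpArgs false in
lemma swap_len (c : C.Crossing) (f : (C.F ⊕ Bool) ⊕ Bool) :
    c.swap.subdivided.len (swapFlag f) = c.subdivided.len f := by
  have h1 := c.flag_ne
  have h2 := c.flag_ne_inv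
  have h3 : c.fst.flag ≠ C.inv c.snd.flag := c.swap.flag_ne_inv
  have h4 : C.inv c.snd.flag ≠ C.inv c.fst.flag := fun h => h1 (C.inv_injective h)
  rcases f with (f | b) | b
  · by_cases hf1 : f = c.fst.flag
    · simp [subdivided, subdivide, snd', swap, swapFlag, hf1, h1, h1.symm, h2, h3]
    by_cases hf2 : f = c.snd.flag
    · simp [subdivided, subdivide, snd', swap, swapFlag, hf2, h1, h1.symm, h2, h3]
    by_cases hf3 : f = C.inv c.fst.flag
    · have hf5 : c.snd.flag ≠ f := Ne.symm hf2
      have hf6 : f ≠ C.inv c.snd.flag := fun h => h4 (by rw [← h, hf3])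
      simp [subdivided, subdivide, snd', swap, swapFlag, ← hf3, hf1, hf2, hf5, hf6, h1, h1.symm, h3]
    by_cases hf4 : f = C.inv c.snd.flag
    · simp [subdivided, subdivide, snd', swap, swapFlag, hf4, h1, h1.symm, h2, h3,
        h2.symm, h3.symm, h4, h4.symm, hf4 ▸ hf1, hf4 ▸ hf2]
    · simp [subdivided, subdivide, snd', swap, swapFlag, hf1, hf2, hf3, hf4, h1, h1.symm, h2, h3]
  · cases b
    · simp [subdivided, subdivide, snd', swap, swapFlag, h1, h1.symm, h2, h3]
    · by_cases h : C.inv c.fst.flag = c.fst.flag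
      · simp [subdivided, subdivide, snd', swap, swapFlag, h, h1, h1.symm, h2, h3]
      · simp [subdivided, subdivide, snd', swap, swapFlag, h, h1, h1.symm, h2, h3, h2.symm, h4,
          h4.symm]
  · cases b
    · simp [subdivided, subdivide, snd', swap, swapFlag, h1, h1.symm, h2, h3]
    · by_cases h : C.inv c.snd.flag = c.snd.flag
      · simp [subdivided, subdivide, snd', swap, swapFlag, h, h1, h1.symm, h2, h3]
      · simp [subdivided, subdivide, snd', swap, swapFlag, h, h1, h1.symm, h2, h3, h3.symm, h4]

/-- The order in which the two edges are subdivided is irrelevant. -/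
def swapIso (c : C.Crossing) : Iso c.subdivided c.swap.subdivided where
  onV := ⟨swapVertex, swapVertex, swapVertex_swapVertex, swapVertex_swapVertex⟩
  onF := ⟨swapFlag, swapFlag, swapFlag_swapFlag, swapFlag_swapFlag⟩
  bdry_eq := by rintro ((f | b) | b) <;> rfl
  inv_eq := c.swap_inv
  len_eq := c.swap_len
  dir_eq := by rintro ((f | b) | b) <;> rfl
  pos_eq := by rintro (_ | _ | v) <;> rfl
  mark_eq _ := rfl

lemma attach_swap_iso (c : C.Crossing) (m : ℝ) (hm : 0 < m) :
    Nonempty (Iso (c.attach m hm) (c.swap.attach m hm)) :=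
  ⟨(c.swapIso.attachEdge (v' := none) (w' := some none) rfl rfl _
    (funext fun i => congrFun c.image_eq i) hm).trans (attachEdgeSwap _ hm)⟩

lemma attach_iso_of_same {c c' : C.Crossing} (h1 : c.fst.Same c'.fst) (h2 : c.snd.Same c'.snd)
    (m : ℝ) (hm : 0 < m) : Nonempty (Iso (c.attach m hm) (c'.attach m hm)) := by
  obtain ⟨φ, hφ1, hφ2⟩ := h1.exists_iso
  -- The descriptions of the two points are changed one at a time. Here the first is already that of
  -- `c'`, while the second is still that of `c`; its flag keeps its name since `φ` fixes the old
  -- flags.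
  let y : (C.subdivide c'.fst).EdgePoint :=
    { flag := Sum.inl c.snd.flag
      s := c.snd.s
      s_pos := c.snd.s_pos
      s_lt := fun hb => by
        have := c.snd'.s_lt ((φ.isBounded_iff (Sum.inl c.snd.flag)).1 ((hφ2 c.snd.flag).symm ▸ hb))
        exact this.trans_eq ((φ.len_eq _).symm.trans
          (congrArg (C.subdivide c'.fst).len (hφ2 c.snd.flag)))
      unmarked := fun hb => c.snd.unmarked ((subdivide_isMarked_inl c'.fst c.snd.flag).1 hb) }
  let φ1 : Iso c.subdivided ((C.subdivide c'.fst).subdivide y) :=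
    φ.subdivide c.snd' y (hφ2 c.snd.flag).symm rfl
  have hy : y.Same c'.snd' := by
    rcases h2 with ⟨h1, h2⟩ | ⟨h0, h1, h2⟩
    · exact Or.inl ⟨congrArg Sum.inl h1, h2⟩
    · have hne : c.snd.flag ≠ c'.fst.flag := fun h => c'.flag_ne_inv (by rw [h1, h])
      have hne' : c.snd.flag ≠ C.inv c'.fst.flag := fun h => c'.flag_ne (by
        rw [h1, h, C.inv_inv])
      refine Or.inr ⟨(subdivide_isBounded_inl c'.fst c.snd.flag).2 (Or.inl h0), ?_, ?_⟩
      · refine Eq.trans ?_ (subdivide_inv_of_ne c'.fst hne hne').symm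
        exact congrArg Sum.inl h1
      · have : (C.subdivide c'.fst).len (Sum.inl c.snd.flag) = C.len c.snd.flag := by
          simp [subdivide, hne, hne']
        exact h2.trans (congrArg (· - c.snd.s) this.symm)
  obtain ⟨φ2, hφ3, -⟩ := hy.exists_iso
  refine ⟨(φ1.trans φ2).attachEdge ?_ ?_ _ _ hm⟩
  · refine (hφ3 (φ1.onV (some none))).trans ?_
    exact congrArg some (hφ1 none)
  · exact (hφ3 (φ1.onV none)).trans rfl

end Crossing

end CrossingIso

/-! ### Counting flags -/

section Counting

variable {n : ℕ} (C : PlaneGraph n)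

lemma not_isBounded_mark (i : Fin n) : ¬ C.IsBounded (C.mark i) := not_not.2 (C.mark_end i)

lemma card_marked : (Finset.univ.filter fun f => C.IsMarked f).card = n := by
  have : (Finset.univ.filter fun f => C.IsMarked f) = Finset.univ.image C.mark := by
    ext f
    simp only [Finset.mem_filter, Finset.mem_univ, true_and, Finset.mem_image]
    rfl
  rw [this, Finset.card_image_of_injective _ C.mark_injective, Finset.card_univ, Fintype.card_fin]

lemma card_flags : Fintype.card C.F =
    (Finset.univ.filter fun f => C.IsBounded f).card + n + C.numFreeEnds := by
  have h1 := Finset.card_filter_add_card_filter_not (s := (Finset.univ : Finset C.F))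
    fun f => C.IsBounded f
  have h2 := Finset.card_filter_add_card_filter_not
    (s := Finset.univ.filter fun f => ¬ C.IsBounded f) fun f => C.IsMarked f
  have h3 : ((Finset.univ.filter fun f => ¬ C.IsBounded f).filter fun f => C.IsMarked f) =
      Finset.univ.filter fun f => C.IsMarked f := by
    ext f
    simp only [Finset.mem_filter, Finset.mem_univ, true_and, and_iff_right_iff_imp]
    rintro ⟨i, rfl⟩
    exact C.not_isBounded_mark i
  have h4 : ((Finset.univ.filter fun f => ¬ C.IsBounded f).filter fun f => ¬ C.IsMarked f) =
      Finset.univ.filter fun f => C.IsFreeEnd f := by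
    ext f
    rw [Finset.mem_filter, Finset.mem_filter, Finset.mem_filter]
    simp only [Finset.mem_univ, true_and, IsFreeEnd, IsBounded, not_not]
  rw [h3, h4, card_marked] at h2
  rw [numFreeEnds, ← Finset.card_univ]
  omega

lemma card_flags_of_trivalent (h : ∀ v, C.val v = 3) :
    Fintype.card C.F = 3 * Fintype.card C.V := by
  have := Finset.card_eq_sum_card_fiberwise (s := (Finset.univ : Finset C.F))
    (t := (Finset.univ : Finset C.V)) (f := C.bdry) fun _ _ => Finset.mem_univ _
  rw [← Finset.card_univ, this]
  change ∑ v, C.val v = _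
  simp [h, mul_comm]

variable {C}

lemma HasDegree.numFreeEnds_eq {d : ℕ} (h : C.HasDegree d) : C.numFreeEnds = 3 * d := by
  have := congrArg Multiset.card h
  simp only [Multiset.card_map, Multiset.card_add, Multiset.card_replicate] at this
  change C.numFreeEnds = _ at this
  omega

lemma HasDegree.dir_mem {d : ℕ} (h : C.HasDegree d) {f : C.F} (hf : C.IsFreeEnd f) :
    C.dir f = ![-1, 0] ∨ C.dir f = ![0, -1] ∨ C.dir f = ![1, 1] := by
  have : C.dir f ∈ (Finset.univ.filter fun f => C.IsFreeEnd f).val.map C.dir :=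
    Multiset.mem_map_of_mem _ (by simpa using hf)
  rw [h] at this
  simp only [Multiset.mem_add, Multiset.mem_replicate] at this
  tauto

lemma HasDegree.dir_ne_zero {d : ℕ} (h : C.HasDegree d) {f : C.F} (hf : C.IsFreeEnd f) :
    C.dir f ≠ 0 := by
  rcases h.dir_mem hf with h | h | h <;> rw [h] <;> intro h0
  · simpa using congrFun h0 0
  · simpa using congrFun h0 1
  · simpa using congrFun h0 0

end Counting

/-! ### Induced curves -/

section Induce

variable {n : ℕ} (C : PlaneGraph n)

/-- The part of a curve at a set of vertices: the edges leaving it are extended to ends. -/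
def induce (D : Set C.V) (hD : ∀ i, C.bdry (C.mark i) ∈ D) : PlaneGraph n where
  V := {v // v ∈ D}
  F := {f // C.bdry f ∈ D}
  bdry f := ⟨C.bdry f, f.2⟩
  inv f := if h : C.bdry (C.inv f) ∈ D then ⟨C.inv f, h⟩ else f
  inv_inv := by
    rintro ⟨f, hf⟩
    by_cases h : C.bdry (C.inv f) ∈ D
    · simp [h, C.inv_inv, hf]
    · simp [h]
  len f := if C.bdry (C.inv f) ∈ D then C.len f else 0
  len_inv := by
    rintro ⟨f, hf⟩
    by_cases h : C.bdry (C.inv f) ∈ D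
    · simp [h, C.inv_inv, hf, C.len_inv]
    · simp [h]
  len_pos := by
    rintro ⟨f, hf⟩ hb
    by_cases h : C.bdry (C.inv f) ∈ D
    · simp only [h, dif_pos, if_true, ne_eq, Subtype.mk.injEq] at hb ⊢
      exact C.len_pos f hb
    · simp [h] at hb
  len_end := by
    rintro ⟨f, hf⟩ hb
    by_cases h : C.bdry (C.inv f) ∈ D
    · simp only [h, dif_pos, if_true, Subtype.mk.injEq] at hb ⊢
      exact C.len_end f hb
    · simp [h]
  dir f := C.dir f
  dir_inv := by
    rintro ⟨f, hf⟩ hb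
    by_cases h : C.bdry (C.inv f) ∈ D
    · simp only [h, dif_pos, ne_eq, Subtype.mk.injEq] at hb ⊢
      exact C.dir_inv f hb
    · simp [h] at hb
  pos v := C.pos v
  pos_inv := by
    rintro ⟨f, hf⟩ i
    by_cases h : C.bdry (C.inv f) ∈ D
    · simp only [h, dif_pos, if_true]
      exact C.pos_inv f i
    · simp [h]
  balanced := by
    rintro ⟨v, hv⟩
    have h := C.balanced v
    rw [← Finset.sum_subset (Finset.subset_univ (Finset.univ.filter fun f => C.bdry f ∈ D)),
      Finset.sum_subtype (p := fun f => C.bdry f ∈ D) _ (by simp)] at h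
    · simpa only [Subtype.mk.injEq] using h
    · intro f _ hf
      rw [if_neg]
      rintro rfl
      exact hf (by simpa using hv)
  mark i := ⟨C.mark i, hD i⟩
  mark_injective i j h := C.mark_injective (congrArg Subtype.val h)
  mark_end i := by
    apply Subtype.ext
    simp [C.mark_end, hD]
  mark_dir i := C.mark_dir i

end Induce

/-- A rational curve of degree `d` through points in general position. -/
structure IsGeneric {n : ℕ} (C : PlaneGraph n) (d : ℕ) (p : Fin n → Fin 2 → ℝ) : Prop where
  general : InTropicalGeneralPosition p
  card_eq : n + 1 = 3 * d
  tropical : C.IsTropicalCurve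
  tree : C.IsTree
  degree : C.HasDegree d
  ev_eq : ∀ i, C.ev i = p i

/-! ### Counts of vertices and edges of a rational curve in general position -/

section Generic

variable {n : ℕ} {C : PlaneGraph n} {d : ℕ} {p : Fin n → Fin 2 → ℝ}

lemma IsGeneric.exists_freeEnd (h : C.IsGeneric d p) : ∃ f, C.IsFreeEnd f := by
  by_contra! hcon
  have h1 := h.degree.numFreeEnds_eq
  have h2 := h.card_eq
  rw [numFreeEnds, Finset.filter_false_of_mem fun f _ => hcon f, Finset.card_empty] at h1
  omega

/-- The curve has g + x - 1 = 0 + 3d - 1 = n, so general position applies to it. -/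
lemma IsGeneric.isSimple (h : C.IsGeneric d p) : C.IsSimple := by
  obtain ⟨f, hf⟩ := h.exists_freeEnd
  refine (h.general C h.tropical (fun f hf => h.degree.dir_ne_zero hf)
    (fun v => ⟨f, hf, h.tree.1.2 _ _⟩) h.ev_eq ?_).1
  have h1 := h.tree.2
  have h2 := h.degree.numFreeEnds_eq
  have h3 := h.card_eq
  omega

/-- This is the equality case of `card_bounded_inside_add`, attained by the set of all vertices. It
follows from counting the flags of a trivalent tree with n marked and n + 1 free ends. -/
lemma IsGeneric.card_bounded (h : C.IsGeneric d p) :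
    (Finset.univ.filter fun f => C.IsBounded f).card + 4 * n = 4 * Fintype.card C.V := by
  have h1 := C.card_flags
  have h2 := C.card_flags_of_trivalent h.isSimple.trivalent
  have h3 := h.degree.numFreeEnds_eq
  have h4 := h.tree.card_bounded
  have h5 := h.card_eq
  omega

lemma IsGeneric.card_vertices (h : C.IsGeneric d p) : Fintype.card C.V + 1 = 2 * n := by
  have h1 := h.card_bounded
  have h2 := h.tree.card_bounded
  omega

end Generic

section Induce

variable {n : ℕ} {C : PlaneGraph n} {D : Set C.V} {hD : ∀ i, C.bdry (C.mark i) ∈ D}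

lemma induce_val (v : {v // v ∈ D}) : (C.induce D hD).val v = C.val v := by
  refine Finset.card_nbij (fun f : {f // C.bdry f ∈ D} => f.1) (fun f hf => ?_)
    (Set.injOn_of_injective Subtype.val_injective) fun f hf => ?_
  · have := (Finset.mem_filter.1 hf).2
    exact Finset.mem_filter.2 ⟨Finset.mem_univ _, congrArg Subtype.val this⟩
  · have := (Finset.mem_filter.1 hf).2
    refine ⟨⟨f, this ▸ v.2⟩, ?_, rfl⟩
    exact Finset.mem_coe.2 (Finset.mem_filter.2 ⟨Finset.mem_univ _, Subtype.ext this⟩)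

lemma induce_isBounded (f : {f // C.bdry f ∈ D}) :
    (C.induce D hD).IsBounded f ↔ C.IsBounded f ∧ C.bdry (C.inv f) ∈ D := by
  by_cases h : C.bdry (C.inv f) ∈ D
  · simp [IsBounded, induce, h, Subtype.ext_iff]
  · simp [IsBounded, induce, h]

lemma induce_isMarked (f : {f // C.bdry f ∈ D}) :
    (C.induce D hD).IsMarked f ↔ C.IsMarked f :=
  exists_congr fun _ => Subtype.ext_iff

lemma induce_card_bounded : (Finset.univ.filter fun f => (C.induce D hD).IsBounded f).card =
    (Finset.univ.filter fun f =>
      C.IsBounded f ∧ C.bdry f ∈ D ∧ C.bdry (C.inv f) ∈ D).card := by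
  refine Finset.card_nbij (fun f : {f // C.bdry f ∈ D} => f.1) (fun f hf => ?_)
    (Set.injOn_of_injective Subtype.val_injective) fun f hf => ?_
  · have := (induce_isBounded f).1 (Finset.mem_filter.1 hf).2
    exact Finset.mem_filter.2 ⟨Finset.mem_univ _, this.1, f.2, this.2⟩
  · have := (Finset.mem_filter.1 hf).2
    refine ⟨⟨f, this.2.1⟩, ?_, rfl⟩
    exact Finset.mem_coe.2 (Finset.mem_filter.2
      ⟨Finset.mem_univ _, (induce_isBounded (hD := hD) _).2 ⟨this.1, this.2.2⟩⟩)

lemma induce_adj {f : C.F} (h1 : C.bdry f ∈ D) (h2 : C.bdry (C.inv f) ∈ D) :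
    (C.induce D hD).Adj ⟨C.bdry f, h1⟩ ⟨C.bdry (C.inv f), h2⟩ :=
  ⟨⟨f, h1⟩, rfl, by simp [induce, h2]⟩

/-- Every component of an induced curve has an unmarked end. -/
lemma Connected.induce_reaches_freeEnd (hC : C.Connected) {f₀ : C.F} (hf₀ : C.IsFreeEnd f₀)
    (v : {v // v ∈ D}) : ∃ f, (C.induce D hD).IsFreeEnd f ∧
      Relation.ReflTransGen (C.induce D hD).Adj v ((C.induce D hD).bdry f) := by
  -- `S` is the component of `v` in the induced curve. If it misses the vertex of `f₀`, some edge of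
  -- `C` leaves it; this edge must lead out of `D`, so it has become an end.
  let S : Set C.V := {w | ∃ h : w ∈ D, Relation.ReflTransGen (C.induce D hD).Adj v ⟨w, h⟩}
  by_cases hS : C.bdry f₀ ∈ S
  · obtain ⟨h, hr⟩ := hS
    refine ⟨⟨f₀, h⟩, ⟨?_, fun h' => hf₀.2 ((induce_isMarked _).1 h')⟩, hr⟩
    refine not_not.1 fun h' => ?_
    exact ((induce_isBounded (hD := hD) ⟨f₀, h⟩).1 h').1 hf₀.1
  · obtain ⟨f, ⟨h, hr⟩, hf⟩ := hC.exists_leaving (S := S) ⟨v.2, .refl⟩ hS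
    have hfD : C.bdry (C.inv f) ∉ D := fun h' => hf ⟨h', hr.tail (induce_adj h h')⟩
    refine ⟨⟨f, h⟩, ⟨?_, fun h' => ?_⟩, hr⟩
    · refine not_not.1 fun h' => ?_
      exact hfD ((induce_isBounded (hD := hD) ⟨f, h⟩).1 h').2
    · obtain ⟨i, rfl⟩ := (induce_isMarked _).1 h'
      exact hfD (by rw [C.mark_end]; exact h)

end Induce

section Generic

variable {n : ℕ} {C : PlaneGraph n} {d : ℕ} {p : Fin n → Fin 2 → ℝ}

/-- General position gives g + x - 1 ≥ n for the induced curve, as the opposite inequality implies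
equality. If b flags are bounded there, trivalence gives 3|D| = b + n + x, while g = 1 - |D| + b/2.
Substituting turns the inequality into b ≤ 4|D| - 4n. -/
lemma IsGeneric.card_bounded_inside_add (h : C.IsGeneric d p) {D : Finset C.V}
    (hD : ∀ i, C.bdry (C.mark i) ∈ D) :
    (Finset.univ.filter fun f =>
      C.IsBounded f ∧ C.bdry f ∈ D ∧ C.bdry (C.inv f) ∈ D).card + 4 * n ≤ 4 * D.card := by
  obtain ⟨f₀, hf₀⟩ := h.exists_freeEnd
  have hs := h.isSimple
  let I := C.induce D hD
  have hval : ∀ v : I.V, I.val v = 3 := fun v => (induce_val v).trans (hs.trivalent _)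
  have h1 := I.card_flags
  have h2 := I.card_flags_of_trivalent hval
  have h3 := I.two_mul_numBounded
  have h4 : Fintype.card I.V = D.card :=
    (Fintype.card_congr (α := I.V) (β := {v // v ∈ D}) (Equiv.refl _)).trans (Fintype.card_coe D)
  have h5 : (Finset.univ.filter fun f => I.IsBounded f).card = (Finset.univ.filter fun f =>
      C.IsBounded f ∧ C.bdry f ∈ D ∧ C.bdry (C.inv f) ∈ D).card := by
    rw [induce_card_bounded]
    congr 1
    ext f
    simp only [Finset.mem_filter, Finset.mem_coe]
  have h6 := h.general I (fun v => (hval v).ge)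
    (fun f hf => hs.dir_ne_zero _ fun h' => hf.2 ((induce_isMarked _).2 h'))
    (h.tree.1.induce_reaches_freeEnd hf₀) h.ev_eq
  have h7 : I.genus = 1 - (Fintype.card I.V : ℤ) + (I.numBounded : ℤ) := rfl
  rw [← h5]
  by_cases h9 : I.genus + (I.numFreeEnds : ℤ) - 1 ≤ (n : ℤ)
  · have := (h6 h9).2
    omega
  · omega

/-- A proper set of vertices containing the marked ones is joined to some other vertex by two
edges. -/
lemma IsGeneric.exists_two_flags (h : C.IsGeneric d p) {D : Finset C.V}
    (hD : ∀ i, C.bdry (C.mark i) ∈ D) (hne : Dᶜ.Nonempty) :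
    ∃ f g, f ≠ g ∧ C.bdry f = C.bdry g ∧ C.bdry f ∉ D ∧
      C.bdry (C.inv f) ∈ D ∧ C.bdry (C.inv g) ∈ D := by
  -- Of the 4|V| - 4n bounded flags at most 4|D| - 4n are inside `D`, and at most 2|Dᶜ| - 2 inside
  -- the complement, which is part of a tree. More than |Dᶜ| edges thus join the two, while `hcon`
  -- allows only one for each vertex of the complement.
  by_contra! hcon
  have h1 := h.card_bounded_inside_add hD
  have h2 := h.tree.card_bounded_inside hne
  have h3 := h.card_bounded
  have h4 := D.card_add_card_compl
  let In := Finset.univ.filter fun f =>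
    C.IsBounded f ∧ C.bdry f ∈ D ∧ C.bdry (C.inv f) ∈ D
  let Out := Finset.univ.filter fun f =>
    C.IsBounded f ∧ C.bdry f ∈ Dᶜ ∧ C.bdry (C.inv f) ∈ Dᶜ
  let X := Finset.univ.filter fun f => C.bdry f ∉ D ∧ C.bdry (C.inv f) ∈ D
  have h5 : X.card ≤ Dᶜ.card := by
    refine Finset.card_le_card_of_injOn C.bdry (fun f hf => ?_) fun f hf g hg hfg => ?_
    · exact Finset.mem_coe.2 (Finset.mem_compl.2 (Finset.mem_filter.1 hf).2.1)
    · by_contra hne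
      have hf := (Finset.mem_filter.1 hf).2
      exact hcon f g hne hfg hf.1 hf.2 (Finset.mem_filter.1 hg).2.2
  have h6 : (Finset.univ.filter fun f => C.IsBounded f) ⊆ (In ∪ Out) ∪ (X ∪ X.image C.inv) := by
    intro f hf
    have hf := (Finset.mem_filter.1 hf).2
    simp only [Finset.mem_union, Finset.mem_image, In, Out, X, Finset.mem_filter,
      Finset.mem_univ, true_and, Finset.mem_compl]
    by_cases ha : C.bdry f ∈ D <;> by_cases hb : C.bdry (C.inv f) ∈ D
    · exact Or.inl (Or.inl ⟨hf, ha, hb⟩)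
    · exact Or.inr (Or.inr ⟨C.inv f, ⟨hb, by rwa [C.inv_inv]⟩, C.inv_inv f⟩)
    · exact Or.inr (Or.inl ⟨ha, hb⟩)
    · exact Or.inl (Or.inr ⟨hf, ha, hb⟩)
  have h7 := Finset.card_le_card h6
  have h8 := Finset.card_union_le (In ∪ Out) (X ∪ X.image C.inv)
  have h9 := Finset.card_union_le In Out
  have h10 := Finset.card_union_le X (X.image C.inv)
  have h11 := Finset.card_image_le (s := X) (f := C.inv)
  change In.card + _ ≤ _ at h1
  change Out.card + _ ≤ _ at h2
  omega

/-- The unmarked vertices can be reached one after another, starting from the marked ones, each by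
two edges. -/
lemma IsGeneric.exists_rank_of_subset (h : C.IsGeneric d p) (k : ℕ) : ∀ D : Finset C.V,
    (∀ i, C.bdry (C.mark i) ∈ D) → Dᶜ.card = k →
    ∃ (r : C.V → ℕ) (inc : C.V → Fin 2 → C.F), (∀ v ∈ D, r v = 0) ∧ (∀ v, r v ≤ k) ∧
      (∀ v ∉ D, ∀ w ∉ D, r v = r w → v = w) ∧
      ∀ v ∉ D, 0 < r v ∧ inc v 0 ≠ inc v 1 ∧
        ∀ j, C.bdry (inc v j) = v ∧ r (C.bdry (C.inv (inc v j))) < r v := by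
  induction k with
  | zero =>
    intro D hD hk
    have : ∀ v, v ∈ D := fun v => by
      by_contra hv
      have : v ∈ Dᶜ := Finset.mem_compl.2 hv
      rw [Finset.card_eq_zero.1 hk] at this
      simp at this
    exact ⟨fun _ => 0, fun _ _ => h.exists_freeEnd.choose, fun _ _ => rfl, fun _ => le_rfl,
      fun v hv => absurd (this v) hv, fun v hv => absurd (this v) hv⟩
  | succ k ih =>
    intro D hD hk
    obtain ⟨f, g, hfg, hb, hf, hfD, hgD⟩ := h.exists_two_flags hD
      (Finset.card_pos.1 (by omega))
    obtain ⟨r, inc, h1, h2, h3, h4⟩ := ih (insert (C.bdry f) D)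
      (fun i => Finset.mem_insert_of_mem (hD i)) (by
        rw [Finset.compl_insert, Finset.card_erase_of_mem (Finset.mem_compl.2 hf), hk]
        rfl)
    -- All ranks outside `D` are raised by one. The new vertex `bdry f` had rank 0 in the enlarged
    -- set, so it gets rank 1 and the later vertices follow it.
    let r' : C.V → ℕ := fun v => if v ∈ D then 0 else r v + 1
    have hr' : ∀ v, r' v ≤ r v + 1 := fun v => by
      by_cases hv : v ∈ D <;> simp [r', hv]
    have hrf : r (C.bdry f) = 0 := h1 _ (Finset.mem_insert_self _ _)
    have hne : ∀ v ∉ D, v ≠ C.bdry f → v ∉ insert (C.bdry f) D := fun v hv hvf hmem =>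
      (Finset.mem_insert.1 hmem).elim hvf hv
    refine ⟨r', Function.update inc (C.bdry f) ![f, g], fun v hv => if_pos hv, fun v => ?_,
      fun v hv w hw hvw => ?_, fun v hv => ?_⟩
    · exact (hr' v).trans (Nat.succ_le_succ (h2 v))
    · simp only [r', hv, hw, if_false, Nat.add_right_cancel_iff] at hvw
      by_cases hv' : v = C.bdry f
      · by_cases hw' : w = C.bdry f
        · rw [hv', hw']
        · have := (h4 w (hne w hw hw')).1
          rw [← hvw, hv', hrf] at this
          exact absurd this (lt_irrefl _)
      · by_cases hw' : w = C.bdry f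
        · have := (h4 v (hne v hv hv')).1
          rw [hvw, hw', hrf] at this
          exact absurd this (lt_irrefl _)
        · exact h3 v (hne v hv hv') w (hne w hw hw') hvw
    · have hrv : r' v = r v + 1 := if_neg hv
      refine ⟨by omega, ?_⟩
      by_cases hv' : v = C.bdry f
      · subst hv'
        rw [Function.update_self]
        refine ⟨hfg, fun j => ?_⟩
        fin_cases j
        · exact ⟨rfl, by rw [hrv]; simp [r', hfD]⟩
        · exact ⟨hb.symm, by rw [hrv]; simp [r', hgD]⟩
      · rw [Function.update_of_ne hv']
        obtain ⟨h5, h6, h7⟩ := h4 v (hne v hv hv')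
        refine ⟨h6, fun j => ⟨(h7 j).1, ?_⟩⟩
        have := (h7 j).2
        have := hr' (C.bdry (C.inv (inc v j)))
        omega

end Generic

/-- An ordering of the unmarked vertices in which each of them is joined to earlier vertices or
marked ones by exactly two edges. -/
structure Ranking {n : ℕ} (C : PlaneGraph n) where
  rank : C.V → ℕ
  inc : {v // C.IsUnmarkedVertex v} × Fin 2 → C.F
  rank_mark : ∀ i, rank (C.bdry (C.mark i)) = 0
  rank_pos : ∀ v, C.IsUnmarkedVertex v → 0 < rank v
  rank_inj : ∀ v w, C.IsUnmarkedVertex v → C.IsUnmarkedVertex w → rank v = rank w → v = w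
  rank_le : ∀ v, rank v ≤ Fintype.card C.V
  bdry_inc : ∀ o, C.bdry (inc o) = o.1
  rank_lt : ∀ o, rank (C.bdry (C.inv (inc o))) < rank o.1
  inc_injective : Function.Injective inc
  mark_inj : Function.Injective fun i => C.bdry (C.mark i)
  exhaust : ∀ f, C.IsBounded f → ∃ o, f = inc o ∨ f = C.inv (inc o)

namespace Ranking

variable {n : ℕ} {C : PlaneGraph n} (R : C.Ranking)

lemma inc_ne_inv_inc (o o' : {v // C.IsUnmarkedVertex v} × Fin 2) :
    R.inc o ≠ C.inv (R.inc o') := by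
  intro h
  have h1 := R.rank_lt o
  have h2 := R.rank_lt o'
  rw [h, C.inv_inv, R.bdry_inc] at h1
  rw [← h, R.bdry_inc] at h2
  exact lt_asymm h1 h2

lemma isBounded_inc (o : {v // C.IsUnmarkedVertex v} × Fin 2) : C.IsBounded (R.inc o) :=
  fun h => R.inc_ne_inv_inc o o h.symm

end Ranking

section Generic

variable {n : ℕ} {C : PlaneGraph n} {d : ℕ} {p : Fin n → Fin 2 → ℝ}

lemma card_markedVertices_add :
    (Finset.univ.image fun i => C.bdry (C.mark i)).card +
      Fintype.card {v // C.IsUnmarkedVertex v} = Fintype.card C.V := by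
  rw [Fintype.card_subtype]
  have : (Finset.univ.filter fun v => C.IsUnmarkedVertex v) =
      (Finset.univ.image fun i => C.bdry (C.mark i))ᶜ := by
    ext v
    simp only [Finset.mem_filter, Finset.mem_compl, Finset.mem_image, Finset.mem_univ, true_and,
      not_exists]
    rfl
  rw [this, Finset.card_add_card_compl]

/-- The fields `mark_inj` and `exhaust` come from a count. At least n - 1 of the 2n - 1 vertices are
unmarked, and four distinct bounded flags belong to each (two edges, two flags each). There are only
4n - 4 bounded flags, so both estimates are sharp. -/
lemma IsGeneric.nonempty_ranking (h : C.IsGeneric d p) : Nonempty C.Ranking := by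
  let D := Finset.univ.image fun i => C.bdry (C.mark i)
  have hD : ∀ i, C.bdry (C.mark i) ∈ D := fun i => Finset.mem_image_of_mem _ (Finset.mem_univ i)
  have hU : ∀ v, C.IsUnmarkedVertex v → v ∉ D := fun v hv hm => by
    obtain ⟨i, -, hi⟩ := Finset.mem_image.1 hm
    exact hv i hi
  obtain ⟨r, inc, h1, h2, h3, h4⟩ := h.exists_rank_of_subset _ D hD rfl
  let inc' : {v // C.IsUnmarkedVertex v} × Fin 2 → C.F := fun o => inc o.1 o.2
  have hb : ∀ o, C.bdry (inc' o) = o.1 := fun o => ((h4 o.1 (hU _ o.1.2)).2.2 o.2).1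
  have hlt : ∀ o, r (C.bdry (C.inv (inc' o))) < r o.1 := fun o =>
    ((h4 o.1 (hU _ o.1.2)).2.2 o.2).2
  have hinj : Function.Injective inc' := by
    rintro ⟨u, j⟩ ⟨u', j'⟩ ho
    have hu : u = u' := Subtype.ext (by rw [← hb (u, j), ho, hb])
    subst hu
    have hne := (h4 u.1 (hU _ u.2)).2.1
    have ho : inc u j = inc u j' := ho
    congr 1
    fin_cases j <;> fin_cases j'
    · rfl
    · exact absurd ho hne
    · exact absurd ho.symm hne
    · rfl
  have hni : ∀ o o', inc' o ≠ C.inv (inc' o') := by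
    intro o o' ho
    have h1 := hlt o
    have h2 := hlt o'
    rw [ho, C.inv_inv, hb] at h1
    rw [← ho, hb] at h2
    exact lt_asymm h1 h2
  let A := Finset.univ.image inc'
  have hA : A.card = Fintype.card {v // C.IsUnmarkedVertex v} * 2 := by
    rw [Finset.card_image_of_injective _ hinj, Finset.card_univ, Fintype.card_prod,
      Fintype.card_fin]
  have hA' : (A.image C.inv).card = A.card := Finset.card_image_of_injective _ C.inv_injective
  have hdisj : Disjoint A (A.image C.inv) := by
    refine Finset.disjoint_left.2 fun f hf hf' => ?_
    obtain ⟨o, -, rfl⟩ := Finset.mem_image.1 hf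
    obtain ⟨g, hg, hgo⟩ := Finset.mem_image.1 hf'
    obtain ⟨o', -, rfl⟩ := Finset.mem_image.1 hg
    exact hni o o' hgo.symm
  have hsub : A ∪ A.image C.inv ⊆ Finset.univ.filter fun f => C.IsBounded f := by
    intro f hf
    rw [Finset.mem_filter]
    refine ⟨Finset.mem_univ _, ?_⟩
    rcases Finset.mem_union.1 hf with hf | hf
    · obtain ⟨o, -, rfl⟩ := Finset.mem_image.1 hf
      exact fun h => hni o o h.symm
    · obtain ⟨g, hg, rfl⟩ := Finset.mem_image.1 hf
      obtain ⟨o, -, rfl⟩ := Finset.mem_image.1 hg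
      exact C.isBounded_inv.2 fun h => hni o o h.symm
  have hc1 := Finset.card_le_card hsub
  have hc2 := Finset.card_union_of_disjoint hdisj
  have hc3 := h.tree.card_bounded
  have hc4 := h.card_vertices
  have hc5 := C.card_markedVertices_add
  have hc6 : D.card ≤ n := by
    simpa using Finset.card_image_le (s := (Finset.univ : Finset (Fin n)))
      (f := fun i => C.bdry (C.mark i))
  change D.card + _ = _ at hc5
  refine ⟨⟨r, inc', fun i => h1 _ (hD i), fun v hv => (h4 v (hU v hv)).1,
    fun v w hv hw => h3 v (hU v hv) w (hU w hw),
    fun v => (h2 v).trans (Finset.card_le_univ _), hb, hlt, hinj, ?_, fun f hf => ?_⟩⟩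
  · rw [← Set.injOn_univ, ← Finset.coe_univ, ← Finset.card_image_iff, Finset.card_univ,
      Fintype.card_fin]
    change D.card = n
    omega
  · have heq := Finset.eq_of_subset_of_card_le hsub (by omega)
    have hf : f ∈ A ∪ A.image C.inv := heq ▸ Finset.mem_filter.2 ⟨Finset.mem_univ _, hf⟩
    rcases Finset.mem_union.1 hf with hf | hf
    · obtain ⟨o, -, rfl⟩ := Finset.mem_image.1 hf
      exact ⟨o, Or.inl rfl⟩
    · obtain ⟨g, hg, rfl⟩ := Finset.mem_image.1 hf
      obtain ⟨o, -, rfl⟩ := Finset.mem_image.1 hg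
      exact ⟨o, Or.inr rfl⟩

lemma Ranking.card_unmarked (R : C.Ranking) :
    n + Fintype.card {v // C.IsUnmarkedVertex v} = Fintype.card C.V := by
  rw [← C.card_markedVertices_add, Finset.card_image_of_injective _ R.mark_inj, Finset.card_univ,
    Fintype.card_fin]

end Generic

/-! ### Vertex multiplicities of trivalent vertices -/

lemma det2_dir_of_sum_eq_zero {a b c : Fin 2 → ℤ} (h : a + b + c = 0) :
    det2 b c = det2 a b ∧ det2 c a = det2 a b := by
  have h0 := congrFun h 0
  have h1 := congrFun h 1
  simp only [Pi.add_apply, Pi.zero_apply] at h0 h1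
  have hc0 : c 0 = - a 0 - b 0 := by linarith
  have hc1 : c 1 = - a 1 - b 1 := by linarith
  constructor <;> simp only [det2, hc0, hc1] <;> ring

section Trivalent

variable {n : ℕ} {C : PlaneGraph n}

/-- The flags at a trivalent vertex. -/
lemma exists_third_flag {f g : C.F} (h : C.val (C.bdry f) = 3) (hfg : f ≠ g)
    (hb : C.bdry g = C.bdry f) : ∃ e, e ≠ f ∧ e ≠ g ∧ C.bdry e = C.bdry f ∧
      (Finset.univ.filter fun e => C.bdry e = C.bdry f) = {f, g, e} := by
  let s := Finset.univ.filter fun e => C.bdry e = C.bdry f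
  have hs : s.card = 3 := h
  have hfs : f ∈ s := by simp [s]
  have hgs : g ∈ s := by simp [s, hb]
  have h1 : ((s.erase f).erase g).card = 1 := by
    rw [Finset.card_erase_of_mem (Finset.mem_erase.2 ⟨hfg.symm, hgs⟩),
      Finset.card_erase_of_mem hfs, hs]
  obtain ⟨e, he⟩ := Finset.card_eq_one.1 h1
  have hmem : e ∈ (s.erase f).erase g := by rw [he]; exact Finset.mem_singleton_self e
  have hmem' := Finset.mem_erase.1 (Finset.mem_erase.1 hmem).2
  refine ⟨e, hmem'.1, (Finset.mem_erase.1 hmem).1, by simpa [s] using hmem'.2, ?_⟩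
  change s = _
  rw [← he, Finset.insert_erase (Finset.mem_erase.2 ⟨hfg.symm, hgs⟩), Finset.insert_erase hfs]

lemma dir_add_add_eq_zero {f g e : C.F} (hfg : f ≠ g) (hef : e ≠ f) (heg : e ≠ g)
    (h : (Finset.univ.filter fun e => C.bdry e = C.bdry f) = {f, g, e}) :
    C.dir f + C.dir g + C.dir e = 0 := by
  have := C.balanced (C.bdry f)
  rw [← Finset.sum_filter, h, Finset.sum_insert (by simp [hfg, hef.symm]),
    Finset.sum_pair heg.symm, ← add_assoc] at this
  exact this

lemma vertexMult_eq_natAbs {f g : C.F} (h : C.val (C.bdry f) = 3) (hfg : f ≠ g)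
    (hb : C.bdry g = C.bdry f) :
    C.vertexMult (C.bdry f) = (det2 (C.dir f) (C.dir g)).natAbs := by
  obtain ⟨e, hef, heg, -, hs⟩ := exists_third_flag h hfg hb
  have hsum := dir_add_add_eq_zero hfg hef heg hs
  obtain ⟨h1, h2⟩ := det2_dir_of_sum_eq_zero hsum
  have hself : ∀ a, det2 a a = 0 := fun a => by rw [det2]; ring
  have hcomm : ∀ a b, (det2 a b).natAbs = (det2 b a).natAbs := fun a b => by
    rw [← Int.natAbs_neg]; congr 1; rw [det2, det2]; ring
  refine le_antisymm (Finset.sup_le fun x hx => ?_) ?_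
  · obtain ⟨hx1, hx2⟩ := (Finset.mem_filter.1 hx).2
    have hm : ∀ y, C.bdry y = C.bdry f → y = f ∨ y = g ∨ y = e := fun y hy => by
      have : y ∈ Finset.univ.filter fun e => C.bdry e = C.bdry f := by simpa using hy
      rw [hs] at this
      simpa using this
    rcases hm _ hx1 with h3 | h3 | h3 <;> rcases hm _ hx2 with h4 | h4 | h4 <;> rw [h3, h4]
    · simp [hself]
    · rw [hcomm, h2]
    · rw [hcomm]
    · simp [hself]
    · rw [h1]
    · rw [h2]
    · rw [hcomm, h1]
    · simp [hself]
  · exact Finset.le_sup (f := fun x : C.F × C.F => (det2 (C.dir x.1) (C.dir x.2)).natAbs)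
      (Finset.mem_filter.2 ⟨Finset.mem_univ (f, g), rfl, hb⟩)

/-- Two unmarked edges at a trivalent vertex of an immersed curve are not parallel. -/
lemma IsSimple.det2_ne_zero (hC : C.IsSimple) {f g : C.F} (hu : C.IsUnmarkedVertex (C.bdry f))
    (hfg : f ≠ g) (hb : C.bdry g = C.bdry f) : det2 (C.dir f) (C.dir g) ≠ 0 := by
  intro h0
  obtain ⟨e, hef, heg, hbe, hs⟩ := exists_third_flag (hC.trivalent _) hfg hb
  have hsum := dir_add_add_eq_zero hfg hef heg hs
  have hnm : ∀ y, C.bdry y = C.bdry f → ¬ C.IsMarked y := by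
    rintro y hy ⟨i, rfl⟩
    exact hu i hy
  have hf := hC.dir_ne_zero f (hnm f rfl)
  have hsq : ∀ x, C.bdry x = C.bdry f →
      0 < C.dir x 0 * C.dir x 0 + C.dir x 1 * C.dir x 1 := by
    intro x hx
    by_contra! hle
    refine hC.dir_ne_zero x (hnm x hx) (funext fun i => ?_)
    have h1 : C.dir x 0 = 0 := by
      nlinarith [mul_self_nonneg (C.dir x 0), mul_self_nonneg (C.dir x 1)]
    have h2 : C.dir x 1 = 0 := by
      nlinarith [mul_self_nonneg (C.dir x 0), mul_self_nonneg (C.dir x 1)]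
    fin_cases i
    · exact h1
    · exact h2
  -- Parallel flags at one vertex have negative scalar product: otherwise suitable positive
  -- multiples of their directions agree, against `immersed`.
  have key : ∀ x y, C.bdry x = C.bdry f → C.bdry y = C.bdry f → x ≠ y →
      det2 (C.dir x) (C.dir y) = 0 → C.dir x 0 * C.dir y 0 + C.dir x 1 * C.dir y 1 < 0 := by
    intro x y hx hy hxy hdet
    by_contra! hge
    have hx2 := hsq x hx
    rw [det2] at hdet
    have hne : C.dir x 0 * C.dir y 0 + C.dir x 1 * C.dir y 1 ≠ 0 := fun h0 => by
      refine (mul_pos hx2 (hsq y hy)).ne' ?_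
      linear_combination (C.dir x 0 * C.dir y 0 + C.dir x 1 * C.dir y 1) * h0 +
        (C.dir x 0 * C.dir y 1 - C.dir x 1 * C.dir y 0) * hdet
    refine hC.immersed x y (hnm x hx) (hnm y hy) hxy (hx.trans hy.symm)
      (C.dir x 0 * C.dir y 0 + C.dir x 1 * C.dir y 1).toNat
      (C.dir x 0 * C.dir x 0 + C.dir x 1 * C.dir x 1).toNat (by omega) (by omega) ?_
    funext i
    rw [Pi.smul_apply, Pi.smul_apply, nsmul_eq_mul, nsmul_eq_mul, Int.toNat_of_nonneg hge,
      Int.toNat_of_nonneg hx2.le]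
    fin_cases i
    · simp only [Fin.zero_eta]; linear_combination (C.dir x 1) * hdet
    · simp only [Fin.mk_one]; linear_combination (- C.dir x 0) * hdet
  obtain ⟨h1, h2⟩ := det2_dir_of_sum_eq_zero hsum
  have hcomm : ∀ a b, det2 a b = 0 → det2 b a = 0 := fun a b h => by
    rw [det2] at h ⊢; linarith
  have k1 := key f g rfl hb hfg h0
  have k2 := key f e rfl hbe hef.symm (hcomm _ _ (h2.trans h0))
  have k3 := key g e hb hbe heg.symm (h1.trans h0)
  -- If two of the three directions are parallel, all are, and they would be pairwise opposite. But
  -- for parallel vectors (f·g)(f·e) = |f|²(g·e), where the left side is positive and the right side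
  -- negative.
  have k4 := mul_pos_of_neg_of_neg k1 k2
  have k5 := mul_neg_of_pos_of_neg (hsq f rfl) k3
  rw [det2] at h0
  refine (k5.trans k4).ne' ?_
  linear_combination (-(C.dir f 0 * C.dir e 1 - C.dir f 1 * C.dir e 0)) * h0

end Trivalent

end PlaneGraph

section Index

/-- Functions on a disjoint union. -/
def sumPiEquiv (A B : Type*) : (B → ℤ) × (A → ℤ) ≃+ (A ⊕ B → ℤ) where
  toFun x := Sum.elim x.2 x.1
  invFun y := (fun b => y (Sum.inr b), fun a => y (Sum.inl a))
  left_inv _ := rfl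
  right_inv y := by ext (a | b) <;> rfl
  map_add' x y := by ext (a | b) <;> rfl

/-- The diagonal block of one unmarked vertex. Rows are its two position coordinates and the lengths
of the two edges to earlier vertices; columns are the two components of the equations of these
edges, with directions `x` and `y`. -/
lemma det_edgeBlock (x y : Fin 2 → ℤ) :
    (Matrix.of fun (a b : Fin 2 × Fin 2) => - (if a = (0, b.2) then (1 : ℤ) else 0) -
      (if a = (1, b.1) then ![x, y] b.1 b.2 else 0)).det.natAbs = (det2 x y).natAbs := by
  rw [← Matrix.det_reindex_self (finProdFinEquiv : Fin 2 × Fin 2 ≃ Fin (2 * 2))]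
  have : Matrix.reindex finProdFinEquiv finProdFinEquiv
      (Matrix.of fun (a b : Fin 2 × Fin 2) => - (if a = (0, b.2) then (1 : ℤ) else 0) -
        (if a = (1, b.1) then ![x, y] b.1 b.2 else 0)) =
      (!![-1, 0, -1, 0; 0, -1, 0, -1; - x 0, - x 1, 0, 0; 0, 0, - y 0, - y 1] :
        Matrix (Fin 4) (Fin 4) ℤ) := by
    ext i j
    fin_cases i <;> fin_cases j <;> simp [finProdFinEquiv, Fin.divNat, Fin.modNat]
  rw [this, ← Int.natAbs_neg]
  congr 1
  rw [det2, Matrix.det_succ_row_zero]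
  simp [Fin.sum_univ_succ, Matrix.det_fin_three, Fin.succAbove]
  ring

end Index

namespace PlaneGraph

/-! ### The multiplicity of a rational curve as the index of the evaluation map -/

namespace Ranking

variable {n : ℕ} {C : PlaneGraph n} (R : C.Ranking)

/-- Coordinates: positions of the marked vertices, and for every unmarked vertex its position and
the lengths of the two edges leading to it. -/
abbrev Coord (C : PlaneGraph n) : Type :=
  (Fin n × Fin 2) ⊕ {v // C.IsUnmarkedVertex v} × (Fin 2 × Fin 2)

/-- The coordinate which is the position of the given vertex. -/
def posCoord (C : PlaneGraph n) (v : C.V) (k : Fin 2) : Coord C :=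
  if h : C.IsUnmarkedVertex v then Sum.inr (⟨v, h⟩, (0, k))
  else Sum.inl ((not_forall.1 h).choose, k)

lemma posCoord_unmarked (u : {v // C.IsUnmarkedVertex v}) (k : Fin 2) :
    posCoord C u k = Sum.inr (u, (0, k)) := dif_pos u.2

include R in
lemma posCoord_mark (i : Fin n) (k : Fin 2) :
    posCoord C (C.bdry (C.mark i)) k = Sum.inl (i, k) := by
  have h : ¬ C.IsUnmarkedVertex (C.bdry (C.mark i)) := fun h => h i rfl
  rw [posCoord, dif_neg h]
  congr 2
  exact R.mark_inj (not_not.1 (not_forall.1 h).choose_spec)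

/-- The rank of the vertex to which a coordinate belongs. -/
def coordRank : Coord C → ℕ := Sum.elim (fun _ => 0) fun x => R.rank x.1

lemma coordRank_posCoord (v : C.V) (k : Fin 2) : R.coordRank (posCoord C v k) = R.rank v := by
  by_cases h : C.IsUnmarkedVertex v
  · rw [posCoord, dif_pos h]
    rfl
  · obtain ⟨i, hi⟩ := not_forall.1 h
    have hi := not_not.1 hi
    rw [← hi, R.posCoord_mark, R.rank_mark]
    rfl

/-- The equations of the edges. -/
def edgeHom : (Coord C → ℤ) →+ ({v // C.IsUnmarkedVertex v} × (Fin 2 × Fin 2) → ℤ) where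
  toFun y x := y (posCoord C (C.bdry (C.inv (R.inc (x.1, x.2.1)))) x.2.2) -
    y (Sum.inr (x.1, (0, x.2.2))) -
    y (Sum.inr (x.1, (1, x.2.1))) * C.dir (R.inc (x.1, x.2.1)) x.2.2
  map_zero' := by ext; simp
  map_add' y z := by
    ext
    simp only [Pi.add_apply]
    ring

/-- The positions of the marked vertices. -/
def markHom (C : PlaneGraph n) : (Coord C → ℤ) →+ (Fin n × Fin 2 → ℤ) where
  toFun y i := y (Sum.inl i)
  map_zero' := rfl
  map_add' _ _ := rfl

/-- The edge equations together with the positions of the marked vertices. -/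
def systemHom : (Coord C → ℤ) →+ (Coord C → ℤ) :=
  (sumPiEquiv _ _).toAddMonoidHom.comp (R.edgeHom.prod (markHom C))

lemma systemHom_inr (y : Coord C → ℤ) (x : {v // C.IsUnmarkedVertex v} × (Fin 2 × Fin 2)) :
    R.systemHom y (Sum.inr x) = y (posCoord C (C.bdry (C.inv (R.inc (x.1, x.2.1)))) x.2.2) -
      y (Sum.inr (x.1, (0, x.2.2))) -
      y (Sum.inr (x.1, (1, x.2.1))) * C.dir (R.inc (x.1, x.2.1)) x.2.2 := rfl

/-- The transpose of the matrix of the system. -/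
def systemMatrix : Matrix (Coord C) (Coord C) ℤ :=
  Matrix.of fun i j => R.systemHom (Pi.single i 1) j

lemma systemMatrix_apply (i j : Coord C) :
    R.systemMatrix i j = R.systemHom (Pi.single i 1) j := rfl

lemma toLin_systemMatrix :
    (Matrix.toLin' R.systemMatrix.transpose).toAddMonoidHom = R.systemHom := by
  have : Matrix.toLin' R.systemMatrix.transpose = R.systemHom.toIntLinearMap := by
    rw [← LinearMap.toMatrix'.injective.eq_iff, LinearMap.toMatrix'_toLin']
    ext i j
    rw [LinearMap.toMatrix'_apply, Matrix.transpose_apply, systemMatrix_apply]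
    congr 2
  rw [this]
  rfl

/-- The equation of an edge from `u` towards an earlier vertex contains only the coordinates
belonging to `u` and the position of that earlier vertex. -/
lemma systemMatrix_blockTriangular : R.systemMatrix.BlockTriangular R.coordRank := by
  intro i j hij
  have hne : ∀ k, R.coordRank k ≤ R.coordRank j → (Pi.single i 1 : Coord C → ℤ) k = 0 :=
    fun k hk => Pi.single_eq_of_ne (by rintro rfl; omega) _
  rcases j with j | ⟨u, j, k⟩
  · exact hne _ le_rfl
  · rw [systemMatrix_apply, systemHom_inr, hne, hne, hne]
    · simp
    · exact le_rfl
    · exact le_rfl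
    · rw [coordRank_posCoord]
      exact (R.rank_lt (u, j)).le

lemma det_systemMatrix_block_zero : (R.systemMatrix.toSquareBlock R.coordRank 0).det = 1 := by
  let e : Fin n × Fin 2 → {i // R.coordRank i = 0} := fun i => ⟨Sum.inl i, rfl⟩
  have he : Function.Bijective e := by
    refine ⟨fun i j h => Sum.inl_injective (congrArg Subtype.val h), ?_⟩
    rintro ⟨i | ⟨u, j⟩, h⟩
    · exact ⟨i, rfl⟩
    · exact absurd h (R.rank_pos u u.2).ne'
  rw [← Matrix.det_submatrix_equiv_self (Equiv.ofBijective e he)]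
  convert Matrix.det_one (n := Fin n × Fin 2) (R := ℤ)
  ext i j
  change (Pi.single (Sum.inl i) 1 : Coord C → ℤ) (Sum.inl j) = _
  simp [Pi.single_apply, Matrix.one_apply, eq_comm]

/-- Ranks of unmarked vertices are distinct and positive, so the block belongs to `u` alone, and the
other vertex of each of its edges, having smaller rank, does not enter. -/
lemma natAbs_det_systemMatrix_block (u : {v // C.IsUnmarkedVertex v}) :
    (R.systemMatrix.toSquareBlock R.coordRank (R.rank u)).det.natAbs =
      (det2 (C.dir (R.inc (u, 0))) (C.dir (R.inc (u, 1)))).natAbs := by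
  let e : Fin 2 × Fin 2 → {i // R.coordRank i = R.rank u} := fun i => ⟨Sum.inr (u, i), rfl⟩
  have he : Function.Bijective e := by
    refine ⟨fun i j h => ?_, ?_⟩
    · have := Sum.inr_injective (congrArg Subtype.val h)
      exact (Prod.mk.inj this).2
    · rintro ⟨i | ⟨w, j⟩, h⟩
      · exact absurd h.symm (R.rank_pos u u.2).ne'
      · obtain rfl : w = u := Subtype.ext (R.rank_inj _ _ w.2 u.2 h)
        exact ⟨j, rfl⟩
  rw [← Matrix.det_submatrix_equiv_self (Equiv.ofBijective e he), ← det_edgeBlock]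
  congr 2
  ext a ⟨j, k⟩
  change R.systemHom (Pi.single (Sum.inr (u, a)) 1) (Sum.inr (u, (j, k))) = _
  have h1 : posCoord C (C.bdry (C.inv (R.inc (u, j)))) k ≠ Sum.inr (u, a) := fun h => by
    have h2 := R.rank_lt (u, j)
    have h3 := R.coordRank_posCoord (C.bdry (C.inv (R.inc (u, j)))) k
    rw [h] at h3
    exact h2.ne h3.symm
  have h4 : ![C.dir (R.inc (u, 0)), C.dir (R.inc (u, 1))] j = C.dir (R.inc (u, j)) := by
    fin_cases j <;> rfl
  rw [systemHom_inr, Pi.single_eq_of_ne h1, Matrix.of_apply, h4]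
  simp only [Pi.single_apply, Sum.inr.injEq, Prod.mk.injEq, true_and, zero_sub, ite_mul, one_mul,
    zero_mul, eq_comm (b := a)]

lemma natAbs_det_systemMatrix : R.systemMatrix.det.natAbs =
    ∏ u, (det2 (C.dir (R.inc (u, 0))) (C.dir (R.inc (u, 1)))).natAbs := by
  have hinj : Function.Injective fun u : {v // C.IsUnmarkedVertex v} => R.rank u :=
    fun u w h => Subtype.ext (R.rank_inj _ _ u.2 w.2 h)
  rw [R.systemMatrix_blockTriangular.det, Finset.prod_subset (s₂ := insert 0 (Finset.univ.image
    fun u : {v // C.IsUnmarkedVertex v} => R.rank u))]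
  · rw [Finset.prod_insert, det_systemMatrix_block_zero, one_mul,
      Finset.prod_image hinj.injOn, ← Int.natAbsHom_apply, map_prod]
    · exact Finset.prod_congr rfl fun u _ => R.natAbs_det_systemMatrix_block u
    · intro h
      obtain ⟨u, -, hu⟩ := Finset.mem_image.1 h
      exact (R.rank_pos u u.2).ne' hu
  · intro a ha
    obtain ⟨i | ⟨u, i⟩, -, rfl⟩ := Finset.mem_image.1 ha
    · exact Finset.mem_insert_self _ _
    · exact Finset.mem_insert_of_mem (Finset.mem_image_of_mem _ (Finset.mem_univ u))
  · intro a _ ha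
    have : IsEmpty {i // R.coordRank i = a} :=
      ⟨fun i => ha (i.2 ▸ Finset.mem_image_of_mem _ (Finset.mem_univ i.1))⟩
    exact Matrix.det_isEmpty

lemma inv_eq_inc_iff (f : C.F) (o : {v // C.IsUnmarkedVertex v} × Fin 2) :
    C.inv f = R.inc o ↔ f = C.inv (R.inc o) :=
  ⟨fun h => by rw [← h, C.inv_inv], fun h => by rw [h, C.inv_inv]⟩

lemma inv_eq_inv_inc_iff (f : C.F) (o : {v // C.IsUnmarkedVertex v} × Fin 2) :
    C.inv f = C.inv (R.inc o) ↔ f = R.inc o := C.inv_injective.eq_iff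

/-- Any right-hand side is solved with all lengths 0: on a tree the positions can be chosen with
prescribed differences along the edges. -/
lemma edgeHom_surjective (hC : C.IsTree) : Function.Surjective R.edgeHom := by
  intro t
  let T : {v // C.IsUnmarkedVertex v} × Fin 2 → Fin 2 → ℤ := fun o k => t (o.1, (o.2, k))
  let c : C.F → Fin 2 → ℤ := fun f =>
    (∑ o, if f = R.inc o then T o else 0) - ∑ o, if f = C.inv (R.inc o) then T o else 0
  obtain ⟨h, hh⟩ := hC.exists_potential c fun f _ => by
    simp only [c, R.inv_eq_inc_iff, R.inv_eq_inv_inc_iff, neg_sub]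
  refine ⟨Sum.elim (fun i => h (C.bdry (C.mark i.1)) i.2)
    (fun x => if x.2.1 = 0 then h x.1 x.2.2 else 0), ?_⟩
  have hpos : ∀ v k, (Sum.elim (fun i => h (C.bdry (C.mark i.1)) i.2)
    (fun x => if x.2.1 = 0 then h x.1 x.2.2 else 0) : Coord C → ℤ) (posCoord C v k) = h v k := by
    intro v k
    by_cases hv : C.IsUnmarkedVertex v
    · rw [posCoord_unmarked ⟨v, hv⟩]
      simp
    · obtain ⟨i, hi⟩ := not_forall.1 hv
      rw [← not_not.1 hi, R.posCoord_mark]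
      simp
  ext ⟨u, j, k⟩
  have h1 := congrFun (hh _ (R.isBounded_inc (u, j))) k
  have h2 : c (R.inc (u, j)) = T (u, j) := by
    simp [c, R.inc_ne_inv_inc, R.inc_injective.eq_iff]
  rw [h2, Pi.add_apply, R.bdry_inc] at h1
  change (Sum.elim (fun i => h (C.bdry (C.mark i.1)) i.2)
    (fun x => if x.2.1 = 0 then h x.1 x.2.2 else 0) : Coord C → ℤ)
    (posCoord C (C.bdry (C.inv (R.inc (u, j)))) k) - _ - _ = _
  rw [hpos, h1]
  simp [T]

/-- The coordinates of a point of the lattice of the cell. -/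
def coords (x : C.cellLattice) : Coord C → ℤ :=
  Sum.elim (fun i => x.1.1 (C.bdry (C.mark i.1)) i.2)
    (fun a => if a.2.1 = 0 then x.1.1 a.1 a.2.2 else x.1.2 (R.inc (a.1, a.2.2)))

lemma coords_posCoord (x : C.cellLattice) (v : C.V) (k : Fin 2) :
    R.coords x (posCoord C v k) = x.1.1 v k := by
  by_cases hv : C.IsUnmarkedVertex v
  · rw [posCoord_unmarked ⟨v, hv⟩]
    simp [coords]
  · obtain ⟨i, hi⟩ := not_forall.1 hv
    rw [← not_not.1 hi, R.posCoord_mark]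
    simp [coords]

lemma edgeHom_coords (x : C.cellLattice) : R.edgeHom (R.coords x) = 0 := by
  ext ⟨u, j, k⟩
  have h1 := x.2.2.2 (R.inc (u, j)) k
  rw [R.bdry_inc] at h1
  change R.coords x (posCoord C (C.bdry (C.inv (R.inc (u, j)))) k) - _ - _ = 0
  rw [coords_posCoord, h1]
  simp [coords]

/-- By `exhaust`, the equations of the edges `inc` are those of all bounded edges, so solutions of
the homogeneous system are the points of the lattice of the cell. -/
lemma map_ker_edgeHom : R.edgeHom.ker.map (markHom C) = C.evHom.range := by
  ext z
  constructor
  · rintro ⟨y, hy, rfl⟩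
    have hy : R.edgeHom y = 0 := hy
    let ℓ : C.F → ℤ := fun f =>
      ∑ o, if f = R.inc o ∨ f = C.inv (R.inc o) then y (Sum.inr (o.1, (1, o.2))) else 0
    have hinc : ∀ o, ℓ (R.inc o) = y (Sum.inr (o.1, (1, o.2))) := fun o => by
      simp only [ℓ, R.inc_injective.eq_iff, R.inc_ne_inv_inc, or_false]
      simp
    have hinv : ∀ f, ℓ (C.inv f) = ℓ f := fun f => by
      simp only [ℓ, R.inv_eq_inc_iff, R.inv_eq_inv_inc_iff, or_comm]
    refine ⟨⟨(fun v k => y (posCoord C v k), ℓ), hinv, fun f hf => ?_, fun f i => ?_⟩, ?_⟩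
    · refine Finset.sum_eq_zero fun o _ => if_neg ?_
      rintro (rfl | rfl)
      · exact R.isBounded_inc o hf
      · exact C.isBounded_inv.2 (R.isBounded_inc o) hf
    · by_cases hf : C.IsBounded f
      · have key : ∀ o, y (posCoord C (C.bdry (C.inv (R.inc o))) i) =
            y (posCoord C (C.bdry (R.inc o)) i) + ℓ (R.inc o) * C.dir (R.inc o) i := fun o => by
          have h1 := congrFun hy (o.1, (o.2, i))
          change y (posCoord C (C.bdry (C.inv (R.inc o))) i) - _ - _ = 0 at h1
          rw [hinc, R.bdry_inc, posCoord_unmarked]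
          linarith
        obtain ⟨o, rfl | rfl⟩ := R.exhaust f hf
        · exact key o
        · change y (posCoord C (C.bdry (C.inv (C.inv (R.inc o)))) i) =
            y (posCoord C (C.bdry (C.inv (R.inc o))) i) +
              ℓ (C.inv (R.inc o)) * C.dir (C.inv (R.inc o)) i
          rw [key o, C.inv_inv, hinv, C.dir_inv _ (R.isBounded_inc o)]
          simp
      · have hf : C.inv f = f := not_not.1 hf
        have hz : ℓ f = 0 := by
          refine Finset.sum_eq_zero fun o _ => if_neg ?_
          rintro (rfl | rfl)
          · exact R.isBounded_inc o hf
          · exact C.isBounded_inv.2 (R.isBounded_inc o) hf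
        change y (posCoord C (C.bdry (C.inv f)) i) = y (posCoord C (C.bdry f) i) + ℓ f * _
        rw [hz, hf, zero_mul, add_zero]
    · ext ⟨i, k⟩
      change y (posCoord C (C.bdry (C.mark i)) k) = y (Sum.inl (i, k))
      rw [R.posCoord_mark]
  · rintro ⟨x, rfl⟩
    exact ⟨R.coords x, R.edgeHom_coords x, rfl⟩

/-- The index of the whole system is the product of the block determinants. It is also the index of
the image of the edge equations, which is 1, times the index of the evaluation on their solutions.
-/
lemma index_evHom_range (hC : C.IsTree) (h : ∀ u : {v // C.IsUnmarkedVertex v},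
      det2 (C.dir (R.inc (u, 0))) (C.dir (R.inc (u, 1))) ≠ 0) : C.evHom.range.index =
    ∏ u, (det2 (C.dir (R.inc (u, 0))) (C.dir (R.inc (u, 1)))).natAbs := by
  have h0 : R.systemMatrix.det ≠ 0 := by
    rw [← Int.natAbs_ne_zero, natAbs_det_systemMatrix, Finset.prod_ne_zero_iff]
    exact fun u _ => Int.natAbs_ne_zero.2 (h u)
  have h1 : R.systemHom.range.index = R.systemMatrix.det.natAbs := by
    rw [← toLin_systemMatrix, index_range_toLin _ (by rwa [Matrix.det_transpose]),
      Matrix.det_transpose]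
  rw [← natAbs_det_systemMatrix, ← h1, systemHom, AddMonoidHom.range_comp, index_map_equiv',
    index_range_prod, map_ker_edgeHom,
    AddMonoidHom.range_eq_top_of_surjective _ (R.edgeHom_surjective hC), AddSubgroup.index_top,
    one_mul]

lemma evHom_injective (h : ∀ u : {v // C.IsUnmarkedVertex v},
    det2 (C.dir (R.inc (u, 0))) (C.dir (R.inc (u, 1))) ≠ 0) : Function.Injective C.evHom := by
  have h0 : R.systemMatrix.transpose.det ≠ 0 := by
    rw [Matrix.det_transpose, ← Int.natAbs_ne_zero, natAbs_det_systemMatrix,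
      Finset.prod_ne_zero_iff]
    exact fun u _ => Int.natAbs_ne_zero.2 (h u)
  rw [injective_iff_map_eq_zero]
  intro x hx
  have h1 : R.systemHom (R.coords x) = 0 := by
    ext (i | i)
    · exact congrFun hx i
    · exact congrFun (R.edgeHom_coords x) i
  rw [← toLin_systemMatrix] at h1
  have h2 : R.coords x = 0 := Matrix.eq_zero_of_mulVec_eq_zero h0 (by
    simpa [Matrix.toLin'_apply] using h1)
  refine Subtype.ext (Prod.ext (funext fun v => funext fun k => ?_) (funext fun f => ?_))
  · rw [← R.coords_posCoord, h2]
    rfl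
  · have hinc : ∀ o, x.1.2 (R.inc o) = 0 := fun o => by
      have := congrFun h2 (Sum.inr (o.1, (1, o.2)))
      simpa [coords] using this
    by_cases hf : C.IsBounded f
    · obtain ⟨o, rfl | rfl⟩ := R.exhaust f hf
      · exact hinc o
      · exact (x.2.1 _).trans (hinc o)
    · exact x.2.2.1 f (not_not.1 hf)

end Ranking

section Generic

variable {n : ℕ} {C : PlaneGraph n} {d : ℕ} {p : Fin n → Fin 2 → ℝ}

/-- A ranking of the vertices. -/
def IsGeneric.ranking (h : C.IsGeneric d p) : C.Ranking := h.nonempty_ranking.some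

lemma Ranking.vertexMult_eq (R : C.Ranking) (hC : C.IsSimple) (u : {v // C.IsUnmarkedVertex v}) :
    C.vertexMult u = (det2 (C.dir (R.inc (u, 0))) (C.dir (R.inc (u, 1)))).natAbs := by
  have h1 := R.bdry_inc (u, 0)
  rw [← vertexMult_eq_natAbs (hC.trivalent _) (R.inc_injective.ne (by simp))
    ((R.bdry_inc (u, 1)).trans h1.symm), h1]

lemma Ranking.det2_ne_zero (R : C.Ranking) (hC : C.IsSimple) (u : {v // C.IsUnmarkedVertex v}) :
    det2 (C.dir (R.inc (u, 0))) (C.dir (R.inc (u, 1))) ≠ 0 :=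
  hC.det2_ne_zero ((R.bdry_inc (u, 0)).symm ▸ u.2) (R.inc_injective.ne (by simp))
    ((R.bdry_inc (u, 1)).trans (R.bdry_inc (u, 0)).symm)

lemma IsGeneric.index_evHom_range (h : C.IsGeneric d p) : C.evHom.range.index = C.mult := by
  rw [h.ranking.index_evHom_range h.tree (h.ranking.det2_ne_zero h.isSimple), mult,
    Finset.prod_subtype (p := C.IsUnmarkedVertex) _ (fun v => by
      rw [Finset.mem_filter]; exact and_iff_right (Finset.mem_univ v))]
  exact Finset.prod_congr rfl fun u _ => (h.ranking.vertexMult_eq h.isSimple u).symm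

lemma IsGeneric.mult_ne_zero (h : C.IsGeneric d p) : C.mult ≠ 0 := by
  rw [← h.index_evHom_range, h.ranking.index_evHom_range h.tree
    (h.ranking.det2_ne_zero h.isSimple), Finset.prod_ne_zero_iff]
  exact fun u _ => Int.natAbs_ne_zero.2 (h.ranking.det2_ne_zero h.isSimple u)

lemma IsGeneric.evHom_injective (h : C.IsGeneric d p) : Function.Injective C.evHom :=
  h.ranking.evHom_injective (h.ranking.det2_ne_zero h.isSimple)

end Generic

end PlaneGraph

/-- Two lines in the plane with integral direction vectors: a bound for the parameter of their
intersection point. -/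
lemma abs_le_of_intersection {A B : Fin 2 → ℝ} {u v : Fin 2 → ℤ} {R K s t : ℝ}
    (hA : ∀ i, |A i| ≤ R) (hB : ∀ i, |B i| ≤ R) (hv : ∀ i, |(v i : ℝ)| ≤ K) (hd : det2 u v ≠ 0)
    (h : ∀ i, A i + s * u i = B i + t * v i) : |s| ≤ 4 * R * K := by
  have hK : 0 ≤ K := (abs_nonneg _).trans (hv 0)
  have hR : 0 ≤ R := (abs_nonneg _).trans (hA 0)
  -- Cramer's rule. The determinant is a nonzero integer, hence at least 1 in absolute value.
  have h1 : s * (det2 u v : ℝ) = (B 0 - A 0) * v 1 - (B 1 - A 1) * v 0 := by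
    rw [det2]
    push_cast
    linear_combination (v 1 : ℝ) * h 0 - (v 0 : ℝ) * h 1
  have h2 : (1 : ℝ) ≤ |(det2 u v : ℝ)| := by
    rw [← Int.cast_abs]
    exact_mod_cast Int.one_le_abs hd
  have h3 : ∀ i, |B i - A i| ≤ 2 * R := fun i => by
    have := abs_sub (B i) (A i)
    linarith [hA i, hB i]
  have h4 : ∀ i j, |(B i - A i) * v j| ≤ 2 * R * K := fun i j => by
    rw [abs_mul]
    exact mul_le_mul (h3 i) (hv j) (abs_nonneg _) (by linarith)
  calc |s| ≤ |s| * |(det2 u v : ℝ)| := le_mul_of_one_le_right (abs_nonneg _) h2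
    _ = |(B 0 - A 0) * v 1 - (B 1 - A 1) * v 0| := by rw [← abs_mul, h1]
    _ ≤ |(B 0 - A 0) * v 1| + |(B 1 - A 1) * v 0| := abs_sub _ _
    _ ≤ 4 * R * K := by linarith [h4 0 1, h4 1 0]

namespace PlaneGraph

/-! ### Uniform bounds for the rational curves through the given points -/

section Bounds

variable {n : ℕ} {C : PlaneGraph n} {d : ℕ} {p : Fin n → Fin 2 → ℝ}

/-- The direction of a bounded edge of a rational curve is the sum of the directions of the ends on
one side of it. -/
lemma IsTree.dir_eq_sum (hC : C.IsTree) {f : C.F} (hf : C.IsBounded f) (i : Fin 2) :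
    C.dir f i = ∑ g ∈ Finset.univ.filter fun g => C.IsFreeEnd g,
      (hC.sep f (C.bdry g) - hC.sep f (C.bdry f)) * C.dir g i := by
  -- `χ` is the indicator function of the part of the tree behind `f`. Summing the balancing
  -- conditions over this part, its inner edges cancel, and there remain its ends and the edge of
  -- `f`.
  let χ : C.V → ℤ := fun v => hC.sep f v - hC.sep f (C.bdry f)
  have h1 : ∑ g, χ (C.bdry g) * C.dir g i = 0 := by
    rw [← C.sum_flags_fiberwise]
    refine Finset.sum_eq_zero fun v _ => ?_
    rw [Finset.sum_congr rfl (g := fun g => χ v * C.dir g i), ← Finset.mul_sum,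
      C.balanced_apply, mul_zero]
    intro g hg
    rw [(Finset.mem_filter.1 hg).2]
  have hne : f ≠ C.inv f := fun h => hf h.symm
  have h2 : ∑ g, χ (C.bdry g) * C.dir g i = ∑ g ∈ C.edgeReps,
      ((if C.IsFreeEnd g then χ (C.bdry g) * C.dir g i else 0) -
        ((if g = f then C.dir f i else 0) + if C.inv g = f then C.dir f i else 0)) := by
    rw [C.sum_flags_eq]
    refine Finset.sum_congr rfl fun g _ => ?_
    by_cases hg : C.IsBounded g
    · have h3 : ¬ C.IsFreeEnd g := fun h => hg h.1
      have h4 := hC.sep_inv f hg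
      have h5 : χ (C.bdry (C.inv g)) = χ (C.bdry g) +
          ((if g = f then 1 else 0) - if g = C.inv f then 1 else 0) := by
        simp only [χ, h4]; ring
      have h6 : C.inv g = f ↔ g = C.inv f :=
        ⟨fun h => by rw [← h, C.inv_inv], fun h => by rw [h, C.inv_inv]⟩
      rw [if_pos hg, if_neg h3, h5, C.dir_inv g hg, Pi.neg_apply]
      simp only [h6]
      by_cases h7 : g = f
      · subst h7
        simp [hne]
        ring
      · by_cases h8 : g = C.inv f
        · subst h8
          simp [hne.symm, C.dir_inv f hf]
          ring
        · simp [h7, h8]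
    · have hg' : C.inv g = g := not_not.1 hg
      have h7 : g ≠ f := fun h => hg (h ▸ hf)
      rw [if_neg hg, hg', if_neg h7]
      by_cases h8 : C.IsFreeEnd g
      · simp [h8]
      · have : C.IsMarked g := by
          by_contra h9
          exact h8 ⟨hg', h9⟩
        obtain ⟨j, rfl⟩ := this
        simp [h8, C.mark_dir]
  have h3 : ∑ g ∈ C.edgeReps, ((if g = f then C.dir f i else 0) +
      if C.inv g = f then C.dir f i else 0) = C.dir f i := by
    have h := C.sum_flags_eq fun g => if g = f then C.dir f i else 0
    rw [Finset.sum_ite_eq' Finset.univ f fun _ => C.dir f i, if_pos (Finset.mem_univ f)] at h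
    refine (Finset.sum_congr rfl fun g _ => ?_).trans h.symm
    by_cases hg : C.IsBounded g
    · simp [hg]
    · have h7 : C.inv g ≠ f := fun h => by
        rw [← h] at hf
        exact hg (C.isBounded_inv.1 hf)
      simp [hg, h7]
  have h4 : ∑ g ∈ C.edgeReps, (if C.IsFreeEnd g then χ (C.bdry g) * C.dir g i else 0) =
      ∑ g ∈ Finset.univ.filter fun g => C.IsFreeEnd g, χ (C.bdry g) * C.dir g i := by
    rw [Finset.sum_filter]
    refine Finset.sum_subset (Finset.subset_univ _) fun g _ hg => if_neg fun h => hg ?_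
    rw [mem_edgeReps, h.1]
  rw [h2, Finset.sum_sub_distrib, h3, h4] at h1
  exact (sub_eq_zero.1 h1).symm

lemma HasDegree.abs_dir_le_one (h : C.HasDegree d) {f : C.F} (hf : C.IsFreeEnd f) (i : Fin 2) :
    |C.dir f i| ≤ 1 := by
  rcases h.dir_mem hf with h | h | h <;> rw [h] <;> fin_cases i <;> simp

/-- The direction of a bounded edge is a sum of directions of some of the 3d free ends, whose
entries are at most 1 in absolute value. -/
lemma IsGeneric.abs_dir_le (h : C.IsGeneric d p) (f : C.F) (i : Fin 2) :
    |(C.dir f i : ℝ)| ≤ 3 * d := by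
  have hd : 1 ≤ d := by
    have := h.card_eq
    omega
  suffices |C.dir f i| ≤ 3 * d by exact_mod_cast this
  by_cases hf : C.IsBounded f
  · rw [h.tree.dir_eq_sum hf]
    refine (Finset.abs_sum_le_sum_abs _ _).trans ?_
    have h1 : ∀ g ∈ Finset.univ.filter fun g => C.IsFreeEnd g,
        |(h.tree.sep f (C.bdry g) - h.tree.sep f (C.bdry f)) * C.dir g i| ≤ 1 := by
      intro g hg
      have h2 := h.degree.abs_dir_le_one (Finset.mem_filter.1 hg).2 i
      rcases h.tree.sep_eq_or hf (C.bdry g) with h3 | h3 <;> rw [h3.1]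
      · simp
      · rw [add_sub_cancel_left, one_mul]
        exact h2
    refine (Finset.sum_le_sum h1).trans ?_
    have h2 := h.degree.numFreeEnds_eq
    rw [numFreeEnds] at h2
    simp [h2]
  · by_cases hm : C.IsMarked f
    · obtain ⟨j, rfl⟩ := hm
      simp [C.mark_dir]
    · have := h.degree.abs_dir_le_one ⟨not_not.1 hf, hm⟩ i
      omega

/-- Induction on the rank: an unmarked vertex is the intersection of two non-parallel lines through
earlier vertices. By `abs_le_of_intersection` with directions bounded by 3d, each step enlarges the
bound by the factor 1 + 4(3d)², and ranks do not exceed the number 2n - 1 of vertices. -/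
lemma IsGeneric.abs_pos_le (h : C.IsGeneric d p) {R : ℝ} (hR : ∀ i k, |p i k| ≤ R)
    (hR0 : 0 ≤ R) (v : C.V) (i : Fin 2) :
    |C.pos v i| ≤ R * (1 + 4 * (3 * d) * (3 * d)) ^ (2 * n) := by
  let Q := h.ranking
  have hM : (1 : ℝ) ≤ 1 + 4 * (3 * d) * (3 * d) := le_add_of_nonneg_right (by positivity)
  have key : ∀ k, ∀ v, Q.rank v = k →
      ∀ i, |C.pos v i| ≤ R * (1 + 4 * (3 * d) * (3 * d) : ℝ) ^ k := by
    intro k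
    induction k using Nat.strong_induction_on with
    | _ k ih =>
      intro v hv i
      by_cases hu : C.IsUnmarkedVertex v
      · let u : {v // C.IsUnmarkedVertex v} := ⟨v, hu⟩
        obtain ⟨k, rfl⟩ : ∃ k', k = k' + 1 := ⟨k - 1, by
          have := Q.rank_pos v hu
          omega⟩
        have hA : ∀ j i, |C.pos (C.bdry (C.inv (Q.inc (u, j)))) i| ≤
            R * (1 + 4 * (3 * d) * (3 * d) : ℝ) ^ k := fun j i => by
          have hlt := Q.rank_lt (u, j)
          have hle : Q.rank (C.bdry (C.inv (Q.inc (u, j)))) ≤ k := by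
            have : Q.rank u.1 = k + 1 := hv
            change _ < Q.rank u.1 at hlt
            omega
          refine (ih _ (Nat.lt_succ_of_le hle) _ rfl i).trans ?_
          exact mul_le_mul_of_nonneg_left (pow_le_pow_right₀ hM hle) hR0
        have hpos : ∀ j i, C.pos (C.bdry (C.inv (Q.inc (u, j)))) i +
            (- C.len (Q.inc (u, j))) * C.dir (Q.inc (u, j)) i = C.pos v i := fun j i => by
          rw [C.pos_inv, Q.bdry_inc]
          ring
        have hs := abs_le_of_intersection (hA 0) (hA 1) (fun i => h.abs_dir_le _ i)
          (Q.det2_ne_zero h.isSimple u) fun i => (hpos 0 i).trans (hpos 1 i).symm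
        rw [← hpos 0 i]
        calc _ ≤ |C.pos (C.bdry (C.inv (Q.inc (u, 0)))) i| +
              |(- C.len (Q.inc (u, 0))) * C.dir (Q.inc (u, 0)) i| := abs_add_le _ _
          _ ≤ R * (1 + 4 * (3 * d) * (3 * d) : ℝ) ^ k +
              (4 * (R * (1 + 4 * (3 * d) * (3 * d) : ℝ) ^ k) * (3 * d)) * (3 * d) := by
            refine add_le_add (hA 0 i) ?_
            rw [abs_mul]
            exact mul_le_mul hs (h.abs_dir_le _ i) (abs_nonneg _) ((abs_nonneg _).trans hs)
          _ = _ := by ring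
      · obtain ⟨j, hj⟩ := not_forall.1 hu
        have hj := not_not.1 hj
        have : C.pos v i = p j i := by rw [← h.ev_eq, ev, hj]
        rw [this]
        exact (hR j i).trans (le_mul_of_one_le_right hR0 (one_le_pow₀ hM))
  refine (key _ v rfl i).trans ?_
  refine mul_le_mul_of_nonneg_left (pow_le_pow_right₀ hM ?_) hR0
  have := Q.rank_le v
  have := h.card_vertices
  omega

/-- Lengths and crossing points on curves through the given points are bounded. -/
lemma exists_length_bound (n d : ℕ) (p : Fin n → Fin 2 → ℝ) :
    ∃ B : ℝ, 0 ≤ B ∧ ∀ C : PlaneGraph n, C.IsGeneric d p →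
      (∀ f, C.len f ≤ B) ∧ ∀ c : C.Crossing, c.fst.s ≤ B ∧ c.snd.s ≤ B := by
  let R := ∑ i, ∑ k, |p i k|
  have hR0 : 0 ≤ R := Finset.sum_nonneg fun i _ => Finset.sum_nonneg fun k _ => abs_nonneg _
  have hR : ∀ i k, |p i k| ≤ R := fun i k =>
    (Finset.single_le_sum (f := fun k => |p i k|) (fun k _ => abs_nonneg _)
      (Finset.mem_univ k)).trans (Finset.single_le_sum (f := fun i => ∑ k, |p i k|)
        (fun i _ => Finset.sum_nonneg fun k _ => abs_nonneg _) (Finset.mem_univ i))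
  let S : ℝ := R * (1 + 4 * (3 * d) * (3 * d)) ^ (2 * n)
  have hS : 0 ≤ S := by positivity
  -- `S` bounds all positions. An edge has length at most 2S because some entry of its direction is
  -- a nonzero integer; the other summand bounds the parameters of crossings.
  refine ⟨2 * S + 4 * S * (3 * d), by positivity, fun C h => ⟨fun f => ?_, fun c => ?_⟩⟩
  · have hpos := h.abs_pos_le hR hR0
    have hle : C.len f ≤ 2 * S := by
      by_cases hf : C.IsBounded f
      · have hdir := h.isSimple.dir_ne_zero f (by
          rintro ⟨i, rfl⟩
          exact C.not_isBounded_mark i hf)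
        obtain ⟨i, hi⟩ := Function.ne_iff.1 hdir
        have h1 : (1 : ℝ) ≤ |(C.dir f i : ℝ)| := by
          rw [← Int.cast_abs]
          exact_mod_cast Int.one_le_abs hi
        have h2 : C.len f * C.dir f i = C.pos (C.bdry (C.inv f)) i - C.pos (C.bdry f) i := by
          rw [C.pos_inv]
          ring
        calc C.len f ≤ |C.len f| := le_abs_self _
          _ ≤ |C.len f| * |(C.dir f i : ℝ)| := le_mul_of_one_le_right (abs_nonneg _) h1
          _ = |C.pos (C.bdry (C.inv f)) i - C.pos (C.bdry f) i| := by rw [← abs_mul, h2]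
          _ ≤ |C.pos (C.bdry (C.inv f)) i| + |C.pos (C.bdry f) i| := abs_sub _ _
          _ ≤ S + S := add_le_add (hpos _ _) (hpos _ _)
          _ = 2 * S := by ring
      · rw [C.len_end f (not_not.1 hf)]
        positivity
    have : 0 ≤ 4 * S * (3 * d) := by positivity
    linarith
  · have hpos := h.abs_pos_le hR hR0
    have h1 := abs_le_of_intersection (hpos (C.bdry c.fst.flag)) (hpos (C.bdry c.snd.flag))
      (fun i => h.abs_dir_le c.snd.flag i) c.transverse (congrFun c.image_eq)
    have h2 := abs_le_of_intersection (hpos (C.bdry c.snd.flag)) (hpos (C.bdry c.fst.flag))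
      (fun i => h.abs_dir_le c.fst.flag i) (fun h => c.transverse (by
        rw [det2] at h ⊢
        linarith)) (congrFun c.image_eq.symm)
    exact ⟨by linarith [le_abs_self c.fst.s], by linarith [le_abs_self c.snd.s]⟩

lemma subdivide_len_le {x : C.EdgePoint} {B : ℝ} (h : ∀ f, C.len f ≤ B) (hx : x.s ≤ B)
    (f : (C.subdivide x).F) : (C.subdivide x).len f ≤ B := by
  have h0 : 0 ≤ B := x.s_pos.le.trans hx
  have h1 : C.len x.flag - x.s ≤ B := by linarith [h x.flag, x.s_pos]
  rcases f with f | b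
  · change (if f = x.flag then x.s else if f = C.inv x.flag then C.len x.flag - x.s
      else C.len f) ≤ B
    split_ifs
    exacts [hx, h1, h f]
  · change (if b then (if C.inv x.flag = x.flag then 0 else C.len x.flag - x.s) else x.s) ≤ B
    split_ifs
    exacts [h0, h1, hx]

/-- The length of the cycle at a crossing, without the new edge. -/
def Crossing.pathLength (hC : C.IsTree) (c : C.Crossing) : ℝ :=
  (∑ f ∈ hC.subdivide.subdivide.pathFlags (T := c.subdivided) (some none) none,
    c.subdivided.len f) / 2

lemma Crossing.attach_j (hC : C.IsTree) (c : C.Crossing) {m : ℝ} (hm : 0 < m) :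
    (c.attach m hm).j = m + c.pathLength hC :=
  attachEdge_j hC.subdivide.subdivide

lemma attachLoop_j (hC : C.IsTree) (v : C.V) {m : ℝ} (hm : 0 < m) :
    (C.attachLoop v m hm).j = m := by
  refine (attachEdge_j hC).trans ?_
  rw [hC.pathFlags_self]
  simp

/-- This is the constant L of the theorem. It may not depend on the rational curve, which is chosen
after it. -/
lemma exists_pathLength_bound (n d : ℕ) (p : Fin n → Fin 2 → ℝ) :
    ∃ L : ℝ, 0 ≤ L ∧ ∀ C : PlaneGraph n, ∀ h : C.IsGeneric d p, ∀ c : C.Crossing,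
      c.pathLength h.tree ≤ L := by
  obtain ⟨B, hB0, hB⟩ := exists_length_bound n d p
  -- The factor bounds the number of flags: three at each of the 2n - 1 vertices, and two more for
  -- each of the two subdivisions.
  refine ⟨(6 * n + 4) * B, by positivity, fun C h c => ?_⟩
  obtain ⟨h1, h2⟩ := hB C h
  have h3 : ∀ f, c.subdivided.len f ≤ B :=
    subdivide_len_le (subdivide_len_le h1 (h2 c).1) (h2 c).2
  have h4 : Fintype.card c.subdivided.F = Fintype.card C.F + 4 := by
    refine (Fintype.card_sum (α := C.F ⊕ Bool) (β := Bool)).trans ?_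
    simp
  have h5 := C.card_flags_of_trivalent h.isSimple.trivalent
  have h6 := h.card_vertices
  have h7 : Fintype.card c.subdivided.F ≤ 6 * n + 4 := by omega
  have h8 : ∑ f ∈ h.tree.subdivide.subdivide.pathFlags (T := c.subdivided) (some none) none,
      c.subdivided.len f ≤ (6 * n + 4) * B := by
    refine (Finset.sum_le_card_nsmul _ _ B fun f _ => h3 f).trans ?_
    rw [nsmul_eq_mul]
    refine mul_le_mul_of_nonneg_right ?_ hB0
    exact_mod_cast (Finset.card_le_univ _).trans h7
  have h9 : 0 ≤ (6 * n + 4) * B := by positivity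
  rw [Crossing.pathLength]
  linarith

end Bounds

end PlaneGraph

/-! ### Signs and cross products -/

/-- The sign of a real number, as a real number. -/
abbrev sg (x : ℝ) : ℝ := (SignType.sign x : ℝ)

lemma sg_mul (x y : ℝ) : sg (x * y) = sg x * sg y := by simp [sg, sign_mul]

lemma sg_neg (x : ℝ) : sg (-x) = - sg x := by simp [sg, Left.sign_neg]

lemma sg_of_pos {x : ℝ} (h : 0 < x) : sg x = 1 := by simp [sg, sign_pos h]

lemma sg_of_neg {x : ℝ} (h : x < 0) : sg x = -1 := by simp [sg, sign_neg h]

lemma sg_zero : sg 0 = 0 := by simp [sg]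

lemma sg_mul_self {x : ℝ} (h : x ≠ 0) : sg x * sg x = 1 := by
  rcases h.lt_or_gt with h | h
  · rw [sg_of_neg h]; norm_num
  · rw [sg_of_pos h]; norm_num

lemma abs_eq_self_mul_sg (x : ℝ) : |x| = x * sg x := (self_mul_sign x).symm

lemma abs_mul_sg (x : ℝ) : |x| * sg x = x := abs_mul_sign x

lemma abs_mul_sg_div (x D : ℝ) : |D| * sg (x / D) = D * sg x := by
  by_cases h : D = 0
  · simp [h]
  · have : sg x = sg (x / D) * sg D := by rw [← sg_mul, div_mul_cancel₀ _ h]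
    rw [this, abs_eq_self_mul_sg]
    ring

/-- Made for `starSign`: `a`, `b` depend linearly on one flag and `p`, `q` on another, and each term
on the right is linear in the direction of one of them, so balancing kills it. The right side equals
(|aq| + |bp|)(sg b sg q - sg a sg p). If aq and bp do not have the same sign, |aq| + |bp| = |aq -
bp|; if they do, the second factor is 0. -/
lemma sg_cross_identity (a b p q : ℝ) : |a * q - b * p| * (sg b * sg q - sg a * sg p) =
    q * (|a| * sg b) + b * (|p| * sg q) - a * (|q| * sg p) - p * (|b| * sg a) := by
  have h1 : q * (|a| * sg b) + b * (|p| * sg q) - a * (|q| * sg p) - p * (|b| * sg a) =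
      (|a * q| + |b * p|) * (sg b * sg q - sg a * sg p) := by
    rw [abs_mul, abs_mul]
    linear_combination (-(|a| * sg b)) * abs_mul_sg q - (|p| * sg q) * abs_mul_sg b +
      (|q| * sg p) * abs_mul_sg a + (|b| * sg a) * abs_mul_sg p
  rw [h1]
  rcases le_or_gt ((a * q) * (b * p)) 0 with h | h
  · congr 1
    rcases mul_nonpos_iff.1 h with ⟨h2, h3⟩ | ⟨h2, h3⟩
    · rw [abs_of_nonneg h2, abs_of_nonpos h3, abs_of_nonneg (by linarith)]
      ring
    · rw [abs_of_nonpos h2, abs_of_nonneg h3, abs_of_nonpos (by linarith)]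
      ring
  · have h2 : sg b * sg q = sg a * sg p := by
      have h3 : 0 < (b * q) * (a * p) := by linarith
      rw [← sg_mul, ← sg_mul]
      rcases mul_pos_iff.1 h3 with ⟨h4, h5⟩ | ⟨h4, h5⟩
      · rw [sg_of_pos h4, sg_of_pos h5]
      · rw [sg_of_neg h4, sg_of_neg h5]
    rw [h2]
    ring

/-- The signs are either 1, -1, 0 or two equal ones and their opposite. -/
lemma sg_sum_of_add_eq_zero {x y z : ℝ} (h : x + y + z = 0) (h0 : x ≠ 0 ∨ y ≠ 0) :
    sg x * sg y + sg y * sg z + sg x * sg z = -1 := by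
  rcases lt_trichotomy x 0 with hx | rfl | hx <;> rcases lt_trichotomy y 0 with hy | rfl | hy <;>
    rcases lt_trichotomy z 0 with hz | rfl | hz <;>
    first
    | (exfalso; linarith)
    | (exfalso; simp at h0; done)
    | (simp only [sg_of_pos, sg_of_neg, sg_zero, *]; norm_num)

/-- The cross product of plane vectors. -/
def cross (a b : Fin 2 → ℝ) : ℝ := a 0 * b 1 - a 1 * b 0

namespace PlaneGraph

/-! ### Intersection points of the lines spanned by two edges -/

section Intersection

variable {n : ℕ} (C : PlaneGraph n)

/-- The direction of a flag as a real vector. -/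
def rdir (f : C.F) : Fin 2 → ℝ := fun i => C.dir f i

/-- The cross product of the directions of two flags. -/
def dcross (f g : C.F) : ℝ := cross (C.rdir f) (C.rdir g)

lemma dcross_eq (f g : C.F) : C.dcross f g = (det2 (C.dir f) (C.dir g) : ℤ) := by
  simp [dcross, cross, rdir, det2]

lemma dcross_swap (f g : C.F) : C.dcross g f = - C.dcross f g := by
  simp only [dcross, cross]
  ring

/-- On the line of the flag `f`, the parameter of the intersection point with the line of `g`. -/
def param (f g : C.F) : ℝ :=
  cross (C.pos (C.bdry g) - C.pos (C.bdry f)) (C.rdir g) / C.dcross f g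

variable {C}

lemma rdir_inv {f : C.F} (hf : C.IsBounded f) : C.rdir (C.inv f) = - C.rdir f := by
  ext i
  simp [rdir, C.dir_inv f hf]

lemma dcross_inv_left {f : C.F} (hf : C.IsBounded f) (g : C.F) :
    C.dcross (C.inv f) g = - C.dcross f g := by
  simp only [dcross, rdir_inv hf, cross, Pi.neg_apply]
  ring

lemma dcross_inv_right (f : C.F) {g : C.F} (hg : C.IsBounded g) :
    C.dcross f (C.inv g) = - C.dcross f g := by
  simp only [dcross, rdir_inv hg, cross, Pi.neg_apply]
  ring

lemma dcross_ne_zero_left {f g : C.F} (h : C.dcross f g ≠ 0) : ¬ C.IsMarked f := by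
  rintro ⟨i, rfl⟩
  exact h (by simp [dcross, cross, rdir, C.mark_dir])

lemma dcross_ne_zero_right {f g : C.F} (h : C.dcross f g ≠ 0) : ¬ C.IsMarked g := by
  rintro ⟨i, rfl⟩
  exact h (by simp [dcross, cross, rdir, C.mark_dir])

lemma param_inv_right (f : C.F) {g : C.F} (hg : C.IsBounded g) :
    C.param f (C.inv g) = C.param f g := by
  rw [param, param, dcross_inv_right f hg, rdir_inv hg, ← neg_div_neg_eq, neg_neg]
  congr 1
  simp only [cross, Pi.sub_apply, Pi.neg_apply, C.pos_inv, rdir]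
  ring

lemma param_inv_left {f g : C.F} (hf : C.IsBounded f) (h : C.dcross f g ≠ 0) :
    C.param (C.inv f) g = C.len f - C.param f g := by
  rw [param, param, dcross_inv_left hf, eq_sub_iff_add_eq, div_neg, ← sub_eq_neg_add, ← sub_div,
    div_eq_iff h]
  simp only [cross, dcross, Pi.sub_apply, C.pos_inv, rdir]
  ring

lemma param_spec {f g : C.F} (h : C.dcross f g ≠ 0) (i : Fin 2) :
    C.pos (C.bdry f) i + C.param f g * C.rdir f i =
      C.pos (C.bdry g) i + C.param g f * C.rdir g i := by
  have h' : C.dcross g f ≠ 0 := by rw [dcross_swap]; exact neg_ne_zero.2 h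
  have h1 := div_mul_cancel₀ (cross (C.pos (C.bdry g) - C.pos (C.bdry f)) (C.rdir g)) h
  have h2 := div_mul_cancel₀ (cross (C.pos (C.bdry f) - C.pos (C.bdry g)) (C.rdir f)) h'
  change C.param f g * _ = _ at h1
  change C.param g f * _ = _ at h2
  rw [dcross_swap] at h2
  refine mul_right_cancel₀ h ?_
  simp only [cross, Pi.sub_apply, dcross] at h1 h2 ⊢
  fin_cases i
  · simp only [Fin.zero_eta]
    linear_combination (C.rdir f 0) * h1 + (C.rdir g 0) * h2
  · simp only [Fin.mk_one]
    linear_combination (C.rdir f 1) * h1 + (C.rdir g 1) * h2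

lemma eq_param {f g : C.F} (h : C.dcross f g ≠ 0) {s t : ℝ}
    (hst : ∀ i, C.pos (C.bdry f) i + s * C.rdir f i = C.pos (C.bdry g) i + t * C.rdir g i) :
    s = C.param f g := by
  rw [param, eq_div_iff h]
  simp only [cross, Pi.sub_apply, dcross]
  linear_combination (C.rdir g 1) * hst 0 - (C.rdir g 0) * hst 1

/-- The flags belong to two edges which cross. -/
def Cross (C : PlaneGraph n) (f g : C.F) : Prop :=
  ∃ c : C.Crossing, c.fst.flag = f ∧ c.snd.flag = g

lemma Cross.symm {f g : C.F} (h : C.Cross f g) : C.Cross g f := by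
  obtain ⟨c, rfl, rfl⟩ := h
  exact ⟨c.swap, rfl, rfl⟩

/-- The parameter belongs to an interior point of the edge. -/
def IsInterior (C : PlaneGraph n) (f : C.F) (s : ℝ) : Prop :=
  0 < s ∧ (C.IsBounded f → s < C.len f)

lemma cross_iff {f g : C.F} (h : C.dcross f g ≠ 0) :
    C.Cross f g ↔ C.IsInterior f (C.param f g) ∧ C.IsInterior g (C.param g f) := by
  have h' : C.dcross g f ≠ 0 := by rw [dcross_swap]; exact neg_ne_zero.2 h
  constructor
  · rintro ⟨c, rfl, rfl⟩
    have h1 := eq_param h (congrFun c.image_eq)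
    have h2 := eq_param h' (congrFun c.image_eq.symm)
    rw [← h1, ← h2]
    exact ⟨⟨c.fst.s_pos, c.fst.s_lt⟩, c.snd.s_pos, c.snd.s_lt⟩
  · rintro ⟨h1, h2⟩
    refine ⟨⟨⟨f, C.param f g, h1.1, h1.2, dcross_ne_zero_left h⟩,
      ⟨g, C.param g f, h2.1, h2.2, dcross_ne_zero_right h⟩, ?_, ?_, ?_, ?_⟩, rfl, rfl⟩
    · rintro hfg
      change g = f at hfg
      subst hfg
      exact h (by simp only [dcross, cross]; ring)
    · intro hfg
      change g = C.inv f at hfg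
      by_cases hf : C.IsBounded f
      · rw [hfg, dcross_inv_right f hf] at h
        exact h (by simp only [dcross, cross]; ring)
      · rw [hfg, not_not.1 hf] at h
        exact h (by simp only [dcross, cross]; ring)
    · exact funext (param_spec h)
    · intro h0
      exact h (by rw [dcross_eq]; exact_mod_cast h0)

/-- The number of vertices of the edge (`0` or `1`) at the given parameter. -/
def atVertex (C : PlaneGraph n) (f : C.F) (s : ℝ) : ℝ :=
  (if s = 0 then 1 else 0) + if C.IsBounded f then (if C.len f - s = 0 then 1 else 0) else 0

/-- Adding the signs seen from the vertices of an edge locates a point on its line: the sum is 0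
outside, 1 at a vertex and 2 in the interior. For an end, the constant 1 stands for the missing
vertex at infinity. -/
lemma sg_add_eq (f : C.F) (s : ℝ) :
    sg s + (if C.IsBounded f then sg (C.len f - s) else 1) =
      C.atVertex f s + 2 * if C.IsInterior f s then 1 else 0 := by
  have hneg : s < 0 → ¬ C.IsInterior f s := fun h h' => absurd h'.1 h.not_gt
  have hzero : ¬ C.IsInterior f 0 := fun h' => lt_irrefl _ h'.1
  by_cases hf : C.IsBounded f
  · have hl := C.len_pos f hf
    rw [atVertex, if_pos hf, if_pos hf]
    rcases lt_trichotomy s 0 with h | rfl | h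
    · rw [sg_of_neg h, sg_of_pos (show 0 < C.len f - s by linarith), if_neg h.ne,
        if_neg (show C.len f - s ≠ 0 by linarith), if_neg (hneg h)]
      norm_num
    · rw [sg_zero, sub_zero, sg_of_pos hl, if_pos rfl, if_neg hl.ne', if_neg hzero]
      norm_num
    · rw [sg_of_pos h, if_neg h.ne']
      rcases lt_trichotomy s (C.len f) with h' | h' | h'
      · rw [sg_of_pos (sub_pos.2 h'), if_neg (sub_pos.2 h').ne',
          if_pos (show C.IsInterior f s from ⟨h, fun _ => h'⟩)]
        norm_num
      · rw [h', sub_self, sg_zero, if_pos rfl,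
          if_neg (show ¬ C.IsInterior f (C.len f) from fun h => lt_irrefl _ (h.2 hf))]
        norm_num
      · rw [sg_of_neg (sub_neg.2 h'), if_neg (sub_neg.2 h').ne,
          if_neg (show ¬ C.IsInterior f s from fun h => h'.not_gt (h.2 hf))]
        norm_num
  · rw [atVertex, if_neg hf, if_neg hf]
    rcases lt_trichotomy s 0 with h | rfl | h
    · rw [sg_of_neg h, if_neg h.ne, if_neg (hneg h)]
      norm_num
    · rw [sg_zero, if_pos rfl, if_neg hzero]
      norm_num
    · rw [sg_of_pos h, if_neg h.ne',
        if_pos (show C.IsInterior f s from ⟨h, fun hf' => absurd hf' hf⟩)]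
      norm_num

lemma bdry_eq_iff_param (hC : Function.Injective C.pos) {f g : C.F} (h : C.dcross f g ≠ 0) :
    C.bdry f = C.bdry g ↔ C.param f g = 0 ∧ C.param g f = 0 := by
  constructor
  · intro hb
    constructor <;> simp [param, hb, cross]
  · rintro ⟨h1, h2⟩
    refine hC (funext fun i => ?_)
    have := param_spec h i
    simpa [h1, h2] using this

/-- In a simple curve no vertex is mapped into the interior of another edge. -/
lemma atVertex_mul_interior (hC : C.IsSimple) {f g : C.F} (h : C.dcross f g ≠ 0) :
    C.atVertex f (C.param f g) * (if C.IsInterior g (C.param g f) then 1 else 0) = 0 := by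
  by_cases hg : C.IsInterior g (C.param g f)
  swap
  · rw [if_neg hg, mul_zero]
  have hx := fun v => hC.vertex_ne_point v
    ⟨g, C.param g f, hg.1, hg.2, dcross_ne_zero_right h⟩
  have hspec := param_spec h
  have h1 : C.param f g ≠ 0 := fun h0 => hx (C.bdry f) (funext fun i => by
    have := hspec i
    rw [h0, zero_mul, add_zero] at this
    exact this.symm)
  have h2 : C.IsBounded f → C.len f - C.param f g ≠ 0 := fun hf h0 =>
    hx (C.bdry (C.inv f)) (funext fun i => by
      have := hspec i
      rw [← sub_eq_zero.1 h0] at this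
      rw [C.pos_inv]
      exact this.symm)
  rw [atVertex, if_neg h1]
  by_cases hf : C.IsBounded f
  · rw [if_pos hf, if_neg (h2 hf)]
    simp
  · rw [if_neg hf]
    simp

/-- How two edges of a simple curve can meet. -/
lemma sg_mul_sg_eq (hC : C.IsSimple) {f g : C.F} (h : C.dcross f g ≠ 0) :
    (sg (C.param f g) + (if C.IsBounded f then sg (C.len f - C.param f g) else 1)) *
      (sg (C.param g f) + (if C.IsBounded g then sg (C.len g - C.param g f) else 1)) =
    4 * (if C.Cross f g then 1 else 0) +
      C.atVertex f (C.param f g) * C.atVertex g (C.param g f) := by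
  have h' : C.dcross g f ≠ 0 := by rw [dcross_swap]; exact neg_ne_zero.2 h
  have h1 := atVertex_mul_interior hC h
  have h2 := atVertex_mul_interior hC h'
  have h3 : (if C.Cross f g then (1 : ℝ) else 0) =
      (if C.IsInterior f (C.param f g) then 1 else 0) *
        if C.IsInterior g (C.param g f) then 1 else 0 := by
    by_cases h5 : C.IsInterior f (C.param f g) <;> by_cases h6 : C.IsInterior g (C.param g f) <;>
      simp [cross_iff h, h5, h6]
  rw [sg_add_eq, sg_add_eq, h3]
  linear_combination 2 * h1 + 2 * h2

end Intersection

/-! ### The self-intersection of the curve as a sum over pairs of flags -/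

section Sums

variable {n : ℕ} {C : PlaneGraph n}

/-- The sum of a function of two flags over the flags of two given edges. -/
def fold (φ : C.F → C.F → ℝ) (f g : C.F) : ℝ :=
  (φ f g + if C.IsBounded g then φ f (C.inv g) else 0) +
    if C.IsBounded f then (φ (C.inv f) g + if C.IsBounded g then φ (C.inv f) (C.inv g) else 0)
    else 0

lemma sum_sum_flags_eq (φ : C.F → C.F → ℝ) :
    ∑ f, ∑ g, φ f g = ∑ f ∈ C.edgeReps, ∑ g ∈ C.edgeReps, fold φ f g := by
  rw [C.sum_flags_eq]
  refine Finset.sum_congr rfl fun f _ => ?_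
  rw [C.sum_flags_eq, C.sum_flags_eq (fun g => φ (C.inv f) g)]
  by_cases hf : C.IsBounded f
  · simp only [hf, if_true, fold, Finset.sum_add_distrib]
  · simp only [hf, if_false, fold, add_zero]

/-- The contribution of two flags to the intersection number of the curve with itself. -/
def flagSign (f g : C.F) : ℝ :=
  |C.dcross f g| * ((sg (C.param f g) + if C.IsBounded f then 0 else 1) *
    (sg (C.param g f) + if C.IsBounded g then 0 else 1))

/-- The contribution of two flags at the same vertex. -/
def flagVertex (f g : C.F) : ℝ := |C.dcross f g| * if C.bdry f = C.bdry g then 1 else 0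

/-- Reversing a bounded flag negates `dcross`, turns its own parameter s into (length - s), and
leaves the parameter on the other line unchanged. The sum over the flags of two edges thus factors
into the two quantities of `sg_add_eq`. -/
lemma fold_flagSign (f g : C.F) : fold flagSign f g = |C.dcross f g| *
    ((sg (C.param f g) + (if C.IsBounded f then sg (C.len f - C.param f g) else 1)) *
      (sg (C.param g f) + (if C.IsBounded g then sg (C.len g - C.param g f) else 1))) := by
  by_cases h : C.dcross f g = 0
  · have h2 : C.IsBounded f → C.dcross (C.inv f) g = 0 := fun hf => by
      rw [dcross_inv_left hf, h, neg_zero]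
    have h3 : C.IsBounded g → C.dcross f (C.inv g) = 0 := fun hg => by
      rw [dcross_inv_right f hg, h, neg_zero]
    have h4 : C.IsBounded f → C.IsBounded g → C.dcross (C.inv f) (C.inv g) = 0 := fun hf hg => by
      rw [dcross_inv_left hf, h3 hg, neg_zero]
    by_cases hf : C.IsBounded f <;> by_cases hg : C.IsBounded g <;>
      simp [fold, flagSign, *]
  · have h' : C.dcross g f ≠ 0 := by rw [dcross_swap]; exact neg_ne_zero.2 h
    by_cases hf : C.IsBounded f <;> by_cases hg : C.IsBounded g
    · have hif : C.dcross (C.inv f) g ≠ 0 := by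
        rw [dcross_inv_left hf]; exact neg_ne_zero.2 h
      have hig : C.dcross (C.inv g) f ≠ 0 := by
        rw [dcross_inv_left hg]; exact neg_ne_zero.2 h'
      simp only [fold, flagSign, hf, hg, C.isBounded_inv, if_true, add_zero,
        dcross_inv_left hf, dcross_inv_right f hg, abs_neg,
        param_inv_right _ hf, param_inv_right _ hg, param_inv_left hf h, param_inv_left hg h']
      ring
    · simp only [fold, flagSign, hf, hg, C.isBounded_inv, if_true, if_false, add_zero,
        dcross_inv_left hf, abs_neg, param_inv_right _ hf, param_inv_left hf h]
      ring
    · simp only [fold, flagSign, hf, hg, C.isBounded_inv, if_true, if_false, add_zero,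
        dcross_inv_right f hg, abs_neg, param_inv_right _ hg, param_inv_left hg h']
      ring
    · simp only [fold, flagSign, hf, hg, if_false, add_zero]

/-- As `pos` is injective, two non-parallel flags start at the same vertex exactly when both
parameters vanish, which is what `atVertex` counts. -/
lemma fold_flagVertex (hC : Function.Injective C.pos) (f g : C.F) :
    fold flagVertex f g = |C.dcross f g| *
      (C.atVertex f (C.param f g) * C.atVertex g (C.param g f)) := by
  by_cases h : C.dcross f g = 0
  · have h2 : C.IsBounded f → C.dcross (C.inv f) g = 0 := fun hf => by
      rw [dcross_inv_left hf, h, neg_zero]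
    have h3 : C.IsBounded g → C.dcross f (C.inv g) = 0 := fun hg => by
      rw [dcross_inv_right f hg, h, neg_zero]
    have h4 : C.IsBounded f → C.IsBounded g → C.dcross (C.inv f) (C.inv g) = 0 := fun hf hg => by
      rw [dcross_inv_left hf, h3 hg, neg_zero]
    by_cases hf : C.IsBounded f <;> by_cases hg : C.IsBounded g <;>
      simp [fold, flagVertex, *]
  · have h' : C.dcross g f ≠ 0 := by rw [dcross_swap]; exact neg_ne_zero.2 h
    have key : ∀ f g, C.dcross f g ≠ 0 → flagVertex f g = |C.dcross f g| *
        ((if C.param f g = 0 then 1 else 0) * if C.param g f = 0 then 1 else 0) := by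
      intro f g h
      rw [flagVertex]
      congr 1
      by_cases h1 : C.param f g = 0 <;> by_cases h2 : C.param g f = 0 <;>
        simp [bdry_eq_iff_param hC h, h1, h2]
    have hif : C.IsBounded f → C.dcross (C.inv f) g ≠ 0 := fun hf => by
      rw [dcross_inv_left hf]; exact neg_ne_zero.2 h
    have hfi : C.IsBounded g → C.dcross f (C.inv g) ≠ 0 := fun hg => by
      rw [dcross_inv_right f hg]; exact neg_ne_zero.2 h
    have hii : C.IsBounded f → C.IsBounded g → C.dcross (C.inv f) (C.inv g) ≠ 0 := fun hf hg => by
      rw [dcross_inv_left hf]; exact neg_ne_zero.2 (hfi hg)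
    by_cases hf : C.IsBounded f <;> by_cases hg : C.IsBounded g
    · simp only [fold, atVertex, hf, hg, if_true, key _ _ h, key _ _ (hif hf), key _ _ (hfi hg),
        key _ _ (hii hf hg), dcross_inv_left hf, dcross_inv_right f hg, abs_neg,
        param_inv_right _ hf, param_inv_right _ hg, param_inv_left hf h, param_inv_left hg h']
      ring
    · simp only [fold, atVertex, hf, hg, if_true, if_false, key _ _ h, key _ _ (hif hf), add_zero,
        dcross_inv_left hf, abs_neg, param_inv_right _ hf, param_inv_left hf h]
      ring
    · simp only [fold, atVertex, hf, hg, if_true, if_false, key _ _ h, key _ _ (hfi hg), add_zero,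
        dcross_inv_right f hg, abs_neg, param_inv_right _ hg, param_inv_left hg h']
      ring
    · simp only [fold, atVertex, hf, hg, if_false, key _ _ h, add_zero]

/-- The self-intersection of a simple curve in terms of crossings and vertices. -/
lemma sum_flagSign_eq (hC : C.IsSimple) : ∑ f, ∑ g, C.flagSign f g =
    4 * ∑ f ∈ C.edgeReps, ∑ g ∈ C.edgeReps, (if C.Cross f g then |C.dcross f g| else 0) +
      ∑ f, ∑ g, C.flagVertex f g := by
  rw [sum_sum_flags_eq, sum_sum_flags_eq flagVertex, Finset.mul_sum, ← Finset.sum_add_distrib]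
  refine Finset.sum_congr rfl fun f _ => ?_
  rw [Finset.mul_sum, ← Finset.sum_add_distrib]
  refine Finset.sum_congr rfl fun g _ => ?_
  rw [fold_flagSign, fold_flagVertex hC.pos_injective]
  by_cases h : C.dcross f g = 0
  · simp [h]
  · rw [sg_mul_sg_eq hC h]
    by_cases hx : C.Cross f g
    · simp only [hx, if_true]
      ring
    · simp only [hx, if_false]
      ring

/-! ### Evaluation by balancing -/

lemma sum_rdir (v : C.V) (i : Fin 2) :
    ∑ f ∈ Finset.univ.filter (fun f => C.bdry f = v), C.rdir f i = 0 := by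
  have := C.balanced_apply v i
  simp only [rdir]
  exact_mod_cast this

lemma sum_cross_rdir (w : Fin 2 → ℝ) (v : C.V) :
    ∑ f ∈ Finset.univ.filter (fun f => C.bdry f = v), cross w (C.rdir f) = 0 := by
  simp only [cross, Finset.sum_sub_distrib, ← Finset.mul_sum, sum_rdir, mul_zero, sub_zero]

/-- The intersection number of the stars at two vertices in the direction `w`. -/
def starSign (C : PlaneGraph n) (w : Fin 2 → ℝ) (v v' : C.V) : ℝ :=
  ∑ f ∈ Finset.univ.filter (fun f => C.bdry f = v),
    ∑ g ∈ Finset.univ.filter (fun g => C.bdry g = v'),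
      |C.dcross f g| * (sg (cross w (C.rdir f)) * sg (cross w (C.rdir g)))

lemma starSign_zero (v v' : C.V) : C.starSign 0 v v' = 0 := by
  refine Finset.sum_eq_zero fun f _ => Finset.sum_eq_zero fun g _ => ?_
  simp [cross, sg_zero]

/-- After multiplication by |cross w' w|, `sg_cross_identity` writes the difference as four sums,
each linear in the direction of one of the two flags. Balancing at `v` or `v'` makes each of them
zero. -/
lemma starSign_eq_of_cross_ne_zero {w w' : Fin 2 → ℝ} (h : cross w' w ≠ 0) (v v' : C.V) :
    C.starSign w v v' = C.starSign w' v v' := by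
  refine mul_left_cancel₀ (abs_ne_zero.2 h) (sub_eq_zero.1 ?_)
  simp only [starSign, Finset.mul_sum, ← Finset.sum_sub_distrib]
  have key : ∀ f g : C.F, |cross w' w| * (|C.dcross f g| * (sg (cross w (C.rdir f)) *
      sg (cross w (C.rdir g)))) - |cross w' w| * (|C.dcross f g| * (sg (cross w' (C.rdir f)) *
      sg (cross w' (C.rdir g)))) =
      cross w (C.rdir g) * (|cross w' (C.rdir f)| * sg (cross w (C.rdir f))) +
      cross w (C.rdir f) * (|cross w' (C.rdir g)| * sg (cross w (C.rdir g))) -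
      cross w' (C.rdir f) * (|cross w (C.rdir g)| * sg (cross w' (C.rdir g))) -
      cross w' (C.rdir g) * (|cross w (C.rdir f)| * sg (cross w' (C.rdir f))) := fun f g => by
    rw [← sg_cross_identity]
    have : cross w' (C.rdir f) * cross w (C.rdir g) - cross w (C.rdir f) * cross w' (C.rdir g) =
        cross w' w * C.dcross f g := by
      simp only [cross, dcross]
      ring
    rw [this, abs_mul]
    ring
  simp only [key, Finset.sum_add_distrib, Finset.sum_sub_distrib, ← Finset.sum_mul,
    ← Finset.mul_sum, sum_cross_rdir, zero_mul, Finset.sum_const_zero, add_zero, sub_zero]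

lemma starSign_eq {w : Fin 2 → ℝ} (hw : w ≠ 0) (v v' : C.V) :
    C.starSign w v v' = C.starSign ![1, 0] v v' := by
  by_cases h : cross ![1, 0] w = 0
  · have h1 : w 1 = 0 := by simpa [cross] using h
    have h0 : w 0 ≠ 0 := fun h0 => hw (by ext i; fin_cases i <;> assumption)
    rw [starSign_eq_of_cross_ne_zero (w' := ![0, 1]) (by simpa [cross] using h0),
      starSign_eq_of_cross_ne_zero (w' := ![1, 0]) (by simp [cross])]
  · exact starSign_eq_of_cross_ne_zero h v v'

lemma sum_sum_fiberwise (φ : C.F → C.F → ℝ) :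
    ∑ f, ∑ g, φ f g = ∑ v, ∑ v', ∑ f ∈ Finset.univ.filter (fun f => C.bdry f = v),
      ∑ g ∈ Finset.univ.filter (fun g => C.bdry g = v'), φ f g := by
  refine (C.sum_flags_fiberwise fun f => ∑ g, φ f g).symm.trans
    (Finset.sum_congr rfl fun v _ => ?_)
  exact (Finset.sum_congr rfl fun f _ => (C.sum_flags_fiberwise fun g => φ f g).symm).trans
    Finset.sum_comm

lemma abs_mul_sg_param (f g : C.F) : |C.dcross f g| * sg (C.param f g) =
    C.dcross f g * sg (cross (C.pos (C.bdry g) - C.pos (C.bdry f)) (C.rdir g)) :=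
  abs_mul_sg_div _ _

/-- Both parameters have the same denominator up to a sign that the numerator absorbs, so its sign
cancels. What is left depends on the two vertices only through their difference, as in `starSign`.
-/
lemma abs_mul_sg_param_mul (f g : C.F) :
    |C.dcross f g| * (sg (C.param f g) * sg (C.param g f)) = |C.dcross f g| *
      (sg (cross (C.pos (C.bdry g) - C.pos (C.bdry f)) (C.rdir f)) *
        sg (cross (C.pos (C.bdry g) - C.pos (C.bdry f)) (C.rdir g))) := by
  by_cases h : C.dcross f g = 0
  · simp [h]
  have h' : C.dcross g f ≠ 0 := by rw [dcross_swap]; exact neg_ne_zero.2 h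
  have h1 : ∀ x, sg (x / C.dcross f g) = sg x * sg (C.dcross f g) := fun x => by
    have : sg x = sg (x / C.dcross f g) * sg (C.dcross f g) := by
      rw [← sg_mul, div_mul_cancel₀ _ h]
    rw [this, mul_assoc, sg_mul_self h, mul_one]
  have h2 : C.param g f =
      cross (C.pos (C.bdry g) - C.pos (C.bdry f)) (C.rdir f) / C.dcross f g := by
    rw [param, dcross_swap, div_neg, ← neg_div]
    congr 1
    simp only [cross, Pi.sub_apply]
    ring
  rw [h2, param, h1, h1]
  linear_combination |C.dcross f g| * sg (cross (C.pos (C.bdry g) - C.pos (C.bdry f)) (C.rdir f)) *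
    sg (cross (C.pos (C.bdry g) - C.pos (C.bdry f)) (C.rdir g)) * sg_mul_self h

/-- The mixed terms vanish by balancing. -/
lemma sum_mixed_eq_zero (ε : C.F → ℝ) :
    ∑ f, ∑ g, |C.dcross f g| * sg (C.param f g) * ε g = 0 := by
  rw [Finset.sum_comm]
  refine Finset.sum_eq_zero fun g _ => ?_
  rw [← C.sum_flags_fiberwise]
  refine Finset.sum_eq_zero fun v _ => ?_
  -- For fixed `g`, the sign of the numerator is the same for all flags `f` at `v`, so the summand
  -- is linear in the direction of `f`.
  have : ∀ f ∈ Finset.univ.filter (fun f => C.bdry f = v),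
      |C.dcross f g| * sg (C.param f g) * ε g =
        -(cross (C.rdir g) (C.rdir f) *
          (sg (cross (C.pos (C.bdry g) - C.pos v) (C.rdir g)) * ε g)) := fun f hf => by
    have hd : C.dcross f g = - cross (C.rdir g) (C.rdir f) := C.dcross_swap g f
    rw [abs_mul_sg_param, (Finset.mem_filter.1 hf).2, hd]
    ring
  rw [Finset.sum_congr rfl this, Finset.sum_neg_distrib, ← Finset.sum_mul, sum_cross_rdir,
    zero_mul, neg_zero]

/-- For two different vertices the pure sign terms form `starSign` in the direction of the
difference of their positions, which may be replaced by (1,0). On the diagonal the difference is 0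
and the terms vanish, so the diagonal part of the (1,0)-sum is subtracted. Terms mixing a sign with
an end contribution cancel by balancing, and the pairs of ends remain. -/
lemma sum_flagSign_eq' (hC : Function.Injective C.pos) : ∑ f, ∑ g, C.flagSign f g =
    (∑ f, ∑ g, |C.dcross f g| *
      (sg (cross ![1, 0] (C.rdir f)) * sg (cross ![1, 0] (C.rdir g)))) -
    ∑ v, C.starSign ![1, 0] v v +
    ∑ f, ∑ g, |C.dcross f g| * ((if C.IsBounded f then 0 else 1) *
      if C.IsBounded g then 0 else 1) := by
  let ε : C.F → ℝ := fun f => if C.IsBounded f then 0 else 1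
  have h1 : ∀ f g, C.flagSign f g = |C.dcross f g| * (sg (C.param f g) * sg (C.param g f)) +
      |C.dcross f g| * sg (C.param f g) * ε g + |C.dcross g f| * sg (C.param g f) * ε f +
      |C.dcross f g| * (ε f * ε g) := fun f g => by
    rw [flagSign, C.dcross_swap f g, abs_neg]
    ring
  have h2 : ∑ f, ∑ g, |C.dcross f g| * (sg (C.param f g) * sg (C.param g f)) =
      (∑ f, ∑ g, |C.dcross f g| *
      (sg (cross ![1, 0] (C.rdir f)) * sg (cross ![1, 0] (C.rdir g)))) -
      ∑ v, C.starSign ![1, 0] v v := by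
    rw [sum_sum_fiberwise, sum_sum_fiberwise, ← Finset.sum_sub_distrib]
    refine Finset.sum_congr rfl fun v _ => ?_
    have h3 : ∀ v', (∑ f ∈ Finset.univ.filter (fun f => C.bdry f = v),
        ∑ g ∈ Finset.univ.filter (fun g => C.bdry g = v'),
          |C.dcross f g| * (sg (C.param f g) * sg (C.param g f))) =
        C.starSign (C.pos v' - C.pos v) v v' := fun v' => by
      refine Finset.sum_congr rfl fun f hf => Finset.sum_congr rfl fun g hg => ?_
      rw [abs_mul_sg_param_mul, (Finset.mem_filter.1 hf).2, (Finset.mem_filter.1 hg).2]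
    rw [Finset.sum_congr rfl fun v' _ => h3 v', eq_sub_iff_add_eq,
      ← Finset.sum_erase_add _ _ (Finset.mem_univ v),
      ← Finset.sum_erase_add (Finset.univ : Finset C.V) (fun v' => ∑ f ∈ Finset.univ.filter
        (fun f => C.bdry f = v), ∑ g ∈ Finset.univ.filter (fun g => C.bdry g = v'),
        |C.dcross f g| * (sg (cross ![1, 0] (C.rdir f)) * sg (cross ![1, 0] (C.rdir g))))
        (Finset.mem_univ v), sub_self, starSign_zero, add_zero]
    congr 1
    refine Finset.sum_congr rfl fun v' hv' => ?_
    exact starSign_eq (sub_ne_zero.2 (hC.ne (Finset.ne_of_mem_erase hv'))) v v'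
  simp only [h1, Finset.sum_add_distrib, h2, sum_mixed_eq_zero]
  rw [Finset.sum_comm (f := fun f g => |C.dcross g f| * sg (C.param g f) * ε f),
    sum_mixed_eq_zero]
  simp only [add_zero, ε]

end Sums

/-! ### Evaluation for curves of degree d, and the Bézout identity -/

section Evaluate

variable {n : ℕ} {C : PlaneGraph n}

lemma sum_odd_eq (φ : (Fin 2 → ℤ) → ℝ) (h0 : φ 0 = 0) (hφ : ∀ u, φ (-u) = - φ u) :
    ∑ f, φ (C.dir f) = ∑ f ∈ Finset.univ.filter (fun f => C.IsFreeEnd f), φ (C.dir f) := by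
  have h1 := C.sum_bounded_eq_zero (fun f => φ (C.dir f)) fun f hf => by
    rw [C.dir_inv f hf, hφ]
  rw [Finset.sum_filter] at h1 ⊢
  have h2 : ∑ f, φ (C.dir f) =
      ∑ f, φ (C.dir f) - ∑ f, if C.IsBounded f then φ (C.dir f) else 0 := by rw [h1, sub_zero]
  rw [h2, ← Finset.sum_sub_distrib]
  refine Finset.sum_congr rfl fun f _ => ?_
  by_cases hf : C.IsBounded f
  · have : ¬ C.IsFreeEnd f := fun h => hf h.1
    simp [hf, this]
  · by_cases hm : C.IsMarked f
    · have : ¬ C.IsFreeEnd f := fun h => h.2 hm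
      obtain ⟨i, rfl⟩ := hm
      simp [hf, this, C.mark_dir, h0]
    · have : C.IsFreeEnd f := ⟨not_not.1 hf, hm⟩
      simp [hf, this]

lemma HasDegree.sum_freeEnds {d : ℕ} (h : C.HasDegree d) (φ : (Fin 2 → ℤ) → ℝ) :
    ∑ f ∈ Finset.univ.filter (fun f => C.IsFreeEnd f), φ (C.dir f) =
      d * (φ ![-1, 0] + φ ![0, -1] + φ ![1, 1]) := by
  have : ∑ f ∈ Finset.univ.filter (fun f => C.IsFreeEnd f), φ (C.dir f) =
      (((Finset.univ.filter fun f => C.IsFreeEnd f).val.map C.dir).map φ).sum := by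
    rw [Multiset.map_map]
    rfl
  rw [this, h]
  simp only [Multiset.map_add, Multiset.map_replicate, Multiset.sum_add, Multiset.sum_replicate,
    nsmul_eq_mul]
  ring

/-- The sum of the intersection numbers of all pairs of ends. -/
lemma HasDegree.sum_ends_abs {d : ℕ} (h : C.HasDegree d) :
    ∑ f, ∑ g, |C.dcross f g| * ((if C.IsBounded f then 0 else 1) *
      if C.IsBounded g then 0 else 1) = 6 * d ^ 2 := by
  have h1 : ∀ ψ : (Fin 2 → ℤ) → ℝ, ψ 0 = 0 →
      ∑ f, ψ (C.dir f) * (if C.IsBounded f then 0 else 1) =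
        d * (ψ ![-1, 0] + ψ ![0, -1] + ψ ![1, 1]) := by
    intro ψ hψ
    rw [← h.sum_freeEnds ψ, Finset.sum_filter]
    refine Finset.sum_congr rfl fun f _ => ?_
    by_cases hf : C.IsBounded f
    · have : ¬ C.IsFreeEnd f := fun h => hf h.1
      simp [hf, this]
    · by_cases hm : C.IsMarked f
      · have : ¬ C.IsFreeEnd f := fun h => h.2 hm
        obtain ⟨i, rfl⟩ := hm
        simp [hf, this, C.mark_dir, hψ]
      · have : C.IsFreeEnd f := ⟨not_not.1 hf, hm⟩
        simp [hf, this]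
  have h2 : ∀ f, ∑ g, |C.dcross f g| * ((if C.IsBounded f then 0 else 1) *
      if C.IsBounded g then 0 else 1) =
      (d * (|(det2 (C.dir f) ![-1, 0] : ℝ)| + |(det2 (C.dir f) ![0, -1] : ℝ)| +
        |(det2 (C.dir f) ![1, 1] : ℝ)|)) * if C.IsBounded f then 0 else 1 := fun f => by
    rw [← h1 (fun u => |(det2 (C.dir f) u : ℝ)|) (by simp [det2]), Finset.sum_mul]
    refine Finset.sum_congr rfl fun g _ => ?_
    rw [dcross_eq]
    ring
  rw [Finset.sum_congr rfl fun f _ => h2 f,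
    h1 (fun u => d * (|(det2 u ![-1, 0] : ℝ)| + |(det2 u ![0, -1] : ℝ)| +
      |(det2 u ![1, 1] : ℝ)|)) (by simp [det2])]
  -- Two ends of different directions have determinant ±1, and there are six ordered pairs of
  -- different directions, each occurring d² times.
  simp [det2]
  ring

/-- The summand is odd in the direction of each flag, so bounded edges cancel and only ends count.
Ends of direction (-1,0) have sign 0; the two ordered pairs formed from (0,-1) and (1,1) have
opposite signs and contribute -d² each. -/
lemma HasDegree.sum_sg {d : ℕ} (h : C.HasDegree d) :
    ∑ f, ∑ g, |C.dcross f g| *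
      (sg (cross ![1, 0] (C.rdir f)) * sg (cross ![1, 0] (C.rdir g))) = -2 * d ^ 2 := by
  have hs : ∀ f, cross ![1, 0] (C.rdir f) = (C.dir f 1 : ℝ) := fun f => by simp [cross, rdir]
  have habs : ∀ u v, |(det2 u (-v) : ℝ)| = |(det2 u v : ℝ)| := fun u v => by
    rw [← abs_neg]
    congr 1
    simp only [det2, Pi.neg_apply]
    push_cast
    ring
  have habs' : ∀ u v, |(det2 (-u) v : ℝ)| = |(det2 u v : ℝ)| := fun u v => by
    rw [← abs_neg]
    congr 1
    simp only [det2, Pi.neg_apply]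
    push_cast
    ring
  have h1 : ∀ ψ : (Fin 2 → ℤ) → ℝ, (∀ u, ψ (-u) = ψ u) → ψ 0 = 0 →
      ∑ f, ψ (C.dir f) * sg (C.dir f 1 : ℝ) = d * (ψ ![1, 1] - ψ ![0, -1]) := by
    intro ψ hψ hψ0
    rw [C.sum_odd_eq (fun u => ψ u * sg (u 1 : ℝ)) (by simp [hψ0]) fun u => by
      simp only [hψ, Pi.neg_apply, Int.cast_neg, sg_neg]; ring, h.sum_freeEnds fun u =>
      ψ u * sg (u 1 : ℝ)]
    simp [sg_zero, sg_neg, sg_of_pos]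
    exact Or.inl (by ring)
  have h2 : ∀ f, ∑ g, |C.dcross f g| *
      (sg (cross ![1, 0] (C.rdir f)) * sg (cross ![1, 0] (C.rdir g))) =
      (d * (|(det2 (C.dir f) ![1, 1] : ℝ)| - |(det2 (C.dir f) ![0, -1] : ℝ)|)) *
        sg (C.dir f 1 : ℝ) := fun f => by
    rw [← h1 (fun u => |(det2 (C.dir f) u : ℝ)|) (habs _) (by simp [det2]), Finset.sum_mul]
    refine Finset.sum_congr rfl fun g _ => ?_
    rw [dcross_eq, hs, hs]
    ring
  rw [Finset.sum_congr rfl fun f _ => h2 f,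
    h1 (fun u => d * (|(det2 u ![1, 1] : ℝ)| - |(det2 u ![0, -1] : ℝ)|))
      (fun u => by rw [habs', habs']) (by simp [det2])]
  simp [det2]
  ring

/-- The contributions of a trivalent vertex. -/
lemma sums_at_trivalent {v : C.V} (hv : C.val v = 3) :
    C.starSign ![1, 0] v v = -2 * C.vertexMult v ∧
    ∑ f ∈ Finset.univ.filter (fun f => C.bdry f = v),
      ∑ g ∈ Finset.univ.filter (fun g => C.bdry g = v), |C.dcross f g| = 6 * C.vertexMult v := by
  obtain ⟨f, g, e, hfg, hfe, hge, hs⟩ := Finset.card_eq_three.1 hv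
  have hmem : ∀ x ∈ ({f, g, e} : Finset C.F), C.bdry x = v := fun x hx => by
    rw [← hs] at hx
    exact (Finset.mem_filter.1 hx).2
  have hf := hmem f (by simp)
  have hg := hmem g (by simp)
  subst hf
  have hsum := dir_add_add_eq_zero hfg hfe.symm hge.symm hs
  obtain ⟨h1, h2⟩ := det2_dir_of_sum_eq_zero hsum
  have hm : (C.vertexMult (C.bdry f) : ℝ) = |C.dcross f g| := by
    rw [vertexMult_eq_natAbs hv hfg hg, dcross_eq, Nat.cast_natAbs, Int.cast_abs]
  have hself : ∀ x, C.dcross x x = 0 := fun x => by simp only [dcross, cross]; ring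
  have d1 : C.dcross g e = C.dcross f g := by rw [dcross_eq, dcross_eq, h1]
  have d2 : C.dcross e f = C.dcross f g := by rw [dcross_eq, dcross_eq, h2]
  have d3 : C.dcross g f = - C.dcross f g := C.dcross_swap _ _
  have d4 : C.dcross e g = - C.dcross f g := by rw [dcross_swap, d1]
  have d5 : C.dcross f e = - C.dcross f g := by rw [dcross_swap, d2]
  have hf' : f ∉ ({g, e} : Finset C.F) := by simp [hfg, hfe]
  rw [starSign, hs, hm]
  simp only [Finset.sum_insert hf', Finset.sum_pair hge, hself, d1, d2, d3, d4, d5, abs_neg,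
    abs_zero, zero_mul]
  refine ⟨?_, by ring⟩
  by_cases h0 : C.dcross f g = 0
  · simp [h0]
  have hlin : cross ![1, 0] (C.rdir f) + cross ![1, 0] (C.rdir g) + cross ![1, 0] (C.rdir e) = 0 := by
    have := congrFun hsum 1
    simp only [Pi.add_apply, Pi.zero_apply] at this
    simp only [cross, rdir]
    simp
    exact_mod_cast this
  -- All three pairs of flags have the same determinant up to sign, and the products of their signs
  -- add up to -1; ordered pairs count twice.
  have := sg_sum_of_add_eq_zero hlin (by
    by_contra! hcon
    refine h0 ?_
    have e1 : C.rdir f 1 = 0 := by simpa [cross] using hcon.1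
    have e2 : C.rdir g 1 = 0 := by simpa [cross] using hcon.2
    simp [dcross, cross, e1, e2])
  linear_combination 2 * |C.dcross f g| * this

lemma sum_flagVertex (hC : ∀ v, C.val v = 3) :
    ∑ f, ∑ g, C.flagVertex f g = 6 * ∑ v, (C.vertexMult v : ℝ) := by
  rw [Finset.mul_sum, ← C.sum_flags_fiberwise]
  refine Finset.sum_congr rfl fun v _ => ?_
  rw [← (sums_at_trivalent (hC v)).2]
  refine Finset.sum_congr rfl fun f hf => ?_
  rw [Finset.sum_filter]
  refine Finset.sum_congr rfl fun g _ => ?_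
  rw [flagVertex, (Finset.mem_filter.1 hf).2]
  by_cases h : C.bdry g = v
  · rw [if_pos h, if_pos h.symm, mul_one]
  · rw [if_neg h, if_neg fun h' => h h'.symm, mul_zero]

/-- The tropical Bézout identity for the intersection of a simple curve with itself. -/
lemma IsSimple.sum_crossings {d : ℕ} (hC : C.IsSimple) (h : C.HasDegree d) :
    (∑ f ∈ C.edgeReps, ∑ g ∈ C.edgeReps,
      if C.Cross f g then (det2 (C.dir f) (C.dir g)).natAbs else 0) +
      ∑ v, C.vertexMult v = d ^ 2 := by
  have h1 := sum_flagSign_eq hC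
  rw [sum_flagSign_eq' hC.pos_injective, h.sum_sg, h.sum_ends_abs, sum_flagVertex hC.trivalent,
    Finset.sum_congr rfl fun v _ => (sums_at_trivalent (hC.trivalent v)).1,
    ← Finset.mul_sum] at h1
  -- With M the sum of the vertex multiplicities and X the sum over ordered pairs of crossing edges,
  -- `h1` reads -2d² + 2M + 6d² = 4X + 6M.
  have h2 : (∑ f ∈ C.edgeReps, ∑ g ∈ C.edgeReps, (if C.Cross f g then |C.dcross f g| else 0)) +
      ∑ v, (C.vertexMult v : ℝ) = d ^ 2 := by linarith
  simp only [dcross_eq, ← Int.cast_abs, ← Nat.cast_natAbs] at h2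
  exact_mod_cast h2

end Evaluate

/-! ### The image of the contracted edge, an invariant of the elliptic curves -/

section ContractedPoints

variable {n : ℕ} {C D T : PlaneGraph n}

/-- The images of the contracted bounded edges. -/
def contractedPoints (C : PlaneGraph n) : Set (Fin 2 → ℝ) :=
  {x | ∃ f, C.IsBounded f ∧ C.dir f = 0 ∧ C.pos (C.bdry f) = x}

lemma Iso.contractedPoints_eq (φ : Iso C D) : D.contractedPoints = C.contractedPoints := by
  ext x
  simp only [contractedPoints, Set.mem_ofPred_eq]
  rw [φ.onF.surjective.exists]
  simp only [φ.isBounded_iff, φ.dir_eq, φ.bdry_eq, φ.pos_eq]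

lemma attachEdge_contractedPoints (hT : ∀ f, ¬ T.IsMarked f → T.dir f ≠ 0) {v w : T.V}
    {hvw : T.pos v = T.pos w} {m : ℝ} {hm : 0 < m} :
    (T.attachEdge v w hvw m hm).contractedPoints = {T.pos v} := by
  ext x
  rw [Set.mem_singleton_iff]
  constructor
  · rintro ⟨f | b, hb, hd, rfl⟩
    · have hb := (attachEdge_isBounded_inl f).1 hb
      refine absurd hd (hT f ?_)
      rintro ⟨i, rfl⟩
      exact T.not_isBounded_mark i hb
    · cases b
      · rfl
      · exact hvw.symm
  · rintro rfl
    exact ⟨Sum.inr false, attachEdge_isBounded_inr _, rfl, rfl⟩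

lemma subdivide_dir_ne_zero (hC : ∀ f, ¬ C.IsMarked f → C.dir f ≠ 0) (x : C.EdgePoint)
    (f : (C.subdivide x).F) (hf : ¬ (C.subdivide x).IsMarked f) : (C.subdivide x).dir f ≠ 0 := by
  rcases f with f | b
  · exact hC f fun h => hf ((subdivide_isMarked_inl x f).2 h)
  · have := hC _ x.unmarked
    cases b
    · exact neg_ne_zero.2 this
    · exact this

lemma Crossing.attach_contractedPoints (hC : ∀ f, ¬ C.IsMarked f → C.dir f ≠ 0) (c : C.Crossing)
    {m : ℝ} (hm : 0 < m) : (c.attach m hm).contractedPoints = {c.fst.image} :=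
  attachEdge_contractedPoints (subdivide_dir_ne_zero (subdivide_dir_ne_zero hC c.fst) c.snd')

end ContractedPoints

/-! ### The curves built out of a rational curve are elliptic tropical curves of degree d -/

section Properties

variable {n : ℕ} {C : PlaneGraph n} {d : ℕ}

lemma attachLoop_isTropicalCurve (hC : C.IsTropicalCurve) (v : C.V) {m : ℝ} (hm : 0 < m) :
    (C.attachLoop v m hm).IsTropicalCurve := fun u =>
  ((hC u).trans (Nat.le_add_right _ _)).trans_eq
    (attachEdge_val (T := C) (v := v) (w := v) (hvw := rfl) (hm := hm) u).symm

lemma Crossing.attach_isTropicalCurve (hC : C.IsTropicalCurve) (c : C.Crossing) {m : ℝ}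
    (hm : 0 < m) : (c.attach m hm).IsTropicalCurve := by
  intro u
  refine le_of_le_of_eq ?_ (attachEdge_val (T := c.subdivided) (v := some none) (w := none)
    (hm := hm) u).symm
  have key : ∀ P Q : Prop, P ∨ Q → 3 ≤ 2 + ((if P then 1 else 0) + if Q then 1 else 0) := by
    rintro P Q (h | h) <;> simp only [h, if_true] <;> omega
  rcases u with _ | _ | u
  · have : c.subdivided.val none = 2 := subdivide_val_none _
    rw [this]
    exact key _ _ (Or.inr rfl)
  · have : c.subdivided.val (some none) = 2 :=
      (subdivide_val_some _ _).trans (subdivide_val_none _)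
    rw [this]
    exact key _ _ (Or.inl rfl)
  · have : c.subdivided.val (some (some u)) = C.val u :=
      (subdivide_val_some _ _).trans (subdivide_val_some _ _)
    rw [this]
    exact (hC u).trans (Nat.le_add_right _ _)

lemma Crossing.attach_connected (hC : C.IsTree) (c : C.Crossing) {m : ℝ} (hm : 0 < m) :
    (c.attach m hm).Connected := by
  unfold Crossing.attach
  exact hC.subdivide.subdivide.1.attachEdge

lemma Crossing.attach_genus (hC : C.IsTree) (c : C.Crossing) {m : ℝ} (hm : 0 < m) :
    (c.attach m hm).genus = 1 := by
  unfold Crossing.attach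
  refine attachEdge_genus.trans ?_
  rw [hC.subdivide.subdivide.2, zero_add]

lemma Crossing.attach_hasDegree (hC : C.HasDegree d) (c : C.Crossing) {m : ℝ} (hm : 0 < m) :
    (c.attach m hm).HasDegree d := by
  unfold Crossing.attach
  exact hC.subdivide.subdivide.attachEdge

end Properties

/-! ### Crossings as unordered pairs of edges -/

section Crossings

variable {n : ℕ} {C : PlaneGraph n}

lemma Crossing.dcross_ne_zero (c : C.Crossing) : C.dcross c.fst.flag c.snd.flag ≠ 0 := by
  rw [dcross_eq]
  exact_mod_cast c.transverse

lemma Crossing.fst_s (c : C.Crossing) : c.fst.s = C.param c.fst.flag c.snd.flag :=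
  eq_param c.dcross_ne_zero (congrFun c.image_eq)

lemma Crossing.snd_s (c : C.Crossing) : c.snd.s = C.param c.snd.flag c.fst.flag :=
  c.swap.fst_s

lemma param_of_same_edges {f g f' g' : C.F} (h : C.dcross f g ≠ 0) (hf : f' = f ∨ f' = C.inv f)
    (hg : g' = g ∨ g' = C.inv g) : (f' = f ∧ C.param f' g' = C.param f g) ∨
      (C.IsBounded f ∧ f' = C.inv f ∧ C.param f' g' = C.len f - C.param f g) := by
  have h1 : C.param f' g' = C.param f' g := by
    rcases hg with rfl | rfl
    · rfl
    · by_cases hb : C.IsBounded g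
      · exact param_inv_right f' hb
      · rw [not_not.1 hb]
  rw [h1]
  rcases hf with rfl | rfl
  · exact Or.inl ⟨rfl, rfl⟩
  · by_cases hb : C.IsBounded f
    · exact Or.inr ⟨hb, rfl, param_inv_left hb h⟩
    · rw [not_not.1 hb]
      exact Or.inl ⟨rfl, rfl⟩

lemma dcross_ne_zero_of_same_edges {f g f' g' : C.F} (h : C.dcross f g ≠ 0)
    (hf : f' = f ∨ f' = C.inv f) (hg : g' = g ∨ g' = C.inv g) : C.dcross f' g' ≠ 0 := by
  have h1 : C.dcross f' g ≠ 0 := by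
    rcases hf with rfl | rfl
    · exact h
    · by_cases hb : C.IsBounded f
      · rw [dcross_inv_left hb]
        exact neg_ne_zero.2 h
      · rwa [not_not.1 hb]
  rcases hg with rfl | rfl
  · exact h1
  · by_cases hb : C.IsBounded g
    · rw [dcross_inv_right _ hb]
      exact neg_ne_zero.2 h1
    · rwa [not_not.1 hb]

lemma Crossing.same_of_flags {c c' : C.Crossing}
    (hf : c'.fst.flag = c.fst.flag ∨ c'.fst.flag = C.inv c.fst.flag)
    (hg : c'.snd.flag = c.snd.flag ∨ c'.snd.flag = C.inv c.snd.flag) :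
    c.fst.Same c'.fst ∧ c.snd.Same c'.snd := by
  have h1 := param_of_same_edges c.dcross_ne_zero hf hg
  have h2 := param_of_same_edges c.swap.dcross_ne_zero hg hf
  rw [← c.fst_s, ← c'.fst_s] at h1
  have h3 : C.param c.swap.fst.flag c.swap.snd.flag = c.snd.s := c.snd_s.symm
  rw [h3, ← c'.snd_s] at h2
  exact ⟨h1, h2⟩

lemma Cross.of_same_edges {f g f' g' : C.F} (h : C.Cross f g) (hf : f' = f ∨ f' = C.inv f)
    (hg : g' = g ∨ g' = C.inv g) : C.Cross f' g' := by
  have hne : C.dcross f g ≠ 0 := by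
    obtain ⟨c, rfl, rfl⟩ := h
    exact c.dcross_ne_zero
  have hne' : C.dcross g f ≠ 0 := by rw [dcross_swap]; exact neg_ne_zero.2 hne
  obtain ⟨h1, h2⟩ := (cross_iff hne).1 h
  have key : ∀ {f f' : C.F} {s s' : ℝ}, C.IsInterior f s → ((f' = f ∧ s' = s) ∨
      (C.IsBounded f ∧ f' = C.inv f ∧ s' = C.len f - s)) → C.IsInterior f' s' := by
    rintro f f' s s' hi (⟨rfl, rfl⟩ | ⟨hb, rfl, rfl⟩)
    · exact hi
    · refine ⟨sub_pos.2 (hi.2 hb), fun _ => ?_⟩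
      rw [C.len_inv]
      linarith [hi.1]
  exact (cross_iff (dcross_ne_zero_of_same_edges hne hf hg)).2
    ⟨key h1 (param_of_same_edges hne hf hg), key h2 (param_of_same_edges hne' hg hf)⟩

/-- The pairs of crossing edges. -/
def crossingPairs (C : PlaneGraph n) : Finset (C.F × C.F) :=
  Finset.univ.filter fun x => x.1 ∈ C.edgeReps ∧ x.2 ∈ C.edgeReps ∧
    C.flagKey x.1 < C.flagKey x.2 ∧ C.Cross x.1 x.2

lemma mem_crossingPairs {x : C.F × C.F} : x ∈ C.crossingPairs ↔ x.1 ∈ C.edgeReps ∧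
    x.2 ∈ C.edgeReps ∧ C.flagKey x.1 < C.flagKey x.2 ∧ C.Cross x.1 x.2 := by
  rw [crossingPairs, Finset.mem_filter]
  exact and_iff_right (Finset.mem_univ x)

/-- Every crossing is given by a pair of crossing edges, up to the order and the choice of flags. -/
lemma Crossing.exists_pair (c : C.Crossing) : ∃ x ∈ C.crossingPairs, ∀ c' : C.Crossing,
    c'.fst.flag = x.1 → c'.snd.flag = x.2 →
      ∀ m hm, Nonempty (Iso (c.attach m hm) (c'.attach m hm)) := by
  have hrep : ∀ f : C.F, ∃ f' ∈ C.edgeReps, f' = f ∨ f' = C.inv f := fun f =>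
    (mem_edgeReps_or f).elim (fun h => ⟨f, h, Or.inl rfl⟩) fun h => ⟨_, h, Or.inr rfl⟩
  obtain ⟨f, hfE, hf⟩ := hrep c.fst.flag
  obtain ⟨g, hgE, hg⟩ := hrep c.snd.flag
  have hx : C.Cross f g := Cross.of_same_edges ⟨c, rfl, rfl⟩ hf hg
  have hne : f ≠ g := by
    rintro rfl
    exact dcross_ne_zero_of_same_edges c.dcross_ne_zero hf hg (by
      simp only [dcross, cross]
      ring)
  rcases (C.flagKey.injective.ne hne).lt_or_gt with hlt | hlt
  · refine ⟨(f, g), mem_crossingPairs.2 ⟨hfE, hgE, hlt, hx⟩, fun c' h1 h2 m hm => ?_⟩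
    obtain ⟨h3, h4⟩ := Crossing.same_of_flags (c := c) (c' := c') (h1 ▸ hf) (h2 ▸ hg)
    exact attach_iso_of_same h3 h4 m hm
  · refine ⟨(g, f), mem_crossingPairs.2 ⟨hgE, hfE, hlt, hx.symm⟩, fun c' h1 h2 m hm => ?_⟩
    obtain ⟨h3, h4⟩ := Crossing.same_of_flags (c := c.swap) (c' := c') (h1 ▸ hg) (h2 ▸ hf)
    obtain ⟨φ⟩ := c.attach_swap_iso m hm
    obtain ⟨ψ⟩ := attach_iso_of_same h3 h4 m hm
    exact ⟨φ.trans ψ⟩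

/-- A crossing of the two edges of a pair. -/
def pairCrossing (x : C.crossingPairs) : C.Crossing := (mem_crossingPairs.1 x.2).2.2.2.choose

lemma pairCrossing_fst (x : C.crossingPairs) : (pairCrossing x).fst.flag = x.1.1 :=
  (mem_crossingPairs.1 x.2).2.2.2.choose_spec.1

lemma pairCrossing_snd (x : C.crossingPairs) : (pairCrossing x).snd.flag = x.1.2 :=
  (mem_crossingPairs.1 x.2).2.2.2.choose_spec.2

lemma EdgePoint.Same.flag_eq {x y : C.EdgePoint} (h : x.Same y) (hx : x.flag ∈ C.edgeReps)
    (hy : y.flag ∈ C.edgeReps) : y.flag = x.flag := by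
  rcases h with ⟨h1, -⟩ | ⟨h0, h1, -⟩
  · exact h1
  · rw [h1] at hy
    exact absurd (eq_of_mem_edgeReps hx hy) h0

lemma Crossing.not_same (c : C.Crossing) : ¬ c.fst.Same c.snd := by
  rintro (⟨h, -⟩ | ⟨-, h, -⟩)
  · exact c.flag_ne h
  · exact c.flag_ne_inv h

/-- In a simple curve two different pairs of edges do not cross at the same point. -/
lemma IsSimple.pairCrossing_injective (hC : C.IsSimple) :
    Function.Injective fun x : C.crossingPairs => (pairCrossing x).fst.image := by
  intro x y hxy
  have hxy : (pairCrossing x).fst.image = (pairCrossing y).fst.image := hxy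
  obtain ⟨hx1, hx2, hx3, -⟩ := mem_crossingPairs.1 x.2
  obtain ⟨hy1, hy2, hy3, -⟩ := mem_crossingPairs.1 y.2
  -- A point of the plane has at most two preimages, so `z` lies on one of the two edges of `x`. The
  -- order of the flag numbers within each pair then fixes which edge is which.
  have key : ∀ z : C.EdgePoint, (pairCrossing x).fst.image = z.image → z.flag ∈ C.edgeReps →
      z.flag = x.1.1 ∨ z.flag = x.1.2 := by
    intro z hz hzE
    have hx1' := hx1
    have hx2' := hx2
    rw [← pairCrossing_fst] at hx1' ⊢
    rw [← pairCrossing_snd] at hx2' ⊢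
    rcases hC.at_most_two (pairCrossing x).fst (pairCrossing x).snd z
      (pairCrossing x).image_eq ((pairCrossing x).image_eq.symm.trans hz) with h | h | h
    · exact absurd h (pairCrossing x).not_same
    · exact Or.inr (h.flag_eq hx2' hzE)
    · exact Or.inl (h.flag_eq hx1' hzE)
  have h1 := key (pairCrossing y).fst hxy (by rwa [pairCrossing_fst])
  have h2 := key (pairCrossing y).snd (hxy.trans (pairCrossing y).image_eq)
    (by rwa [pairCrossing_snd])
  rw [pairCrossing_fst] at h1
  rw [pairCrossing_snd] at h2
  refine Subtype.ext (Prod.ext ?_ ?_)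
  · rcases h1 with h1 | h1
    · exact h1.symm
    · rcases h2 with h2 | h2
      · rw [h1, h2] at hy3
        exact absurd hy3 hx3.not_gt
      · rw [h1, h2] at hy3
        exact absurd hy3 (lt_irrefl _)
  · rcases h2 with h2 | h2
    · rcases h1 with h1 | h1
      · rw [h1, h2] at hy3
        exact absurd hy3 (lt_irrefl _)
      · rw [h1, h2] at hy3
        exact absurd hy3 hx3.not_gt
    · exact h2.symm

lemma Cross.not_self (f : C.F) : ¬ C.Cross f f := by
  rintro ⟨c, h1, h2⟩
  exact c.flag_ne (h2.trans h1.symm)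

lemma sum_crossingPairs : 2 * ∑ x ∈ C.crossingPairs, (det2 (C.dir x.1) (C.dir x.2)).natAbs =
    ∑ f ∈ C.edgeReps, ∑ g ∈ C.edgeReps,
      if C.Cross f g then (det2 (C.dir f) (C.dir g)).natAbs else 0 := by
  have hcomm : ∀ a b, (det2 a b).natAbs = (det2 b a).natAbs := fun a b => by
    rw [← Int.natAbs_neg]; congr 1; rw [det2, det2]; ring
  let φ : C.F → C.F → ℕ := fun f g => if C.flagKey f < C.flagKey g ∧ C.Cross f g then
    (det2 (C.dir f) (C.dir g)).natAbs else 0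
  have h1 : ∑ x ∈ C.crossingPairs, (det2 (C.dir x.1) (C.dir x.2)).natAbs =
      ∑ f ∈ C.edgeReps, ∑ g ∈ C.edgeReps, φ f g := by
    rw [← Finset.sum_product' C.edgeReps C.edgeReps φ]
    simp only [φ]
    rw [← Finset.sum_filter]
    refine Finset.sum_congr ?_ fun _ _ => rfl
    ext x
    rw [mem_crossingPairs, Finset.mem_filter, Finset.mem_product, and_assoc]
  have h2 : ∀ f g, (if C.Cross f g then (det2 (C.dir f) (C.dir g)).natAbs else 0) =
      φ f g + φ g f := by
    intro f g
    by_cases h : C.Cross f g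
    · have hne : f ≠ g := by
        rintro rfl
        exact Cross.not_self f h
      rcases (C.flagKey.injective.ne hne).lt_or_gt with hlt | hlt
      · simp [φ, h, hlt, hlt.not_gt]
      · simp [φ, h, h.symm, hlt, hlt.not_gt, hcomm (C.dir g)]
    · have h' : ¬ C.Cross g f := fun h' => h h'.symm
      simp [φ, h, h']
  simp only [h1, h2, Finset.sum_add_distrib]
  rw [Finset.sum_comm (f := fun f g => φ g f), two_mul]

end Crossings

/-! ### Summation over the isomorphism classes of elliptic curves -/

section Lifts

variable {n : ℕ} {C : PlaneGraph n} {d : ℕ} {p : Fin n → Fin 2 → ℝ} {l : ℝ}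

/-- The elliptic curves with `j`-invariant `l` built out of a rational curve. -/
def lift (hC : C.IsTree) (hl : 0 < l) (hP : ∀ c : C.Crossing, c.pathLength hC < l) :
    {v // C.IsUnmarkedVertex v} ⊕ C.crossingPairs → PlaneGraph n
  | Sum.inl v => C.attachLoop v l hl
  | Sum.inr x => (pairCrossing x).attach _ (sub_pos.2 (hP (pairCrossing x)))

/-- The multiplicity of an elliptic curve relative to that of the rational curve. -/
def liftMult (C : PlaneGraph n) : {v // C.IsUnmarkedVertex v} ⊕ C.crossingPairs → ℚ
  | Sum.inl v => ((C.vertexMult v : ℚ) - 1) / 2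
  | Sum.inr x => (det2 (C.dir x.1.1) (C.dir x.1.2)).natAbs

lemma Iso.isoClass_eq {C D : PlaneGraph n} (φ : Iso C D) : C.isoClass = D.isoClass :=
  Quotient.sound ⟨φ⟩

lemma nonempty_iso_of_isoClass_eq {C D : PlaneGraph n} (h : C.isoClass = D.isoClass) :
    Nonempty (Iso C D) :=
  Quotient.exact h

/-- The prescribed j-invariant forces the length of the new edge, and up to isomorphism the curve
only depends on the pair of crossing edges, not on their order or on the flags describing them. -/
lemma ellipticLifts_eq_range (hC : C.IsTree) (h3 : ∀ v, C.val v = 3) (hl : 0 < l)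
    (hP : ∀ c : C.Crossing, c.pathLength hC < l) :
    C.ellipticLifts l = Set.range fun i => (lift hC hl hP i).isoClass := by
  ext q
  constructor
  · rintro (⟨v, m, hm, -, hu, hj, rfl⟩ | ⟨c, m, hm, hj, rfl⟩)
    · obtain rfl : m = l := (attachLoop_j hC v hm).symm.trans hj
      exact ⟨Sum.inl ⟨v, hu⟩, rfl⟩
    · obtain ⟨x, hx, hiso⟩ := c.exists_pair
      obtain ⟨φ⟩ := hiso (pairCrossing ⟨x, hx⟩) (pairCrossing_fst _) (pairCrossing_snd _) m hm
      have hm' : m = l - (pairCrossing ⟨x, hx⟩).pathLength hC := by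
        rw [← φ.j_eq, Crossing.attach_j hC] at hj
        linarith
      subst hm'
      exact ⟨Sum.inr ⟨x, hx⟩, φ.symm.isoClass_eq⟩
  · rintro ⟨v | x, rfl⟩
    · exact Or.inl ⟨v, l, hl, h3 v, v.2, attachLoop_j hC v hl, rfl⟩
    · refine Or.inr ⟨pairCrossing x, _, sub_pos.2 (hP (pairCrossing x)), ?_, rfl⟩
      rw [Crossing.attach_j hC]
      ring

/-- The only contracted bounded edge is the new one, and isomorphisms preserve its image. In a
simple curve the vertices have distinct images, none of them a crossing, and different pairs of
edges cross at different points. -/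
lemma lift_injective (hC : C.IsTree) (hs : C.IsSimple) (hl : 0 < l)
    (hP : ∀ c : C.Crossing, c.pathLength hC < l) :
    Function.Injective fun i => (lift hC hl hP i).isoClass := by
  have hloop : ∀ v, (lift hC hl hP (Sum.inl v)).contractedPoints = {C.pos v} := fun v =>
    attachEdge_contractedPoints (hvw := rfl) (hm := hl) hs.dir_ne_zero
  have hcross : ∀ x, (lift hC hl hP (Sum.inr x)).contractedPoints =
      {(pairCrossing x).fst.image} := fun x =>
    (pairCrossing x).attach_contractedPoints hs.dir_ne_zero _
  intro i i' h
  obtain ⟨φ⟩ := nonempty_iso_of_isoClass_eq h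
  have hφ := φ.contractedPoints_eq
  rcases i with v | x <;> rcases i' with v' | x'
  · rw [hloop, hloop, Set.singleton_eq_singleton_iff] at hφ
    rw [Subtype.ext (hs.pos_injective hφ)]
  · rw [hloop, hcross, Set.singleton_eq_singleton_iff] at hφ
    exact absurd hφ (hs.vertex_ne_point _ _)
  · rw [hloop, hcross, Set.singleton_eq_singleton_iff] at hφ
    exact absurd hφ.symm (hs.vertex_ne_point _ _)
  · rw [hcross, hcross, Set.singleton_eq_singleton_iff] at hφ
    rw [hs.pairCrossing_injective hφ]

lemma IsGeneric.lift_evjMult (h : C.IsGeneric d p) (hl : 0 < l)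
    (hP : ∀ c : C.Crossing, c.pathLength h.tree < l)
    (i : {v // C.IsUnmarkedVertex v} ⊕ C.crossingPairs) {D : PlaneGraph n}
    (φ : Iso (lift h.tree hl hP i) D) :
    D.cellDim = 2 * n + 1 ∧ D.evjMult = C.liftMult i * C.mult := by
  have hidx := h.index_evHom_range
  have hne : C.evHom.range.index ≠ 0 := by
    rw [hidx]
    exact h.mult_ne_zero
  rcases i with v | x
  · have := attachLoop_evjMult h.tree h.evHom_injective hne (h.isSimple.trivalent v) v.2 φ
    rwa [hidx] at this
  · have := (pairCrossing x).attach_evjMult h.tree h.evHom_injective hne φ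
    rwa [hidx, pairCrossing_fst, pairCrossing_snd] at this

lemma IsGeneric.lift_properties (h : C.IsGeneric d p) (hl : 0 < l)
    (hP : ∀ c : C.Crossing, c.pathLength h.tree < l)
    (i : {v // C.IsUnmarkedVertex v} ⊕ C.crossingPairs) {D : PlaneGraph n}
    (φ : Iso (lift h.tree hl hP i) D) :
    D.IsTropicalCurve ∧ D.Connected ∧ D.genus = 1 ∧ D.HasDegree d ∧ (∀ i, D.ev i = p i) ∧
      D.j = l := by
  rw [φ.genus_eq, φ.j_eq]
  suffices (lift h.tree hl hP i).IsTropicalCurve ∧ (lift h.tree hl hP i).Connected ∧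
      (lift h.tree hl hP i).genus = 1 ∧ (lift h.tree hl hP i).HasDegree d ∧
      (∀ k, (lift h.tree hl hP i).ev k = p k) ∧ (lift h.tree hl hP i).j = l from
    ⟨φ.isTropicalCurve this.1, φ.connected this.2.1, this.2.2.1, φ.hasDegree this.2.2.2.1,
      fun k => (φ.ev_eq k).trans (this.2.2.2.2.1 k), this.2.2.2.2.2⟩
  rcases i with v | x
  · refine ⟨attachLoop_isTropicalCurve h.tropical _ _,
      h.tree.1.attachEdge (hvw := rfl) (hm := hl), ?_,
      h.degree.attachEdge (hvw := rfl) (hm := hl), h.ev_eq, attachLoop_j h.tree v hl⟩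
    refine (attachEdge_genus (hvw := rfl) (hm := hl)).trans ?_
    rw [h.tree.2, zero_add]
  · refine ⟨(pairCrossing x).attach_isTropicalCurve h.tropical _,
      (pairCrossing x).attach_connected h.tree _, (pairCrossing x).attach_genus h.tree _,
      (pairCrossing x).attach_hasDegree h.degree _, h.ev_eq, ?_⟩
    refine ((pairCrossing x).attach_j h.tree _).trans ?_
    ring

/-- The multiplicity of a trivalent vertex can be computed from any two of its flags, and a marked
flag has direction 0. The Bézout identity, a sum over all vertices, thus only involves the unmarked
ones. -/
lemma IsSimple.vertexMult_marked (hC : C.IsSimple) {v : C.V} (hv : ¬ C.IsUnmarkedVertex v) :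
    C.vertexMult v = 0 := by
  obtain ⟨i, hi⟩ := not_forall.1 hv
  obtain rfl := not_not.1 hi
  have h3 := hC.trivalent (C.bdry (C.mark i))
  obtain ⟨g, hg, hne⟩ := Finset.exists_mem_ne (by rw [← val, h3]; norm_num) (C.mark i)
  rw [vertexMult_eq_natAbs h3 hne.symm (Finset.mem_filter.1 hg).2, C.mark_dir]
  simp [det2]

/-- There are 2n - 1 vertices, n of them marked, so n - 1 = 3d - 2 are unmarked. By the Bézout
identity the sum is (d² - (3d - 2))/2 = (d - 1)(d - 2)/2. -/
lemma IsGeneric.sum_liftMult (h : C.IsGeneric d p) :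
    ∑ i, C.liftMult i = ((d - 1).choose 2 : ℕ) := by
  have h1 := h.isSimple.sum_crossings h.degree
  rw [← C.sum_crossingPairs] at h1
  have h2 : ∑ v, C.vertexMult v = ∑ v : {v // C.IsUnmarkedVertex v}, C.vertexMult v := by
    rw [← Finset.sum_subtype (Finset.univ.filter fun v => C.IsUnmarkedVertex v) (fun v => by
      rw [Finset.mem_filter]; exact and_iff_right (Finset.mem_univ v)) C.vertexMult]
    refine (Finset.sum_subset (Finset.subset_univ _) fun v _ hv => ?_).symm
    refine h.isSimple.vertexMult_marked fun hu => hv ?_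
    rw [Finset.mem_filter]
    exact ⟨Finset.mem_univ v, hu⟩
  rw [h2] at h1
  have h3 := h.ranking.card_unmarked
  have h4 := h.card_vertices
  have h5 := h.card_eq
  obtain ⟨e, rfl⟩ : ∃ e, d = e + 1 := ⟨d - 1, by omega⟩
  have h6 : Fintype.card {v // C.IsUnmarkedVertex v} = 3 * e + 1 := by omega
  rw [Fintype.sum_sum_type]
  simp only [liftMult]
  rw [← Finset.sum_div, Finset.sum_sub_distrib, Finset.sum_const, Finset.card_univ, h6,
    Finset.sum_coe_sort C.crossingPairs
      fun x => ((det2 (C.dir x.1) (C.dir x.2)).natAbs : ℚ), Nat.add_sub_cancel,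
    Nat.cast_choose_two]
  have h7 : (2 : ℚ) * ∑ x ∈ C.crossingPairs, ((det2 (C.dir x.1) (C.dir x.2)).natAbs : ℚ) +
      ∑ v : {v // C.IsUnmarkedVertex v}, (C.vertexMult v : ℚ) = (e + 1) ^ 2 := by
    exact_mod_cast h1
  rw [nsmul_eq_mul]
  push_cast
  linear_combination h7 / 2

lemma IsGeneric.finsum_evjMult (h : C.IsGeneric d p) (hl : 0 < l)
    (hP : ∀ c : C.Crossing, c.pathLength h.tree < l) (r : IsoClass n → PlaneGraph n)
    (hr : ∀ q, (r q).isoClass = q) :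
    ∑ᶠ q ∈ C.ellipticLifts l, (r q).evjMult = (((d - 1).choose 2 * C.mult : ℕ) : ℚ) := by
  rw [ellipticLifts_eq_range h.tree h.isSimple.trivalent hl hP,
    finsum_mem_range (lift_injective h.tree h.isSimple hl hP), finsum_eq_sum_of_fintype,
    Nat.cast_mul, ← h.sum_liftMult, Finset.sum_mul]
  refine Finset.sum_congr rfl fun i _ => ?_
  obtain ⟨φ⟩ := nonempty_iso_of_isoClass_eq (hr (lift h.tree hl hP i).isoClass).symm
  exact (h.lift_evjMult hl hP i φ).2

lemma finite_ellipticLifts (hC : C.IsTree) (h3 : ∀ v, C.val v = 3) (hl : 0 < l)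
    (hP : ∀ c : C.Crossing, c.pathLength hC < l) : (C.ellipticLifts l).Finite := by
  rw [ellipticLifts_eq_range hC h3 hl hP]
  exact Set.finite_range _

end Lifts

end PlaneGraph

end TropicalElliptic

end

open TropicalElliptic PlaneGraph in
theorem mainTheorem6 (d : ℕ) (hd : 1 ≤ d) (p : Fin (3 * d - 1) → Fin 2 → ℝ)
    (hp : InTropicalGeneralPosition p) :
    ∃ L : ℝ, ∀ l : ℝ, L < l → ∀ C' : PlaneGraph (3 * d - 1),
      C'.IsTropicalCurve → C'.Connected → C'.genus = 0 → C'.HasDegree d →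
      (∀ i, C'.ev i = p i) →
        -- every vertex of `C'` and every crossing of `C'` gives rise to an elliptic curve
        (∀ v : C'.V, C'.IsUnmarkedVertex v →
          C'.val v = 3 ∧ ∃! m : {m : ℝ // 0 < m}, (C'.attachLoop v m.1 m.2).j = l) ∧
        (∀ c : C'.Crossing, ∃! m : {m : ℝ // 0 < m}, (c.attach m.1 m.2).j = l) ∧
        -- the curves obtained are elliptic curves through the points, with `j`-invariant `l`,
        -- in cells of top dimension
        (∀ C : PlaneGraph (3 * d - 1), C.isoClass ∈ C'.ellipticLifts l →
          C.IsTropicalCurve ∧ C.Connected ∧ C.genus = 1 ∧ C.HasDegree d ∧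
          (∀ i, C.ev i = p i) ∧ C.j = l ∧ C.cellDim = 3 * d + (3 * d - 1)) ∧
        -- there are finitely many of them, and their multiplicities add up as claimed
        (C'.ellipticLifts l).Finite ∧
        ∀ r : IsoClass (3 * d - 1) → PlaneGraph (3 * d - 1), (∀ q, (r q).isoClass = q) →
          ∑ᶠ q ∈ C'.ellipticLifts l, (r q).evjMult =
            (((d - 1).choose 2 * C'.mult : ℕ) : ℚ) := by
  obtain ⟨L, hL0, hL⟩ := exists_pathLength_bound (3 * d - 1) d p
  refine ⟨L, fun l hl C htrop hconn hgenus hdeg hev => ?_⟩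
  have h : C.IsGeneric d p := ⟨hp, by omega, htrop, ⟨hconn, hgenus⟩, hdeg, hev⟩
  have hl0 : 0 < l := hL0.trans_lt hl
  have hP : ∀ c : C.Crossing, c.pathLength h.tree < l := fun c => (hL C h c).trans_lt hl
  refine ⟨fun v _ => ⟨h.isSimple.trivalent v, ⟨l, hl0⟩, attachLoop_j h.tree v hl0,
    fun m hm => Subtype.ext ((attachLoop_j h.tree v m.2).symm.trans hm)⟩, fun c => ?_, ?_,
    finite_ellipticLifts h.tree h.isSimple.trivalent hl0 hP, h.finsum_evjMult hl0 hP⟩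
  -- The j-invariant is the new length plus the length of the path in `C`, which is below l by the
  -- choice of L.
  · refine ⟨⟨l - c.pathLength h.tree, sub_pos.2 (hP c)⟩, ?_, fun m hm => Subtype.ext ?_⟩
    · exact (c.attach_j h.tree _).trans (sub_add_cancel _ _)
    · exact eq_sub_of_add_eq ((c.attach_j h.tree m.2).symm.trans hm)
  · intro D hD
    rw [ellipticLifts_eq_range h.tree h.isSimple.trivalent hl0 hP] at hD
    obtain ⟨i, hi⟩ := hD
    obtain ⟨φ⟩ := nonempty_iso_of_isoClass_eq hi
    obtain ⟨h1, h2, h3, h4, h5, h6⟩ := h.lift_properties hl0 hP i φ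
    refine ⟨h1, h2, h3, h4, h5, h6, (h.lift_evjMult hl0 hP i φ).1.trans ?_⟩
    omega
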